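/- **Setting.** An instance of $k$-median with outliers consists of a finite set $F$ of potential median locations, a finite set $C$ of points, a metric $d$ on $F\cup C$ and integers $k\ge 1$, $z\ge 0$. A solution is a set $S\subseteq F$ of $k$ medians (of $\min(k,|F|)$ medians, while fewer than $k$ locations are available). Its cost with a set $O\subseteq C$ of outliers is $\sum_{j\in C\setminus O} d(j,S)$, where $d(j,S)=\min_{i\in S}d(j,i)$, and $\mathrm{opt}$ is the minimum of this cost over all solutions $S$ and all $O\subseteq C$ with $|O|=\min(z,|C|)$. A solution $S$ is a $(\beta,\alpha)$-bicriteria approximation if there is $O\subseteq C$ with $|O|\le\beta z$ and $\sum_{j\in C\setminus O} d(j,S)\le\alpha\cdot\mathrm{opt}$. In the online problem $k$ and $z$ are given at the beginning and $n\ge z$ points $j_1,\dots,j_n$ arrive one by one; $n$ is not known in advance. In the *static-$F$ setting* $F$ is fixed and given at the beginning, $k\le |F|$, and the arrival of $j_t$ reveals its distances to $F$. In the *$F=C$ setting* $k\le n$, the arrival of $j_t$ reveals its distances to $j_1,\dots,j_{t-1}$, and $j_t$ is then added to both $C$ and $F$. After each arrival the algorithm outputs a solution $S_t$ for the current instance,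 with $C=\{j_1,\dots,j_t\}$. All distances among the points of $F\cup C$ are integers, and $D$ denotes the diameter of $F\cup\{j_1,\dots,j_n\}$. The total recourse is $\sum_{t=1}^n|S_t\setminus S_{t-1}|$ with $S_0=\emptyset$. Running time is the total time of a deterministic random access machine with addition and subtraction and logarithmic cost (every operation is charged one plus the number of bits of its result). **Lemma.** There are absolute constants $\varepsilon_0\in(0,1]$, $A>0$ and $c\in\mathbb N$ such that for every integer $\ell\ge1$ and all reals $0<\varepsilon<\varepsilon_0$ and $\gamma>0$, in each of the two settings there are a deterministic online algorithm and a constant $K=K(\ell,\varepsilon,\gamma)$ such that on every instance: 1. for every $1\le t\le n$ the solution $S_t$ is, for the instance at time $t$, a $$\Big(\tfrac1{1-\varepsilon}\big(1+\tfrac1\ell\big)(1+\gamma),\ \tfrac1{1-\varepsilon}\big(3+\tfrac2\ell\big)\big(1+\tfrac2\gamma\big)\Big)\text{-bicriteria approximation}$$ in the static-$F$ setting, and a $$\Big(\tfrac1{1-\varepsilon}\big(1+\tfrac1\ell\big)(1+\gamma),\ \tfrac1{1-\varepsilon}\big(3+\tfrac2\ell\big)\big(1+\tfrac4\gamma\big)\Big)\text{-bicriteria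 approximation}$$ in the $F=C$ setting; 2. if $n\ge2$ and $D\ge1$, the total recourse is at most $A\cdot\dfrac{k^2\,\log n\,\log(nD)}{\varepsilon}$; 3. the total running time over all $n$ arrivals is at most $K\,(n+|F|)^{c\ell}\,(1+\log(1+D))^{c}$ in the static-$F$ setting and at most $K\,n^{c\ell}\,(1+\log(1+D))^{c}$ in the $F=C$ setting; that is, $n^{O(\ell)}$ up to a factor polynomial in the number of bits of a distance, where in the static-$F$ setting the number of locations counts towards the size $n$ of the input. -/

import Mathlib

/-! ## Machine model

A deterministic random access machine with logarithmic cost, in structured form: the memory holds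
natural numbers in arrays `0, 1, 2, …`, the arithmetic operations are addition and truncated
subtraction, and array indices may be computed (indirect addressing).  Every operation is charged
`1` plus the number of bits of its result, so that an address is charged when it is computed, and
a stored or loaded number when it is moved. -/

namespace KMedianRAM

/-- `s a i` is the content of cell `i` of array `a`. -/
abbrev Store := ℕ → ℕ → ℕ

/-- Overwrite one cell. -/
def Store.write (s : Store) (a i v : ℕ) : Store :=
  fun b j => if b = a ∧ j = i then v else s b j

/-- Expressions. -/
inductive Expr where
  | const (v : ℕ)
  | get (a : ℕ) (idx : Expr)
  | add (x y : Expr)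
  | sub (x y : Expr)

/-- Value of an expression. -/
def Expr.eval (s : Store) : Expr → ℕ
  | .const v => v
  | .get a idx => s a (idx.eval s)
  | .add x y => x.eval s + y.eval s
  | .sub x y => x.eval s - y.eval s

/-- Cost of evaluating an expression: each node costs `1` plus the bit length of its value. -/
def Expr.cost (s : Store) : Expr → ℕ
  | .const v => 1 + v.size
  | .get a idx => 1 + (s a (idx.eval s)).size + idx.cost s
  | .add x y => 1 + (x.eval s + y.eval s).size + x.cost s + y.cost s
  | .sub x y => 1 + (x.eval s - y.eval s).size + x.cost s + y.cost s

/-- Programs. The tests of `ite` and `loop` (a while loop) succeed on nonzero values. -/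
inductive Prog where
  | skip
  | set (a : ℕ) (idx e : Expr)
  | seq (p q : Prog)
  | ite (e : Expr) (p q : Prog)
  | loop (e : Expr) (p : Prog)

/-- `Exec p s s' T`: started in memory `s`, the program `p` halts in memory `s'` after exactly
`T` units of time. -/
inductive Exec : Prog → Store → Store → ℕ → Prop
  | skip (s : Store) : Exec .skip s s 1
  | set (s : Store) (a : ℕ) (idx e : Expr) :
      Exec (.set a idx e) s (s.write a (idx.eval s) (e.eval s)) (1 + idx.cost s + e.cost s)
  | seq {p q : Prog} {s s' s'' : Store} {T T' : ℕ} :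
      Exec p s s' T → Exec q s' s'' T' → Exec (.seq p q) s s'' (T + T')
  | ite_true {e : Expr} {p q : Prog} {s s' : Store} {T : ℕ} :
      e.eval s ≠ 0 → Exec p s s' T → Exec (.ite e p q) s s' (1 + e.cost s + T)
  | ite_false {e : Expr} {p q : Prog} {s s' : Store} {T : ℕ} :
      e.eval s = 0 → Exec q s s' T → Exec (.ite e p q) s s' (1 + e.cost s + T)
  | loop_done {e : Expr} {p : Prog} {s : Store} :
      e.eval s = 0 → Exec (.loop e p) s s (1 + e.cost s)
  | loop_step {e : Expr} {p : Prog} {s s' s'' : Store} {T T' : ℕ} :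
      e.eval s ≠ 0 → Exec p s s' T → Exec (.loop e p) s' s'' T' →
      Exec (.loop e p) s s'' (1 + e.cost s + T + T')

/-- The machine is deterministic: result and running time are determined by the start. -/
theorem Exec.deterministic {p : Prog} {s s₁ : Store} {T₁ : ℕ} (h₁ : Exec p s s₁ T₁) :
    ∀ {s₂ : Store} {T₂ : ℕ}, Exec p s s₂ T₂ → s₁ = s₂ ∧ T₁ = T₂ := by
  induction h₁ with
  | skip s => intro s₂ T₂ h; cases h; exact ⟨rfl, rfl⟩
  | set s a idx e => intro s₂ T₂ h; cases h; exact ⟨rfl, rfl⟩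
  | seq _ _ ih ih' =>
    intro s₂ T₂ h
    cases h with
    | seq a b =>
      obtain ⟨rfl, rfl⟩ := ih a
      obtain ⟨rfl, rfl⟩ := ih' b
      exact ⟨rfl, rfl⟩
  | ite_true he _ ih =>
    intro s₂ T₂ h
    cases h with
    | ite_true _ a => obtain ⟨rfl, rfl⟩ := ih a; exact ⟨rfl, rfl⟩
    | ite_false he' _ => exact absurd he' he
  | ite_false he _ ih =>
    intro s₂ T₂ h
    cases h with
    | ite_true he' _ => exact absurd he he'
    | ite_false _ a => obtain ⟨rfl, rfl⟩ := ih a; exact ⟨rfl, rfl⟩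
  | loop_done he =>
    intro s₂ T₂ h
    cases h with
    | loop_done _ => exact ⟨rfl, rfl⟩
    | loop_step he' _ _ => exact absurd he he'
  | loop_step he _ _ ih ih' =>
    intro s₂ T₂ h
    cases h with
    | loop_done he' => exact absurd he' he
    | loop_step _ a b =>
      obtain ⟨rfl, rfl⟩ := ih a
      obtain ⟨rfl, rfl⟩ := ih' b
      exact ⟨rfl, rfl⟩

/-! ## Online algorithms

An online algorithm is a program that is executed once for every arriving point, on a memory that
persists between arrivals.  Array `0` receives the data of the arriving point, array `1` holds the
parameters given at the beginning, and array `2` is the output: location `i` is a chosen median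
iff cell `i` of array `2` is nonzero. -/

/-- Initial memory: the number `m` of locations given at the beginning, `k` and `z`; all other
cells are `0`. -/
def initStore (m k z : ℕ) : Store := fun a i =>
  if a = 1 then (if i = 0 then m else if i = 1 then k else if i = 2 then z else 0) else 0

/-- Replace the contents of the input array by the numbers `row 0, …, row (len - 1)`. -/
def feed (s : Store) (len : ℕ) (row : ℕ → ℕ) : Store := fun a i =>
  if a = 0 then (if i < len then row i else 0) else s a i

/-- The medians among the locations `0, …, N - 1` that are chosen in memory `s`. -/
def medians (s : Store) (N : ℕ) : Finset ℕ := (Finset.range N).filter fun i => s 2 i ≠ 0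

/-- `σ 0, …, σ n` are the memories before the first arrival and after each of `n` arrivals,
where arrival number `t < n` reveals the `len t` numbers `row t 0, row t 1, …`, and `τ t` is the
time spent on it. -/
def IsOnlineRun (P : Prog) (s₀ : Store) (len : ℕ → ℕ) (row : ℕ → ℕ → ℕ) (n : ℕ)
    (σ : ℕ → Store) (τ : ℕ → ℕ) : Prop :=
  σ 0 = s₀ ∧ ∀ t < n, Exec P (feed (σ t) (len t) (row t)) (σ (t + 1)) (τ t)

end KMedianRAM

/-! ## The `k`-median problem with outliers

Points to be clustered are `x j` for `j` in a finite set `C` of indices, and the potential median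
locations are `f i` for `i` in a finite set `F` of indices. -/

namespace KMedianOutliers

variable {X : Type} [MetricSpace X]

/-- `∑_{j ∈ C} d(j, S)`, for nonempty `S`. -/
noncomputable def cost (f x : ℕ → X) (C S : Finset ℕ) : ℝ :=
  ∑ j ∈ C, Metric.infDist (x j) (f '' (S : Set ℕ))

/-- A solution is a set of `k` locations (of all locations, while there are fewer than `k`). -/
def IsSolution (F : Finset ℕ) (k : ℕ) (S : Finset ℕ) : Prop :=
  S ⊆ F ∧ S.card = min k F.card

/-- The optimum cost with `z` outliers (with all points as outliers, while there are fewer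
than `z`). The infimum is over a finite nonempty set. -/
noncomputable def opt (f x : ℕ → X) (F C : Finset ℕ) (k z : ℕ) : ℝ :=
  sInf {v : ℝ | ∃ S O : Finset ℕ, IsSolution F k S ∧ O ⊆ C ∧ O.card = min z C.card ∧
    v = cost f x (C \ O) S}

/-- `(β, α)`-bicriteria approximation. -/
def IsBicriteria (f x : ℕ → X) (F C : Finset ℕ) (k z : ℕ) (β α : ℝ) (S : Finset ℕ) : Prop :=
  IsSolution F k S ∧ ∃ O ⊆ C, (O.card : ℝ) ≤ β * z ∧
    cost f x (C \ O) S ≤ α * opt f x F C k z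

/-- All distances within `A` are integers. -/
def IntegralDist (A : Set X) : Prop := ∀ p ∈ A, ∀ q ∈ A, ∃ a : ℕ, dist p q = a

/-- Total recourse of the sequence of solutions `S 0, S 1, …, S n`. -/
def recourse (S : ℕ → Finset ℕ) (n : ℕ) : ℕ :=
  ∑ t ∈ Finset.range n, (S (t + 1) \ S t).card

end KMedianOutliers

/-! The algorithm is local search on the truncated cost ∑ min(p, d(j, S)), with a penalty p that
starts at 1 and is only ever doubled. An exchange is made only if it lowers the cost by more than
the fraction d/(kE), where d ≤ ℓ bounds its size and E lies between 1/ε and 2/ε. If no such exchange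
exists and more than (num/den)·z points are at distance at least p from S, then p is doubled; if
none exists and there are fewer far points, the arrival is finished and the far points serve as
outliers.

Approximation. Averaging the local optimality inequality over a suitable family of exchanges
(`sum_swaps_nonneg`, `LocalOpt.cost_le`) gives (1 - 1/E)·cost ≤ (3 + 2/ℓ)·opt + (1 + 1/ℓ)·p·z. When
p is about to be doubled, the far points alone cost at least p·(num/den)·z, and num/den is chosen so
that this forces γ(1 + 1/ℓ)·p·z ≤ (3 + 2/ℓ)·opt (`Violated.le_opt`). After the doubling, the penalty
term is thus at most 2/γ times the optimum term at that moment. That older optimum is at most κ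
times the current one: κ = 1 for fixed F (`opt_mono`), and κ = 2 for F = C, where old optimal
medians may not have arrived yet (`opt_self_le_two_mul`). This is the source of 2/γ and 4/γ. As long
as p = 1, integrality makes every point that is not far a point at distance 0.

Recourse. The potential is log(1 + cost). An exchange with size bound d lowers it by at least
d/(2kE) (`EffSwap.le_log`) and a doubling raises it by at most log 2, so it remains to bound the
increase caused by arrivals. For each threshold u = 2^r, the arrivals that occur while the cost is
below u have insertion costs, capped at u, of total O(u·k·log n) (`PenaltySeq.sum_min_le`): compare
with the clusters of the solution at the last such moment, and charge a point with q predecessors in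
its cluster 2u/q. Summing over the O(log(nD)) scales bounds the total increase by O(k·log n·log(nD))
(`PenaltySeq.sum_log_le`); the factor 2kE gives the theorem.

Time. The search tries all sequences of at most ℓ single exchanges, and the same potential bounds
the number of iterations per arrival. The machine only adds and subtracts, so N unit-cost steps
lengthen the numbers in memory by O(N) bits; a polynomial number of steps therefore takes polynomial
logarithmic-cost time (`Steps.exec`). -/

namespace KMedianRAM

/-! ### Unit-cost execution -/

/-- Execution with unit cost: every assignment and every test counts as one step. -/
inductive Steps : Prog → Store → Store → ℕ → Prop
  | skip (s : Store) : Steps .skip s s 1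
  | set (s : Store) (a : ℕ) (idx e : Expr) :
      Steps (.set a idx e) s (s.write a (idx.eval s) (e.eval s)) 1
  | seq {p q : Prog} {s s' s'' : Store} {N N' : ℕ} :
      Steps p s s' N → Steps q s' s'' N' → Steps (.seq p q) s s'' (N + N')
  | ite_true {e : Expr} {p q : Prog} {s s' : Store} {N : ℕ} :
      e.eval s ≠ 0 → Steps p s s' N → Steps (.ite e p q) s s' (1 + N)
  | ite_false {e : Expr} {p q : Prog} {s s' : Store} {N : ℕ} :
      e.eval s = 0 → Steps q s s' N → Steps (.ite e p q) s s' (1 + N)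
  | loop_done {e : Expr} {p : Prog} {s : Store} :
      e.eval s = 0 → Steps (.loop e p) s s 1
  | loop_step {e : Expr} {p : Prog} {s s' s'' : Store} {N N' : ℕ} :
      e.eval s ≠ 0 → Steps p s s' N → Steps (.loop e p) s' s'' N' →
      Steps (.loop e p) s s'' (1 + N + N')

/-- A bound for the number of bits by which evaluating an expression can increase the numbers
in memory. -/
def Expr.weight : Expr → ℕ
  | .const v => 1 + v.size
  | .get _ idx => 1 + idx.weight
  | .add x y => 1 + x.weight + y.weight
  | .sub x y => 1 + x.weight + y.weight

/-- Total weight of the expressions of a program. -/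
def Prog.weight : Prog → ℕ
  | .skip => 1
  | .set _ idx e => 1 + idx.weight + e.weight
  | .seq p q => p.weight + q.weight
  | .ite e p q => 1 + e.weight + p.weight + q.weight
  | .loop e p => 1 + e.weight + p.weight

/-- All numbers in memory have at most `b` bits. -/
def BitBound (s : Store) (b : ℕ) : Prop := ∀ a i, (s a i).size ≤ b

theorem size_add_le {x y b : ℕ} (hx : x.size ≤ b) (hy : y.size ≤ b) : (x + y).size ≤ b + 1 := by
  rw [Nat.size_le] at *
  rw [pow_succ]
  omega

theorem size_le_of_le {x y : ℕ} (h : x ≤ y) : x.size ≤ y.size := Nat.size_le_size h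

theorem Expr.size_eval_le {s : Store} {b : ℕ} (hs : BitBound s b) (e : Expr) :
    (e.eval s).size ≤ b + e.weight := by
  induction e with
  | const v => simp only [Expr.eval, Expr.weight]; omega
  | get a idx ih => simp only [Expr.eval, Expr.weight]; have := hs a (idx.eval s); omega
  | add x y ihx ihy =>
    simp only [Expr.eval, Expr.weight]
    have := size_add_le (b := b + x.weight + y.weight) (x := x.eval s) (y := y.eval s)
      (by omega) (by omega)
    omega
  | sub x y ihx ihy =>
    simp only [Expr.eval, Expr.weight]
    have := size_le_of_le (Nat.sub_le (x.eval s) (y.eval s))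
    omega

/-- The weight bounds both the number of nodes and the excess bit length of every subexpression, so
each unit of weight pays for at most `1 + b + C`. -/
theorem Expr.cost_le {s : Store} {b C : ℕ} (hs : BitBound s b) (e : Expr) (hC : e.weight ≤ C) :
    e.cost s ≤ e.weight * (1 + b + C) := by
  induction e with
  | const v =>
    simp only [Expr.cost, Expr.weight] at *
    nlinarith [Nat.zero_le b, Nat.zero_le C, Nat.zero_le v.size, Nat.zero_le (v.size * b),
      Nat.zero_le (v.size * C)]
  | get a idx ih =>
    have h := Expr.size_eval_le hs (.get a idx)
    simp only [Expr.cost, Expr.weight, Expr.eval] at *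
    have := ih (by omega)
    have := hs a (idx.eval s)
    rw [add_mul]
    omega
  | add x y ihx ihy =>
    have h := Expr.size_eval_le hs (.add x y)
    simp only [Expr.cost, Expr.weight, Expr.eval] at *
    have := ihx (by omega)
    have := ihy (by omega)
    rw [add_mul, add_mul]
    omega
  | sub x y ihx ihy =>
    have h := Expr.size_eval_le hs (.sub x y)
    simp only [Expr.cost, Expr.weight, Expr.eval] at *
    have := ihx (by omega)
    have := ihy (by omega)
    rw [add_mul, add_mul]
    omega

theorem BitBound.mono {s : Store} {b b' : ℕ} (h : BitBound s b) (hb : b ≤ b') : BitBound s b' :=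
  fun a i => (h a i).trans hb

/-- Since addition is the only operation that increases numbers, `N` steps take polynomial time
in `N` and the number of bits of the input. -/
theorem Steps.exec {p : Prog} {s s' : Store} {N : ℕ} (h : Steps p s s' N) {C : ℕ} :
    ∀ {b : ℕ}, p.weight ≤ C → BitBound s b →
      ∃ T, Exec p s s' T ∧ T ≤ N * (C * (1 + b + N * C)) ∧ BitBound s' (b + N * C) := by
  have test : ∀ {e : Expr} {s : Store} {b : ℕ}, 1 + e.weight ≤ C → BitBound s b →
      1 + e.cost s ≤ C * (1 + b + C) := by
    intro e s b hC hs
    have h1 := Expr.cost_le hs e (C := C) (by omega)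
    have h2 : (1 + e.weight) * (1 + b + C) ≤ C * (1 + b + C) := Nat.mul_le_mul_right _ hC
    nlinarith
  induction h with
  | skip s =>
    intro b hC hs
    simp only [Prog.weight] at hC
    refine ⟨1, .skip s, ?_, hs.mono (by omega)⟩
    nlinarith [Nat.zero_le (C * b), Nat.zero_le (C * C)]
  | set s a idx e =>
    intro b hC hs
    simp only [Prog.weight] at hC
    refine ⟨_, .set s a idx e, ?_, ?_⟩
    · have h1 := Expr.cost_le hs e (C := C) (by omega)
      have h2 := Expr.cost_le hs idx (C := C) (by omega)
      have h3 : (1 + idx.weight + e.weight) * (1 + b + C) ≤ C * (1 + b + C) :=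
        Nat.mul_le_mul_right _ hC
      nlinarith
    · intro a' i
      simp only [Store.write]
      split_ifs
      · have := Expr.size_eval_le hs e
        omega
      · have := hs a' i
        omega
  | @seq p q s s' s'' N N' _ _ ih ih' =>
    intro b hC hs
    simp only [Prog.weight] at hC
    obtain ⟨T, h1, h2, h3⟩ := ih (by omega) hs
    obtain ⟨T', h1', h2', h3'⟩ := ih' (by omega) h3
    refine ⟨T + T', .seq h1 h1', ?_, h3'.mono (by rw [add_mul]; omega)⟩
    have : N * (C * (1 + b + N * C)) ≤ N * (C * (1 + b + (N + N') * C)) := by gcongr; omega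
    have : N' * (C * (1 + (b + N * C) + N' * C)) = N' * (C * (1 + b + (N + N') * C)) := by ring
    rw [add_mul]
    omega
  | @ite_true e p q s s' N he _ ih =>
    intro b hC hs
    simp only [Prog.weight] at hC
    obtain ⟨T, h1, h2, h3⟩ := ih (by omega) hs
    refine ⟨_, .ite_true he h1, ?_, h3.mono (by rw [add_mul]; omega)⟩
    have h4 := test (e := e) (by omega) hs
    have : N * (C * (1 + b + N * C)) ≤ N * (C * (1 + b + (1 + N) * C)) := by gcongr; omega
    have : C * (1 + b + C) ≤ C * (1 + b + (1 + N) * C) := by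
      gcongr; nlinarith [Nat.zero_le (N * C)]
    rw [add_mul]
    omega
  | @ite_false e p q s s' N he _ ih =>
    intro b hC hs
    simp only [Prog.weight] at hC
    obtain ⟨T, h1, h2, h3⟩ := ih (by omega) hs
    refine ⟨_, .ite_false he h1, ?_, h3.mono (by rw [add_mul]; omega)⟩
    have h4 := test (e := e) (by omega) hs
    have : N * (C * (1 + b + N * C)) ≤ N * (C * (1 + b + (1 + N) * C)) := by gcongr; omega
    have : C * (1 + b + C) ≤ C * (1 + b + (1 + N) * C) := by
      gcongr; nlinarith [Nat.zero_le (N * C)]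
    rw [add_mul]
    omega
  | @loop_done e p s he =>
    intro b hC hs
    simp only [Prog.weight] at hC
    refine ⟨_, .loop_done he, ?_, hs.mono (by omega)⟩
    have h4 := test (e := e) (by omega) hs
    simpa using h4
  | @loop_step e p s s' s'' N N' he _ _ ih ih' =>
    intro b hC hs
    have hC' := hC
    simp only [Prog.weight] at hC
    obtain ⟨T, h1, h2, h3⟩ := ih (by omega) hs
    obtain ⟨T', h1', h2', h3'⟩ := ih' hC' h3
    refine ⟨_, .loop_step he h1 h1', ?_, h3'.mono (by rw [add_mul, add_mul]; omega)⟩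
    have h4 := test (e := e) (by omega) hs
    have : N * (C * (1 + b + N * C)) ≤ N * (C * (1 + b + (1 + N + N') * C)) := by
      gcongr; omega
    have : N' * (C * (1 + (b + N * C) + N' * C)) ≤ N' * (C * (1 + b + (1 + N + N') * C)) := by
      gcongr 2
      nlinarith
    have : C * (1 + b + C) ≤ C * (1 + b + (1 + N + N') * C) := by
      gcongr; nlinarith [Nat.zero_le (N * C), Nat.zero_le (N' * C)]
    rw [add_mul, add_mul]
    omega

/-! ### Program logic -/

/-- The arrays to which a program writes. -/
def Prog.writes : Prog → Finset ℕ
  | .skip => ∅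
  | .set a _ _ => {a}
  | .seq p q => p.writes ∪ q.writes
  | .ite _ p q => p.writes ∪ q.writes
  | .loop _ p => p.writes

/-- Framing is by whole arrays. Since every scalar has an array of its own, what survives a
subprogram can be read off from `Prog.writes` alone. -/
theorem Steps.frame {p : Prog} {s s' : Store} {N : ℕ} (h : Steps p s s' N) :
    ∀ a ∉ p.writes, s' a = s a := by
  induction h with
  | skip s => intros; rfl
  | set s a idx e =>
    intro b hb
    simp only [Prog.writes, Finset.mem_singleton] at hb
    funext j
    simp [Store.write, hb]
  | seq _ _ ih ih' =>
    intro a ha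
    simp only [Prog.writes, Finset.mem_union, not_or] at ha
    rw [ih' a ha.2, ih a ha.1]
  | ite_true _ _ ih =>
    intro a ha
    simp only [Prog.writes, Finset.mem_union, not_or] at ha
    exact ih a ha.1
  | ite_false _ _ ih =>
    intro a ha
    simp only [Prog.writes, Finset.mem_union, not_or] at ha
    exact ih a ha.2
  | loop_done _ => intros; rfl
  | loop_step _ _ _ ih ih' =>
    intro a ha
    rw [ih' a ha, ih a ha]

/-- Started in `s`, the program halts after at most `N` steps in a memory that satisfies `Q`. -/
def Runs (p : Prog) (s : Store) (N : ℕ) (Q : Store → Prop) : Prop :=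
  ∃ s' n, Steps p s s' n ∧ n ≤ N ∧ Q s'

theorem Runs.mono {p : Prog} {s : Store} {N N' : ℕ} {Q Q' : Store → Prop} (h : Runs p s N Q)
    (hN : N ≤ N') (hQ : ∀ s', (∀ a ∉ p.writes, s' a = s a) → Q s' → Q' s') : Runs p s N' Q' := by
  obtain ⟨s', n, h1, h2, h3⟩ := h
  exact ⟨s', n, h1, h2.trans hN, hQ s' h1.frame h3⟩

theorem Runs.skip {s : Store} {Q : Store → Prop} (h : Q s) : Runs .skip s 1 Q :=
  ⟨s, 1, .skip s, le_rfl, h⟩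

theorem Runs.set {s : Store} {a : ℕ} {idx e : Expr} {Q : Store → Prop}
    (h : Q (s.write a (idx.eval s) (e.eval s))) : Runs (.set a idx e) s 1 Q :=
  ⟨_, 1, .set s a idx e, le_rfl, h⟩

theorem Runs.seq {p q : Prog} {s : Store} {N N' : ℕ} {R Q : Store → Prop} (hp : Runs p s N R)
    (hq : ∀ s', (∀ a ∉ p.writes, s' a = s a) → R s' → Runs q s' N' Q) :
    Runs (.seq p q) s (N + N') Q := by
  obtain ⟨s', n, h1, h2, h3⟩ := hp
  obtain ⟨s'', n', h1', h2', h3'⟩ := hq s' h1.frame h3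
  exact ⟨s'', n + n', .seq h1 h1', by omega, h3'⟩

theorem Runs.set_seq {s : Store} {a : ℕ} {idx e : Expr} {q : Prog} {N : ℕ} {Q : Store → Prop}
    (h : Runs q (s.write a (idx.eval s) (e.eval s)) N Q) :
    Runs (.seq (.set a idx e) q) s (1 + N) Q := by
  obtain ⟨s', n, h1, h2, h3⟩ := h
  exact ⟨s', 1 + n, .seq (.set s a idx e) h1, by omega, h3⟩

theorem Runs.ite {e : Expr} {p q : Prog} {s : Store} {N : ℕ} {Q : Store → Prop}
    (hp : e.eval s ≠ 0 → Runs p s N Q) (hq : e.eval s = 0 → Runs q s N Q) :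
    Runs (.ite e p q) s (1 + N) Q := by
  by_cases he : e.eval s = 0
  · obtain ⟨s', n, h1, h2, h3⟩ := hq he
    exact ⟨s', 1 + n, .ite_false he h1, by omega, h3⟩
  · obtain ⟨s', n, h1, h2, h3⟩ := hp he
    exact ⟨s', 1 + n, .ite_true he h1, by omega, h3⟩

/-- A scalar variable, kept in cell `0` of its own array. -/
def var (a : ℕ) : Expr := .get a (.const 0)

/-- Assignment to a scalar variable. -/
def assign (a : ℕ) (e : Expr) : Prog := .set a (.const 0) e

/-- `forLoop v e p` executes `p` for `v = 0, 1, …, e - 1`. -/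
def forLoop (v : ℕ) (e : Expr) (p : Prog) : Prog :=
  .seq (assign v (.const 0))
    (.loop (.sub e (var v)) (.seq p (assign v (.add (var v) (.const 1)))))

@[simp] theorem eval_var (s : Store) (a : ℕ) : (var a).eval s = s a 0 := rfl

@[simp] theorem eval_const (s : Store) (v : ℕ) : (Expr.const v).eval s = v := rfl

@[simp] theorem eval_add (s : Store) (x y : Expr) :
    (Expr.add x y).eval s = x.eval s + y.eval s := rfl

@[simp] theorem eval_sub (s : Store) (x y : Expr) :
    (Expr.sub x y).eval s = x.eval s - y.eval s := rfl

@[simp] theorem eval_get (s : Store) (a : ℕ) (x : Expr) :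
    (Expr.get a x).eval s = s a (x.eval s) := rfl

theorem writes_forLoop (v : ℕ) (e : Expr) (p : Prog) :
    (forLoop v e p).writes = insert v p.writes := by
  ext a
  simp only [forLoop, assign, Prog.writes, Finset.mem_union, Finset.mem_singleton,
    Finset.mem_insert]
  tauto

@[simp] theorem write_same (s : Store) (a i v : ℕ) : s.write a i v a i = v := by
  simp [Store.write]

theorem write_ne (s : Store) {a b : ℕ} (i v : ℕ) (h : b ≠ a) : s.write a i v b = s b := by
  funext j; simp [Store.write, h]

theorem write_apply (s : Store) (a i v j : ℕ) :
    s.write a i v a j = if j = i then v else s a j := by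
  simp [Store.write]

/-- Rule for loops with an invariant. -/
theorem Runs.forLoop {v : ℕ} {e : Expr} {p : Prog} {s : Store} {n N : ℕ} (I : ℕ → Store → Prop)
    (hv : v ∉ p.writes)
    (he : ∀ s', (∀ a ∉ insert v p.writes, s' a = s a) → e.eval s' = n)
    (h0 : I 0 (s.write v 0 0))
    (hstep : ∀ i < n, ∀ s', (∀ a ∉ insert v p.writes, s' a = s a) → s' v 0 = i → I i s' →
      Runs p s' N (fun s'' => I (i + 1) (s''.write v 0 (i + 1)))) :
    Runs (forLoop v e p) s (2 + n * (N + 2)) (I n) := by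
  -- Induction on the number `r` of remaining rounds. The body must establish the invariant after
  -- the increment of the counter, hence the `write` in `hstep`.
  have key : ∀ r i s', i + r = n → (∀ a ∉ insert v p.writes, s' a = s a) → s' v 0 = i → I i s' →
      Runs (.loop (.sub e (var v)) (.seq p (assign v (.add (var v) (.const 1))))) s'
        (1 + r * (N + 2)) (I n) := by
    intro r
    induction r with
    | zero =>
      intro i s' hi hs hvi hI
      obtain rfl : i = n := by omega
      refine ⟨s', 1, .loop_done ?_, by omega, hI⟩
      simp [he s' hs, hvi]
    | succ r ih =>
      intro i s' hi hs hvi hI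
      obtain ⟨s₁, n₁, h1, h2, h3⟩ := hstep i (by omega) s' hs hvi hI
      have hf := h1.frame
      obtain ⟨s₂, n₂, h1', h2', h3'⟩ := ih (i + 1) (s₁.write v 0 (i + 1)) (by omega) (by
        intro a ha
        have ha' := ha
        simp only [Finset.mem_insert, not_or] at ha'
        rw [write_ne _ _ _ ha'.1, hf a ha'.2, hs a ha]) (by simp) h3
      have hset : Steps (assign v (.add (var v) (.const 1))) s₁ (s₁.write v 0 (i + 1)) 1 := by
        have := Steps.set s₁ v (.const 0) (.add (var v) (.const 1))
        simpa [assign, hf v hv, hvi] using this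
      refine ⟨s₂, _, .loop_step ?_ (.seq h1 hset) h1', ?_, h3'⟩
      · simp only [eval_sub, eval_var, he s' hs, hvi]; omega
      · rw [add_mul]; omega
  have h := key n 0 (s.write v 0 0) (by omega) (by
    intro a ha
    simp only [Finset.mem_insert, not_or] at ha
    rw [write_ne _ _ _ ha.1]) (by simp) h0
  have := Runs.set_seq (a := v) (idx := .const 0) (e := .const 0) h
  exact this.mono (by omega) (fun _ _ h => h)

end KMedianRAM

namespace KMedianOutliers

/-! ### Truncated distances and local optima

`w j i` is the distance between point `j` and location `i`. -/

/-- Distance between point `j` and the set `S`, truncated at `p`. -/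
def tdist (w : ℕ → ℕ → ℕ) (p : ℕ) (S : Finset ℕ) (j : ℕ) : ℕ := S.fold min p (w j)

/-- Cost of `S` for the first `t` points with penalty `p`. -/
def pcost (w : ℕ → ℕ → ℕ) (t p : ℕ) (S : Finset ℕ) : ℕ := ∑ j ∈ Finset.range t, tdist w p S j

/-- The points among the first `t` with distance at least `p` from `S`. -/
def farPoints (w : ℕ → ℕ → ℕ) (t p : ℕ) (S : Finset ℕ) : Finset ℕ :=
  (Finset.range t).filter fun j => p ≤ tdist w p S j

variable {w : ℕ → ℕ → ℕ} {p : ℕ} {S : Finset ℕ} {j : ℕ}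

theorem tdist_le : tdist w p S j ≤ p := Finset.fold_min_le _ |>.2 (Or.inl le_rfl)

theorem tdist_le_of_mem {i : ℕ} (hi : i ∈ S) : tdist w p S j ≤ w j i :=
  Finset.fold_min_le _ |>.2 (Or.inr ⟨i, hi, le_rfl⟩)

theorem le_tdist {c : ℕ} : c ≤ tdist w p S j ↔ c ≤ p ∧ ∀ i ∈ S, c ≤ w j i :=
  Finset.le_fold_min _

theorem tdist_eq_or : tdist w p S j = p ∨ ∃ i ∈ S, tdist w p S j = w j i := by
  rcases (Finset.fold_min_le (tdist w p S j)).1 (le_refl (tdist w p S j)) with h | ⟨i, hi, h⟩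
  · exact Or.inl (le_antisymm tdist_le h)
  · exact Or.inr ⟨i, hi, le_antisymm (tdist_le_of_mem hi) h⟩

theorem tdist_anti {T : Finset ℕ} (h : S ⊆ T) : tdist w p T j ≤ tdist w p S j := by
  rw [le_tdist]
  exact ⟨tdist_le, fun i hi => tdist_le_of_mem (h hi)⟩

/-- Since min(2p, d) ≤ 2·min(p, d), a doubling of the penalty raises log(1 + cost) by at most log 2.
-/
theorem tdist_double : tdist w (p + p) S j ≤ 2 * tdist w p S j := by
  rcases tdist_eq_or (w := w) (p := p) (S := S) (j := j) with h | ⟨i, hi, h⟩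
  · rw [h]; exact tdist_le.trans (by omega)
  · rw [h]; exact (tdist_le_of_mem hi).trans (by omega)

theorem pcost_anti {T : Finset ℕ} {t : ℕ} (h : S ⊆ T) : pcost w t p T ≤ pcost w t p S :=
  Finset.sum_le_sum fun _ _ => tdist_anti h

theorem pcost_double {t : ℕ} : pcost w t (p + p) S ≤ 2 * pcost w t p S := by
  rw [pcost, pcost, Finset.mul_sum]
  exact Finset.sum_le_sum fun _ _ => tdist_double

theorem pcost_succ {t : ℕ} : pcost w (t + 1) p S = pcost w t p S + tdist w p S t :=
  Finset.sum_range_succ _ _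

/-- No exchange of at most `ℓ` medians improves the cost by a factor of more than
`1 - 1 / (k * E)` per exchanged median. -/
def LocalOpt (w : ℕ → ℕ → ℕ) (t N k E ℓ p : ℕ) (S : Finset ℕ) : Prop :=
  ∀ T ⊆ Finset.range N, T.card = S.card → (T \ S).card ≤ ℓ →
    k * E * pcost w t p S ≤ k * E * pcost w t p T + (T \ S).card * pcost w t p S

/-- The effect of a swap on a local optimum. Removing `A` and inserting `B` changes the cost by
at most the sum of the `u j` of points served by `B` and the `v j` of points served by `A`. -/
theorem LocalOpt.swap {t N k E ℓ : ℕ} (h : LocalOpt w t N k E ℓ p S) (hS : S ⊆ Finset.range N)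
    {A B : Finset ℕ} (hA : A ⊆ S) (hB : B ⊆ Finset.range N) (hAB : B.card = A.card)
    (hℓ : B.card ≤ ℓ) (o s : ℕ → ℕ) (u v : ℕ → ℝ) 
    (hu : ∀ j < t, o j ∈ B → (tdist w p ((S \ A) ∪ B) j : ℝ) ≤ tdist w p S j + u j)
    (hv : ∀ j < t, o j ∉ B → s j ∈ A → (tdist w p ((S \ A) ∪ B) j : ℝ) ≤ tdist w p S j + v j)
    (hv0 : ∀ j < t, 0 ≤ v j)
    (hs : ∀ j < t, s j ∉ A → tdist w p ((S \ A) ∪ B) j ≤ tdist w p S j) :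
    0 ≤ B.card * (pcost w t p S : ℝ) + k * E * (∑ j ∈ Finset.range t with o j ∈ B, u j +
      ∑ j ∈ Finset.range t with s j ∈ A, v j) := by
  -- If `B` meets `S \ A`, the exchanged set is smaller than `S`. It is padded with elements of `S`,
  -- which neither raises the cost nor adds new medians.
  obtain ⟨T, hT1, hT2, hT3⟩ := Finset.exists_subsuperset_card_eq (s := (S \ A) ∪ B)
    (t := S ∪ B) (n := S.card)
    (Finset.union_subset_union Finset.sdiff_subset le_rfl)
    ((Finset.card_union_le _ _).trans (by
      rw [Finset.card_sdiff_of_subset hA, hAB]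
      have := Finset.card_le_card hA
      omega)) (Finset.card_le_card Finset.subset_union_left)
  have hTB : T \ S ⊆ B := by
    intro x hx
    rw [Finset.mem_sdiff] at hx
    have := hT2 hx.1
    rw [Finset.mem_union] at this
    tauto
  have hc := Finset.card_le_card hTB
  have h1 := h T (hT2.trans (Finset.union_subset hS hB)) hT3 (hc.trans hℓ)
  have h2 : pcost w t p T ≤ pcost w t p ((S \ A) ∪ B) := pcost_anti hT1
  have h3 : k * E * pcost w t p S ≤
      k * E * pcost w t p ((S \ A) ∪ B) + B.card * pcost w t p S :=
    h1.trans (by gcongr)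
  have h3' : (k * E * pcost w t p S : ℝ) ≤
      k * E * pcost w t p ((S \ A) ∪ B) + B.card * pcost w t p S := by exact_mod_cast h3
  have h4 : (pcost w t p ((S \ A) ∪ B) : ℝ) ≤ pcost w t p S +
      (∑ j ∈ Finset.range t with o j ∈ B, u j + ∑ j ∈ Finset.range t with s j ∈ A, v j) := by
    rw [pcost, pcost, Finset.sum_filter, Finset.sum_filter]
    push_cast
    rw [← Finset.sum_add_distrib, ← Finset.sum_add_distrib]
    refine Finset.sum_le_sum fun j hj => ?_
    rw [Finset.mem_range] at hj
    have a1 := hu j hj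
    have a2 := hv j hj
    have a3 := hv0 j hj
    have a4 := hs j hj
    -- A point with `o j ∈ B` and `s j ∈ A` occurs in both sums; as `v j` is nonnegative, the
    -- surplus is harmless.
    by_cases b1 : o j ∈ B <;> by_cases b2 : s j ∈ A <;> simp only [b1, b2, if_true, if_false]
    · have := a1 b1; linarith
    · have := a1 b1; linarith
    · have := a2 b1 b2; linarith
    · have : (tdist w p ((S \ A) ∪ B) j : ℝ) ≤ tdist w p S j := by exact_mod_cast a4 b2
      linarith
  have h5 : (0:ℝ) ≤ k * E := by positivity
  nlinarith [mul_le_mul_of_nonneg_left h4 h5]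

/-- The combinatorial core of the analysis of local search: `u o` is the gain from opening `o`,
`v s` the loss from closing `s`, and the loss bound is only available for pairs `(A, B)` such that
every element outside of `B` has its nearest median `φ` outside of `A`. -/
theorem sum_swaps_nonneg {S' : Finset ℕ} (hcard : S'.card = S.card) (φ : ℕ → ℕ)
    (hφ : ∀ o ∈ S', φ o ∈ S) (U V : ℕ → ℝ) (hV : ∀ s ∈ S, 0 ≤ V s) (c : ℝ) {ℓ : ℕ} (hℓ : 1 ≤ ℓ)
    (h : ∀ A B, A ⊆ S → B ⊆ S' → B.card = A.card → B.card ≤ ℓ →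
      (∀ o ∈ S', o ∉ B → φ o ∉ A) → 0 ≤ B.card * c + (∑ o ∈ B, U o + ∑ s ∈ A, V s)) :
    0 ≤ S.card * c + (∑ o ∈ S', U o + (1 + 1 / (ℓ : ℝ)) * ∑ s ∈ S, V s) := by
  classical
  -- `R` has one representative of each fibre of `φ`. The bijection `π` from `S'` to `S` agrees with
  -- `φ` on `R` and sends the rest to medians that are nearest to no element of `S'`, which can be
  -- closed freely.
  obtain ⟨R, hRS, hRinj, hRim⟩ := Finset.exists_subset_injOn_image_eq_of_surjOn
    (S' : Set ℕ) (S'.image φ) (f := φ) (by rw [Finset.coe_image]; exact Set.surjOn_image _ _)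
  have hRS' : R ⊆ S' := by exact_mod_cast hRS
  have himS : S'.image φ ⊆ S := Finset.image_subset_iff.2 hφ
  have hcR : R.card = (S'.image φ).card := by
    rw [← hRim, Finset.card_image_of_injOn hRinj]
  have hg : (S' \ R).card = (S \ S'.image φ).card := by
    rw [Finset.card_sdiff_of_subset hRS', Finset.card_sdiff_of_subset himS, hcard, hcR]
  let e := Finset.equivOfCardEq hg
  let π : ℕ → ℕ := fun o => if ho : o ∈ S' \ R then (e ⟨o, ho⟩ : ℕ) else φ o
  have hπR : ∀ o ∈ R, π o = φ o := by
    intro o ho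
    simp only [π]
    rw [dif_neg (by simp [ho])]
  have hπN : ∀ o ∈ S', o ∉ R → π o ∈ S \ S'.image φ := by
    intro o ho hoR
    simp only [π]
    rw [dif_pos (by simp [ho, hoR])]
    exact (e _).2
  have hπS : ∀ o ∈ S', π o ∈ S := by
    intro o ho
    by_cases hoR : o ∈ R
    · rw [hπR o hoR]; exact hφ o ho
    · exact (Finset.mem_sdiff.1 (hπN o ho hoR)).1
  have hπinj : Set.InjOn π S' := by
    intro a ha b hb hab
    rw [Finset.mem_coe] at ha hb
    by_cases haR : a ∈ R <;> by_cases hbR : b ∈ R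
    · rw [hπR a haR, hπR b hbR] at hab
      exact hRinj haR hbR hab
    · have := (Finset.mem_sdiff.1 (hπN b hb hbR)).2
      rw [← hab, hπR a haR] at this
      exact absurd (Finset.mem_image_of_mem φ ha) this
    · have := (Finset.mem_sdiff.1 (hπN a ha haR)).2
      rw [hab, hπR b hbR] at this
      exact absurd (Finset.mem_image_of_mem φ hb) this
    · simp only [π] at hab
      rw [dif_pos (by simp [ha, haR]), dif_pos (by simp [hb, hbR])] at hab
      simpa using e.injective (Subtype.ext hab)
  have hπim : S'.image π = S := by
    refine Finset.eq_of_subset_of_card_le (Finset.image_subset_iff.2 hπS) ?_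
    rw [Finset.card_image_of_injOn hπinj, hcard]
  have hπφ : ∀ o ∈ S', ∀ o' ∈ S', φ o = π o' → φ o = φ o' := by
    intro o ho o' ho' heq
    by_cases hoR : o' ∈ R
    · rw [heq, hπR o' hoR]
    · have := (Finset.mem_sdiff.1 (hπN o' ho' hoR)).2
      rw [← heq] at this
      exact absurd (Finset.mem_image_of_mem φ ho) this
  have hℓ0 : (0 : ℝ) < ℓ := by exact_mod_cast hℓ
  -- The inequality holds separately on each fibre of `φ`; summing over the fibres gives the claim
  -- because `π` is a bijection.
  have block : ∀ s ∈ S'.image φ, 0 ≤ ∑ o ∈ S' with φ o = s,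
      (c + (U o + (1 + 1 / (ℓ : ℝ)) * V (π o))) := by
    intro s hs
    set B := S'.filter fun o => φ o = s with hBdef
    have hBS : B ⊆ S' := Finset.filter_subset _ _
    have hBmem : ∀ o, o ∈ B ↔ o ∈ S' ∧ φ o = s := fun o => Finset.mem_filter
    have hBinj : Set.InjOn π B := hπinj.mono (by exact_mod_cast hBS)
    have hVB : ∀ o ∈ B, 0 ≤ V (π o) := fun o ho => hV _ (hπS o (hBS ho))
    rw [Finset.sum_add_distrib, Finset.sum_add_distrib, Finset.sum_const, nsmul_eq_mul,
      ← Finset.mul_sum]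
    have hsum0 : 0 ≤ ∑ o ∈ B, V (π o) := Finset.sum_nonneg hVB
    by_cases hBℓ : B.card ≤ ℓ
    -- A fibre of at most `ℓ` elements is exchanged as a whole. This is admissible: if `φ o` is
    -- closed, then `o` lies in the same fibre, hence in `B`.
    · have h1 := h (B.image π) B
        ((Finset.image_subset_image hBS).trans hπim.subset) hBS
        (Finset.card_image_of_injOn hBinj).symm hBℓ (by
          intro o ho hoB hmem
          obtain ⟨o', ho', heq⟩ := Finset.mem_image.1 hmem
          rw [hBmem] at ho' hoB
          exact hoB ⟨ho, by rw [hπφ o ho o' ho'.1 heq.symm, ho'.2]⟩)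
      rw [Finset.sum_image hBinj] at h1
      have : 0 ≤ 1 / (ℓ : ℝ) * ∑ o ∈ B, V (π o) := by positivity
      linarith
    -- A large fibre has m + 1 > ℓ elements. Add up the single exchanges of `o` for `π o'` over all
    -- `o ∈ B` and `o' ≠ r`, with weight 1/m: every `o` is opened once in total, and every `π o'` is
    -- closed (m + 1)/m ≤ 1 + 1/ℓ times. The median `s = π r` is never closed.
    · obtain ⟨r, hrR, hrs⟩ : ∃ r ∈ R, φ r = s := by
        rw [← hRim] at hs
        exact Finset.mem_image.1 hs
      have hrB : r ∈ B := (hBmem r).2 ⟨hRS' hrR, hrs⟩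
      have hnotR : ∀ o ∈ B.erase r, o ∈ S' ∧ o ∉ R := by
        intro o ho
        rw [Finset.mem_erase, hBmem] at ho
        exact ⟨ho.2.1, fun hoR => ho.1 (hRinj hoR hrR (ho.2.2.trans hrs.symm))⟩
      have h1 : ∀ o' ∈ B.erase r, ∀ o ∈ B, 0 ≤ c + (U o + V (π o')) := by
        intro o' ho' o ho
        have h2 := h {π o'} {o} (by simpa using hπS o' (hnotR o' ho').1) (by simpa using hBS ho)
          (by simp) (by simpa using hℓ) (by
            intro a ha _ hmem
            rw [Finset.mem_singleton] at hmem
            have := (Finset.mem_sdiff.1 (hπN o' (hnotR o' ho').1 (hnotR o' ho').2)).2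
            rw [← hmem] at this
            exact this (Finset.mem_image_of_mem φ ha))
        simpa using h2
      have h2 := Finset.sum_nonneg fun o' ho' => Finset.sum_nonneg (h1 o' ho')
      simp only [Finset.sum_add_distrib, Finset.sum_const, nsmul_eq_mul, ← Finset.mul_sum] at h2
      have hcard1 : ((B.erase r).card : ℝ) + 1 = B.card := by
        exact_mod_cast Finset.card_erase_add_one hrB
      have hm : (ℓ : ℝ) ≤ (B.erase r).card := by
        have : ℓ ≤ (B.erase r).card := by
          have := Finset.card_erase_add_one hrB
          omega
        exact_mod_cast this
      have h3 : ∑ o ∈ B.erase r, V (π o) ≤ ∑ o ∈ B, V (π o) :=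
        Finset.sum_le_sum_of_subset_of_nonneg (Finset.erase_subset _ _) fun o ho _ => hVB o ho
      have h4 : 0 ≤ ∑ o ∈ B.erase r, V (π o) :=
        Finset.sum_nonneg fun o ho => hVB o (Finset.mem_of_mem_erase ho)
      rw [← hcard1] at h2 ⊢
      set m : ℝ := ((B.erase r).card : ℝ)
      have hm0 : 0 < m := lt_of_lt_of_le hℓ0 hm
      have h5 : 0 ≤ m * ((m + 1) * c + (∑ o ∈ B, U o +
          (1 + 1 / m) * ∑ o ∈ B.erase r, V (π o))) := by
        have : m * ((m + 1) * c + (∑ o ∈ B, U o +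
          (1 + 1 / m) * ∑ o ∈ B.erase r, V (π o))) = m * ((m + 1) * c) + (m * ∑ o ∈ B, U o +
          (m + 1) * ∑ o ∈ B.erase r, V (π o)) := by field_simp
        rw [this]
        linarith
      have h6 := nonneg_of_mul_nonneg_right h5 hm0
      have h7 : 1 / m ≤ 1 / (ℓ : ℝ) := one_div_le_one_div_of_le hℓ0 hm
      have h8 : (1 + 1 / m) * ∑ o ∈ B.erase r, V (π o) ≤
          (1 + 1 / (ℓ : ℝ)) * ∑ o ∈ B, V (π o) := by
        have : 0 ≤ 1 / m := by positivity
        gcongr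
      linarith
  have h1 := Finset.sum_nonneg block
  rw [Finset.sum_fiberwise_of_maps_to (fun o ho => Finset.mem_image_of_mem φ ho)] at h1
  rw [Finset.sum_add_distrib, Finset.sum_add_distrib, Finset.sum_const, nsmul_eq_mul,
      ← Finset.mul_sum, hcard] at h1
  rw [← hπim, Finset.sum_image hπinj, hπim]
  exact h1

end KMedianOutliers

/-! ### The cost of a local optimum compared with an arbitrary solution with outliers -/

namespace KMedianOutliers

variable {w : ℕ → ℕ → ℕ} {p : ℕ} {S : Finset ℕ} {j : ℕ}

theorem sum_filter_mem_eq (J B : Finset ℕ) (o : ℕ → ℕ) (u : ℕ → ℝ) :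
    ∑ j ∈ J with o j ∈ B, u j = ∑ b ∈ B, ∑ j ∈ J with o j = b, u j := by
  rw [← Finset.sum_fiberwise_of_maps_to (s := J.filter fun j => o j ∈ B) (t := B) (g := o)
    (fun j hj => (Finset.mem_filter.1 hj).2)]
  refine Finset.sum_congr rfl fun b hb => ?_
  rw [Finset.filter_filter]
  refine Finset.sum_congr (Finset.filter_congr fun j _ => ?_) fun _ _ => rfl
  constructor
  · exact fun h => h.2
  · exact fun h => ⟨h ▸ hb, h⟩

/-- Cost of a local optimum, compared with any solution `S'` and any set `O` of outliers. The
assignment of the other points to `S'` is `o`. -/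
theorem LocalOpt.cost_le {t N k E ℓ : ℕ} (h : LocalOpt w t N k E ℓ p S)
    (hS : S ⊆ Finset.range N) (hk : S.card ≤ k) (hS0 : S.Nonempty) (hE : 1 ≤ E) (hℓ : 1 ≤ ℓ)
    (g : ℕ → ℕ → ℝ) (hg : ∀ j < t, ∀ a < N, ∀ b < N, (w j b : ℝ) ≤ w j a + g a b)
    (hg' : ∀ j < t, ∀ a < N, ∀ b < N, g a b ≤ w j a + w j b)
    {S' O : Finset ℕ} (hS' : S' ⊆ Finset.range N) (hcard : S'.card = S.card)
    (hO : O ⊆ Finset.range t) (o : ℕ → ℕ) (ho : ∀ j < t, j ∉ O → o j ∈ S') :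
    (1 - 1 / (E : ℝ)) * pcost w t p S ≤ (3 + 2 / (ℓ : ℝ)) * ∑ j ∈ Finset.range t \ O, (w j (o j) : ℝ)
      + (1 + 1 / (ℓ : ℝ)) * (p * O.card) := by
  classical
  have hk1 : 1 ≤ k := hS0.card_pos.trans_le hk
  choose s hsS hsmin using fun j => Finset.exists_min_image S (w j) hS0
  choose φ hφS hφmin using fun a => Finset.exists_min_image S (g a) hS0
  have htd : ∀ j, tdist w p S j = p ∨ tdist w p S j = w j (s j) := by
    intro j
    rcases tdist_eq_or (w := w) (p := p) (S := S) (j := j) with h | ⟨i, hi, h⟩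
    · exact Or.inl h
    · exact Or.inr (le_antisymm (tdist_le_of_mem (hsS j)) (h ▸ hsmin j i hi))
  -- Outliers get the label `N`, which is not in `S'`. They gain nothing from openings, and when
  -- their median is closed they can always fall back on paying `p`.
  let o' : ℕ → ℕ := fun j => if j ∈ O then N else o j
  let u : ℕ → ℝ := fun j => if j ∈ O then 0 else w j (o j) - tdist w p S j
  let v : ℕ → ℝ := fun j => if j ∈ O then p - tdist w p S j else 2 * w j (o j)
  have hv0 : ∀ j < t, 0 ≤ v j := by
    intro j _
    have : (tdist w p S j : ℝ) ≤ p := by exact_mod_cast tdist_le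
    simp only [v]
    split_ifs
    · linarith
    · positivity
  have hkE : (0 : ℝ) < k * E := by
    have : 0 < k * E := by positivity
    exact_mod_cast this
  have hmain := sum_swaps_nonneg hcard φ (fun a _ => hφS a)
    (fun a => k * E * ∑ j ∈ Finset.range t with o' j = a, u j)
    (fun a => k * E * ∑ j ∈ Finset.range t with s j = a, v j)
    (fun a _ => mul_nonneg hkE.le (Finset.sum_nonneg fun j hj =>
      hv0 j (Finset.mem_range.1 (Finset.mem_filter.1 hj).1))) (pcost w t p S) hℓ (by
    intro A B hA hB hAB hBℓ hBA
    have hsw := h.swap hS hA (hB.trans hS') hAB hBℓ o' s u v (by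
      intro j hj hoB
      by_cases hjO : j ∈ O
      · simp only [o', hjO, if_true] at hoB
        exact absurd (hS' (hB hoB)) (by simp)
      · simp only [o', u, hjO, if_false] at hoB ⊢
        have : tdist w p ((S \ A) ∪ B) j ≤ w j (o j) :=
          tdist_le_of_mem (Finset.mem_union_right _ hoB)
        have : (tdist w p ((S \ A) ∪ B) j : ℝ) ≤ w j (o j) := by exact_mod_cast this
        linarith) (by
      intro j hj hoB hsA
      have hp : (tdist w p ((S \ A) ∪ B) j : ℝ) ≤ p := by exact_mod_cast tdist_le
      by_cases hjO : j ∈ O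
      · simp only [v, hjO, if_true]
        linarith
      · simp only [o', v, hjO, if_false] at hoB ⊢
        have hoS' := ho j hj hjO
        have hoN := Finset.mem_range.1 (hS' hoS')
        have hφA := hBA _ hoS' hoB
        -- A point whose median is closed is rerouted to `φ (o j)`, the median nearest to `o j`. As
        -- this is no farther from `o j` than `s j` is, the detour costs at most `2 * w j (o j)`.
        have h1 : tdist w p ((S \ A) ∪ B) j ≤ w j (φ (o j)) := tdist_le_of_mem
          (Finset.mem_union_left _ (Finset.mem_sdiff.2 ⟨hφS _, hφA⟩))
        have h1' : (tdist w p ((S \ A) ∪ B) j : ℝ) ≤ w j (φ (o j)) := by exact_mod_cast h1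
        have h2 := hg j hj (o j) hoN (φ (o j)) (Finset.mem_range.1 (hS (hφS _)))
        have h3 := hφmin (o j) (s j) (hsS j)
        have h4 := hg' j hj (o j) hoN (s j) (Finset.mem_range.1 (hS (hsS _)))
        have h5 : (0 : ℝ) ≤ w j (o j) := by positivity
        rcases htd j with h6 | h6 <;> rw [h6] <;> linarith) hv0 (by
      intro j hj hsA
      have h1 : tdist w p ((S \ A) ∪ B) j ≤ w j (s j) := tdist_le_of_mem
          (Finset.mem_union_left _ (Finset.mem_sdiff.2 ⟨hsS _, hsA⟩))
      rcases htd j with h6 | h6 <;> rw [h6]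
      · exact tdist_le
      · exact h1)
    rw [sum_filter_mem_eq, sum_filter_mem_eq, mul_add, Finset.mul_sum, Finset.mul_sum] at hsw
    exact hsw)
  simp only [← Finset.mul_sum] at hmain
  rw [← sum_filter_mem_eq, ← sum_filter_mem_eq] at hmain
  have hsum_v : ∑ j ∈ Finset.range t with s j ∈ S, v j = ∑ j ∈ Finset.range t, v j := by
    rw [Finset.filter_true_of_mem fun j _ => hsS j]
  have hsum_u : ∑ j ∈ Finset.range t with o' j ∈ S', u j = ∑ j ∈ Finset.range t, u j := by
    rw [Finset.sum_filter]
    refine Finset.sum_congr rfl fun j hj => ?_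
    by_cases hjO : j ∈ O
    · simp [u, hjO]
    · simp [o', hjO, ho j (Finset.mem_range.1 hj) hjO]
  rw [hsum_v, hsum_u] at hmain
  set q : ℝ := 1 / (ℓ : ℝ) with hq
  have hq0 : 0 ≤ q := by positivity
  have hq2 : 2 / (ℓ : ℝ) = 2 * q := by rw [hq]; ring
  rw [hq2]
  have hcomb : ∑ j ∈ Finset.range t, u j + (1 + q) * ∑ j ∈ Finset.range t, v j ≤
      (3 + 2 * q) * ∑ j ∈ Finset.range t \ O, (w j (o j) : ℝ) + (1 + q) * (p * O.card) -
        pcost w t p S := by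
    have e1 : (p : ℝ) * O.card = ∑ j ∈ Finset.range t, if j ∈ O then (p : ℝ) else 0 := by
      rw [← Finset.sum_filter, Finset.filter_mem_eq_inter, Finset.inter_eq_right.2 hO,
        Finset.sum_const, nsmul_eq_mul, mul_comm]
    have e2 : ∑ j ∈ Finset.range t \ O, (w j (o j) : ℝ) =
        ∑ j ∈ Finset.range t, if j ∈ O then (0 : ℝ) else w j (o j) := by
      rw [Finset.sdiff_eq_filter, Finset.sum_filter]
      refine Finset.sum_congr rfl fun j _ => ?_
      split_ifs <;> simp_all
    rw [e1, e2, pcost]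
    push_cast
    rw [Finset.mul_sum, Finset.mul_sum, Finset.mul_sum, ← Finset.sum_add_distrib,
      ← Finset.sum_add_distrib, ← Finset.sum_sub_distrib]
    refine Finset.sum_le_sum fun j _ => ?_
    simp only [u, v]
    have : (0 : ℝ) ≤ tdist w p S j := by positivity
    split_ifs
    · nlinarith [mul_nonneg hq0 this]
    · linarith
  -- The slack of cost/(kE) per exchanged median, for at most `k` medians, adds up to the loss of
  -- 1/E in the conclusion.
  have hm2 : 0 ≤ (k : ℝ) * E * ((1 / E) * pcost w t p S + 
      (∑ j ∈ Finset.range t, u j + (1 + q) * ∑ j ∈ Finset.range t, v j)) := by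
    have hE0 : (E : ℝ) ≠ 0 := by positivity
    have : (k : ℝ) * E * ((1 / E) * pcost w t p S + 
      (∑ j ∈ Finset.range t, u j + (1 + q) * ∑ j ∈ Finset.range t, v j)) = k * pcost w t p S +
      (k * E * ∑ j ∈ Finset.range t, u j + (1 + q) * (k * E * ∑ j ∈ Finset.range t, v j)) := by
      field_simp
    rw [this]
    refine hmain.trans ?_
    have : (S.card : ℝ) * pcost w t p S ≤ k * pcost w t p S := by gcongr
    linarith
  have hm3 := nonneg_of_mul_nonneg_right hm2 hkE
  linarith

end KMedianOutliers

namespace KMedianOutliers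

/-! ### The total increase of the cost caused by arrivals -/

/-- The successive members of class `c` have 0, 1, 2, … predecessors in the class, so the ranks run
through an initial segment. -/
theorem sum_rank_eq (a : ℕ → ℕ) (c : ℕ) (h : ℕ → ℝ) (e : ℕ) :
    ∑ t ∈ Finset.range e with a t = c, h (Finset.card {j ∈ Finset.range t | a j = c}) =
      ∑ q ∈ Finset.range (Finset.card {j ∈ Finset.range e | a j = c}), h q := by
  induction e with
  | zero => simp
  | succ e ih =>
    rw [Finset.range_add_one, Finset.filter_insert]
    split_ifs with hc
    · rw [Finset.sum_insert (by simp), Finset.card_insert_of_notMem (by simp),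
        Finset.sum_range_succ, ih, add_comm]
    · exact ih

/-- Among points of one cluster, the point that follows `q` others is charged `2 / q`. -/
noncomputable def rankCharge (q : ℕ) : ℝ := if q = 0 then 1 else 2 / q

theorem rankCharge_nonneg (q : ℕ) : 0 ≤ rankCharge q := by
  rw [rankCharge]; split_ifs <;> positivity

theorem sum_rankCharge_le (n : ℕ) :
    ∑ q ∈ Finset.range n, rankCharge q ≤ 1 + 2 * (harmonic n : ℝ) := by
  have : ∀ n, ∑ q ∈ Finset.range (n + 1), rankCharge q = 1 + 2 * (harmonic n : ℝ) := by
    intro n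
    induction n with
    | zero => simp [rankCharge]
    | succ n ih =>
      rw [Finset.sum_range_succ, ih, harmonic_succ, rankCharge, if_neg (by omega)]
      push_cast
      ring
  rw [← this n]
  exact Finset.sum_le_sum_of_subset_of_nonneg (Finset.range_subset_range.2 (by omega))
    fun q _ _ => rankCharge_nonneg q

/-- A sequence of sets of at most `k` among `M` locations, with nondecreasing penalties, for
points and locations whose distances satisfy the triangle inequality. -/
structure PenaltySeq (w : ℕ → ℕ → ℕ) (n M k : ℕ) (p : ℕ → ℕ) (S : ℕ → Finset ℕ) : Prop where
  four_point : ∀ j < n, ∀ j' < n, ∀ c < M, ∀ s < M, w j s ≤ w j c + w j' c + w j' s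
  subset : ∀ t, t < n → S t ⊆ Finset.range M
  card_le : ∀ t, t < n → (S t).card ≤ k
  mono : ∀ s t, s ≤ t → t < n → p s ≤ p t

/-- Let `e` be the last time at which the cost is below `u`. A point `t < e` in a cluster of `S e`
is compared with its predecessors `j` in the cluster: going through the common center and `j` to a
median of `S t` and averaging over `j` bounds its insertion cost by its cost under `S e` plus 2u/q.
The costs under `S e` add up to at most `u`, the point `e` itself is charged `u`, and each of the
`k` clusters at most `u` times a harmonic sum. -/
theorem PenaltySeq.sum_min_le {w : ℕ → ℕ → ℕ} {n M k : ℕ} {p : ℕ → ℕ} {S : ℕ → Finset ℕ}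
    (h : PenaltySeq w n M k p S) (u : ℕ) :
    ∑ t ∈ Finset.range n with pcost w t (p t) (S t) < u, (min u (tdist w (p t) (S t) t) : ℝ) ≤
      u * (2 + k * (1 + 2 * (harmonic n : ℝ))) := by
  classical
  have hH : (0 : ℝ) ≤ harmonic n := by
    rw [harmonic]; push_cast; positivity
  set F := (Finset.range n).filter fun t => pcost w t (p t) (S t) < u with hF
  by_cases hne : F.Nonempty
  swap
  · rw [Finset.not_nonempty_iff_eq_empty.1 hne, Finset.sum_empty]
    positivity
  set e := F.max' hne with he
  have heF : e ∈ F := Finset.max'_mem _ _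
  have hen : e < n := Finset.mem_range.1 (Finset.mem_filter.1 heF).1
  have heu : pcost w e (p e) (S e) < u := (Finset.mem_filter.1 heF).2
  -- `a t` is the center of `t` in `S e`. The default `M`, which is never a location, marks points
  -- that pay the penalty at time `e`.
  let a : ℕ → ℕ := fun t =>
    if ht : ∃ c ∈ S e, tdist w (p e) (S e) t = w t c then ht.choose else M
  have ha : ∀ t, a t ∈ S e → tdist w (p e) (S e) t = w t (a t) := by
    intro t hat
    by_cases ht : ∃ c ∈ S e, tdist w (p e) (S e) t = w t c
    · simp only [a, dif_pos ht]
      exact ht.choose_spec.2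
    · simp only [a, dif_neg ht] at hat
      simpa using h.subset e hen hat
  have ha' : ∀ t, a t ∉ S e → tdist w (p e) (S e) t = p e := by
    intro t hat
    rcases tdist_eq_or (w := w) (p := p e) (S := S e) (j := t) with h1 | h1
    · exact h1
    · simp only [a, dif_pos h1] at hat
      exact absurd h1.choose_spec.1 hat
  have hterm : ∀ t ∈ F, t ≠ e → (min u (tdist w (p t) (S t) t) : ℝ) ≤
      tdist w (p e) (S e) t + if a t ∈ S e then
        u * rankCharge (Finset.card {j ∈ Finset.range t | a j = a t}) else 0 := by
    intro t htF hte
    have hlt : t < e := lt_of_le_of_ne (Finset.le_max' F t htF) hte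
    have htn : t < n := hlt.trans hen
    have htu : pcost w t (p t) (S t) < u := (Finset.mem_filter.1 htF).2
    split_ifs with hat
    · rw [rankCharge]
      split_ifs with hq
      · rw [mul_one]
        exact (min_le_left _ _).trans (le_add_of_nonneg_left (by positivity))
      · set Q := (Finset.range t).filter fun j => a j = a t with hQ
        have hstep : ∀ j ∈ Q, tdist w (p t) (S t) t ≤ tdist w (p e) (S e) t +
            tdist w (p e) (S e) j + tdist w (p t) (S t) j := by
          intro j hj
          rw [hQ, Finset.mem_filter, Finset.mem_range] at hj
          rcases tdist_eq_or (w := w) (p := p t) (S := S t) (j := j) with h1 | ⟨s, hs, h1⟩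
          · rw [h1]
            exact tdist_le.trans (by omega)
          · have h2 := ha t hat
            have h3 := ha j (hj.2 ▸ hat)
            rw [hj.2] at h3
            rw [h1, h2, h3]
            exact (tdist_le_of_mem hs).trans (h.four_point t htn j (hj.1.trans htn) _
              (Finset.mem_range.1 (h.subset e hen hat)) s
              (Finset.mem_range.1 (h.subset t htn hs)))
        have h1 := Finset.sum_le_sum hstep
        rw [Finset.sum_add_distrib, Finset.sum_add_distrib, Finset.sum_const, Finset.sum_const,
          smul_eq_mul, smul_eq_mul] at h1
        have h2 : ∑ j ∈ Q, tdist w (p e) (S e) j ≤ pcost w e (p e) (S e) :=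
          Finset.sum_le_sum_of_subset ((Finset.filter_subset _ _).trans
            (Finset.range_subset_range.2 hlt.le))
        have h3 : ∑ j ∈ Q, tdist w (p t) (S t) j ≤ pcost w t (p t) (S t) :=
          Finset.sum_le_sum_of_subset (Finset.filter_subset _ _)
        have h4 : Q.card * tdist w (p t) (S t) t ≤ Q.card * tdist w (p e) (S e) t + 2 * u := by
          omega
        have h4' : (Q.card : ℝ) * tdist w (p t) (S t) t ≤
            Q.card * tdist w (p e) (S e) t + 2 * u := by exact_mod_cast h4
        refine (min_le_right _ _).trans ?_
        have hQ0 : (0 : ℝ) < Q.card := by exact_mod_cast Nat.pos_of_ne_zero hq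
        rw [← mul_le_mul_iff_right₀ hQ0]
        calc (Q.card : ℝ) * tdist w (p t) (S t) t ≤ _ := h4'
          _ = Q.card * (tdist w (p e) (S e) t + u * (2 / Q.card)) := by
            generalize (Q.card : ℝ) = q at hQ0
            field_simp
    -- A point that pays the full penalty at time `e` paid no more at time `t`, because penalties do
    -- not decrease.
    · rw [ha' t hat, add_zero]
      refine (min_le_right _ _).trans ?_
      exact_mod_cast tdist_le.trans (h.mono t e hlt.le hen)
  have hcluster : ∑ t ∈ Finset.range e, (if a t ∈ S e then
        u * rankCharge (Finset.card {j ∈ Finset.range t | a j = a t}) else 0) ≤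
      u * (k * (1 + 2 * (harmonic n : ℝ))) := by
    rw [← Finset.sum_filter, sum_filter_mem_eq]
    have : ∀ c ∈ S e, ∑ t ∈ Finset.range e with a t = c,
        u * rankCharge (Finset.card {j ∈ Finset.range t | a j = a t}) ≤
        u * (1 + 2 * (harmonic n : ℝ)) := by
      intro c _
      rw [← Finset.mul_sum]
      refine mul_le_mul_of_nonneg_left ?_ (by positivity)
      have e1 : ∑ t ∈ Finset.range e with a t = c,
          rankCharge (Finset.card {j ∈ Finset.range t | a j = a t}) =
          ∑ t ∈ Finset.range e with a t = c,
          rankCharge (Finset.card {j ∈ Finset.range t | a j = c}) := by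
        refine Finset.sum_congr rfl fun t ht => ?_
        rw [(Finset.mem_filter.1 ht).2]
      rw [e1, sum_rank_eq]
      refine le_trans ?_ (sum_rankCharge_le n)
      refine Finset.sum_le_sum_of_subset_of_nonneg (Finset.range_subset_range.2 ?_)
        fun q _ _ => rankCharge_nonneg q
      exact (Finset.card_filter_le _ _).trans (by simpa using hen.le)
    refine (Finset.sum_le_sum this).trans ?_
    rw [Finset.sum_const, nsmul_eq_mul]
    have : ((S e).card : ℝ) ≤ k := by exact_mod_cast h.card_le e hen
    have h2 : (0 : ℝ) ≤ u * (1 + 2 * (harmonic n : ℝ)) := by positivity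
    nlinarith
  rw [← Finset.add_sum_erase F _ heF]
  have h1 : ∑ t ∈ F.erase e, (min u (tdist w (p t) (S t) t) : ℝ) ≤
      ∑ t ∈ Finset.range e, ((tdist w (p e) (S e) t : ℝ) + if a t ∈ S e then
        u * rankCharge (Finset.card {j ∈ Finset.range t | a j = a t}) else 0) := by
    refine (Finset.sum_le_sum fun t ht => hterm t (Finset.mem_of_mem_erase ht)
      (Finset.ne_of_mem_erase ht)).trans ?_
    refine Finset.sum_le_sum_of_subset_of_nonneg (fun t ht => ?_) fun t _ _ => ?_
    · exact Finset.mem_range.2 (lt_of_le_of_ne (Finset.le_max' F t (Finset.mem_of_mem_erase ht))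
        (Finset.ne_of_mem_erase ht))
    · have := rankCharge_nonneg (Finset.card {j ∈ Finset.range t | a j = a t})
      split_ifs <;> positivity
  rw [Finset.sum_add_distrib] at h1
  have h2 : ∑ t ∈ Finset.range e, (tdist w (p e) (S e) t : ℝ) ≤ u := by
    have : (pcost w e (p e) (S e) : ℝ) ≤ u := by exact_mod_cast heu.le
    rw [pcost] at this
    push_cast at this
    exact this
  have h3 : (min u (tdist w (p e) (S e) e) : ℝ) ≤ u := min_le_left _ _
  linarith

/-- Downward induction on the scale: with y = x/2^i, passing from y/2 to y multiplies 1 + y by at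
most 1 + min(1, y), and log(1 + min(1, y)) ≤ min(1, y) is the new term. -/
theorem log_one_add_le_sum (x J i : ℕ) (hx : x ≤ 2 ^ J) (hi : i ≤ J) :
    Real.log (1 + x / 2 ^ i) ≤ ∑ r ∈ Finset.Ico i (J + 1), (min (2 ^ r) x : ℝ) / 2 ^ r := by
  have hxJ : (x : ℝ) ≤ 2 ^ J := by exact_mod_cast hx
  induction hi using Nat.decreasingInduction with
  | self =>
    rw [Nat.Ico_succ_singleton, Finset.sum_singleton, min_eq_right hxJ]
    have : (0 : ℝ) ≤ x / 2 ^ J := by positivity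
    have := Real.log_le_sub_one_of_pos (x := 1 + x / 2 ^ J) (by positivity)
    linarith
  | of_succ i hi ih =>
    rw [Finset.sum_eq_sum_Ico_succ_bot (by omega)]
    set y : ℝ := x / 2 ^ i with hy
    have hy0 : 0 ≤ y := by positivity
    have e1 : (x : ℝ) / 2 ^ (i + 1) = y / 2 := by rw [hy, pow_succ]; field_simp
    have e2 : (min (2 ^ i) x : ℝ) / 2 ^ i = min 1 y := by
      rw [← min_div_div_right (show (0 : ℝ) ≤ 2 ^ i by positivity), div_self (by positivity)]
    rw [e1] at ih
    rw [e2]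
    have hm0 : 0 ≤ min 1 y := le_min zero_le_one hy0
    have h1 : 1 + y ≤ (1 + min 1 y) * (1 + y / 2) := by
      rcases le_total 1 y with h | h
      · rw [min_eq_left h]; nlinarith
      · rw [min_eq_right h]; nlinarith
    have h2 := Real.log_le_log (by positivity) h1
    rw [Real.log_mul (by positivity) (by positivity)] at h2
    have h3 := Real.log_le_sub_one_of_pos (x := 1 + min 1 y) (by positivity)
    linarith

/-- Here `W` is replaced by the next power of two, which is at most `2 * W`; the factor 2 comes from
1 + 2y ≤ (1 + y)². -/
theorem log_one_add_div_le (x W J : ℕ) (hx : x ≤ 2 ^ J) (hW : 1 ≤ W) (hWJ : W ≤ 2 ^ J) :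
    Real.log (1 + x / W) ≤
      2 * ∑ r ∈ Finset.range (J + 1) with W ≤ 2 ^ r, (min (2 ^ r) x : ℝ) / 2 ^ r := by
  have hi : Nat.clog 2 W ≤ J := (Nat.clog_le_iff_le_pow one_lt_two).2 hWJ
  have hW1 : W ≤ 2 ^ Nat.clog 2 W := Nat.le_pow_clog one_lt_two W
  have hW2 : 2 ^ Nat.clog 2 W ≤ 2 * W := by
    rcases Nat.eq_or_lt_of_le hW with h | h
    · simp [← h]
    · have := Nat.pow_pred_clog_lt_self one_lt_two h
      have h0 : 0 < Nat.clog 2 W := Nat.clog_pos one_lt_two h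
      obtain ⟨i, hi⟩ : ∃ i, Nat.clog 2 W = i + 1 := ⟨_, (Nat.succ_pred_eq_of_pos h0).symm⟩
      rw [hi] at this ⊢
      rw [pow_succ]
      simp at this
      omega
  have hset : ((Finset.range (J + 1)).filter fun r => W ≤ 2 ^ r) =
      Finset.Ico (Nat.clog 2 W) (J + 1) := by
    ext r
    rw [Finset.mem_filter, Finset.mem_range, Finset.mem_Ico,
      ← Nat.clog_le_iff_le_pow one_lt_two]
    tauto
  rw [hset]
  refine le_trans ?_ (mul_le_mul_of_nonneg_left (log_one_add_le_sum x J _ hx hi) zero_le_two)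
  set P : ℝ := 2 ^ Nat.clog 2 W with hP
  have hP0 : 0 < P := by positivity
  have hPW : P ≤ 2 * W := by rw [hP]; exact_mod_cast hW2
  have hW0 : (0 : ℝ) < W := by exact_mod_cast hW
  have h1 : (x : ℝ) / W ≤ 2 * (x / P) := by
    rw [← mul_div_assoc, div_le_div_iff₀ hW0 hP0]
    have : (0 : ℝ) ≤ x := by positivity
    nlinarith
  have hq : 0 ≤ x / P := by positivity
  have h2 : Real.log (1 + x / W) ≤ Real.log ((1 + x / P) ^ 2) :=
    Real.log_le_log (by positivity) (by nlinarith [sq_nonneg (x / P)])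
  rw [Real.log_pow] at h2
  exact_mod_cast h2

/-- Each logarithm is split into dyadic scales and the sums are interchanged. At scale 2^r exactly
the arrivals with cost below 2^r remain, so `PenaltySeq.sum_min_le` applies to each of the `J + 1`
scales. -/
theorem PenaltySeq.sum_log_le {w : ℕ → ℕ → ℕ} {n M k : ℕ} {p : ℕ → ℕ} {S : ℕ → Finset ℕ}
    (h : PenaltySeq w n M k p S) (J : ℕ) (hJ : ∀ t < n, tdist w (p t) (S t) t ≤ 2 ^ J)
    (hJ' : ∀ t < n, 1 + pcost w t (p t) (S t) ≤ 2 ^ J) :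
    ∑ t ∈ Finset.range n,
      Real.log (1 + (tdist w (p t) (S t) t : ℝ) / (1 + pcost w t (p t) (S t) : ℕ)) ≤
      2 * ((J + 1) * (2 + k * (1 + 2 * (harmonic n : ℝ)))) := by
  refine (Finset.sum_le_sum fun t ht => log_one_add_div_le _ _ J
    (hJ t (Finset.mem_range.1 ht)) (by omega) (hJ' t (Finset.mem_range.1 ht))).trans ?_
  rw [← Finset.mul_sum]
  refine mul_le_mul_of_nonneg_left ?_ zero_le_two
  simp only [Finset.sum_filter]
  rw [Finset.sum_comm]
  have : ∀ r ∈ Finset.range (J + 1), ∑ t ∈ Finset.range n,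
      (if 1 + pcost w t (p t) (S t) ≤ 2 ^ r then
        (min (2 ^ r) (tdist w (p t) (S t) t : ℝ)) / 2 ^ r else 0) ≤
      2 + k * (1 + 2 * (harmonic n : ℝ)) := by
    intro r _
    rw [← Finset.sum_filter, ← Finset.sum_div, div_le_iff₀ (by positivity)]
    have := h.sum_min_le (2 ^ r)
    push_cast at this
    rw [mul_comm]
    refine le_trans (le_of_eq (Finset.sum_congr (Finset.filter_congr fun t _ => ?_)
      fun _ _ => rfl)) this
    omega
  refine (Finset.sum_le_sum this).trans ?_
  rw [Finset.sum_const, Finset.card_range, nsmul_eq_mul]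
  push_cast
  rfl

end KMedianOutliers

namespace KMedianOutliers

/-! ### Sequences of improvements -/

/-- An exchange of `d` medians that improves the cost by a factor of more than
`1 - d / (k * E)`. -/
structure EffSwap (w : ℕ → ℕ → ℕ) (t N k E d p : ℕ) (S T : Finset ℕ) : Prop where
  subset : T ⊆ Finset.range N
  card_eq : T.card = S.card
  card_sdiff : (T \ S).card ≤ d
  gain : k * E * pcost w t p T + d * pcost w t p S < k * E * pcost w t p S

/-- Number `E`, the inverse of the required improvement, the maximum size `ℓ` of an exchange, and
the maximum ratio `num / den` of the number of outliers to `z`. -/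
structure Params where
  (E ℓ num den : ℕ)

/-- There are too many outliers. -/
def Violated (c : Params) (w : ℕ → ℕ → ℕ) (t z p : ℕ) (S : Finset ℕ) : Prop :=
  c.num * z < c.den * (farPoints w t p S).card

/-- `Path c w t N k z R q p S p' S'`: from penalty `p` and solution `S`, the algorithm arrives at
`p'` and `S'`, with exchanges of total size `R` and `q` increases of the penalty. -/
inductive Path (c : Params) (w : ℕ → ℕ → ℕ) (t N k z : ℕ) :
    ℕ → ℕ → ℕ → Finset ℕ → ℕ → Finset ℕ → Prop
  | done {p : ℕ} {S : Finset ℕ} : LocalOpt w t N k c.E c.ℓ p S → ¬ Violated c w t z p S →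
      Path c w t N k z 0 0 p S p S
  | swap {d R q p p' : ℕ} {S T S' : Finset ℕ} : d ≤ c.ℓ → EffSwap w t N k c.E d p S T →
      Path c w t N k z R q p T p' S' → Path c w t N k z (R + d) q p S p' S'
  | double {R q p p' : ℕ} {S S' : Finset ℕ} : LocalOpt w t N k c.E c.ℓ p S →
      Violated c w t z p S → Path c w t N k z R q (p + p) S p' S' →
      Path c w t N k z R (q + 1) p S p' S'

variable {c : Params} {w : ℕ → ℕ → ℕ} {t N k z R q p p' : ℕ} {S S' T : Finset ℕ}

theorem EffSwap.one_le {E d : ℕ} (h : EffSwap w t N k E d p S T) : 1 ≤ d := by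
  by_contra h0
  obtain rfl : d = 0 := by omega
  have h1 : T \ S = ∅ := Finset.card_eq_zero.1 (Nat.le_zero.1 h.card_sdiff)
  have h2 : T = S := Finset.eq_of_subset_of_card_le (Finset.sdiff_eq_empty_iff_subset.1 h1)
    h.card_eq.ge
  have := h.gain
  rw [h2] at this
  omega

theorem EffSwap.pcost_lt {E d : ℕ} (h : EffSwap w t N k E d p S T) :
    pcost w t p T < pcost w t p S := by
  by_contra h0
  have h1 := h.gain
  have := Nat.mul_le_mul_left (k * E) (not_lt.1 h0)
  omega

/-- From 1 - 1/y ≤ log y. An improving exchange starts from an integer cost x ≥ 1, so x/(1 + x) ≥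
1/2; this is the factor 2. -/
theorem EffSwap.le_log {E d : ℕ} (h : EffSwap w t N k E d p S T) :
    (d : ℝ) ≤ 2 * (k * E) * (Real.log (1 + pcost w t p S) - Real.log (1 + pcost w t p T)) := by
  have h1 : (k : ℝ) * E * pcost w t p T + d * pcost w t p S ≤ k * E * pcost w t p S := by
    exact_mod_cast h.gain.le
  have h2 := h.pcost_lt
  have hx : (1 : ℝ) ≤ pcost w t p S := by exact_mod_cast (by omega : 1 ≤ pcost w t p S)
  set x : ℝ := (pcost w t p S : ℝ)
  have hy : (0 : ℝ) ≤ pcost w t p T := by positivity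
  set y : ℝ := (pcost w t p T : ℝ)
  have h3 := Real.one_sub_inv_le_log_of_pos (x := (1 + x) / (1 + y)) (by positivity)
  rw [Real.log_div (by positivity) (by positivity), inv_div] at h3
  have h4 : 1 - (1 + y) / (1 + x) = (x - y) / (1 + x) := by
    have : 1 + x ≠ 0 := by positivity
    field_simp
    ring
  rw [h4] at h3
  refine le_trans ?_ (mul_le_mul_of_nonneg_left h3 (by positivity))
  rw [← mul_div_assoc, le_div_iff₀ (by positivity)]
  have hd : (0 : ℝ) ≤ d := by positivity
  nlinarith

theorem Path.card_eq (h : Path c w t N k z R q p S p' S') : S'.card = S.card := by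
  induction h with
  | done => rfl
  | swap _ h _ ih => rw [ih, h.card_eq]
  | double _ _ _ ih => exact ih

theorem Path.subset (h : Path c w t N k z R q p S p' S') (hS : S ⊆ Finset.range N) :
    S' ⊆ Finset.range N := by
  induction h with
  | done => exact hS
  | swap _ h _ ih => exact ih h.subset
  | double _ _ _ ih => exact ih hS

theorem Path.localOpt (h : Path c w t N k z R q p S p' S') :
    LocalOpt w t N k c.E c.ℓ p' S' := by
  induction h with
  | done h _ => exact h
  | swap _ _ _ ih => exact ih
  | double _ _ _ ih => exact ih

theorem Path.not_violated (h : Path c w t N k z R q p S p' S') : ¬ Violated c w t z p' S' := by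
  induction h with
  | done _ h => exact h
  | swap _ _ _ ih => exact ih
  | double _ _ _ ih => exact ih

theorem Path.card_sdiff_le (h : Path c w t N k z R q p S p' S') : (S' \ S).card ≤ R := by
  induction h with
  | done => simp
  | @swap d R q p p' S T S' _ h _ ih =>
    have h1 : S' \ S ⊆ (S' \ T) ∪ (T \ S) := by
      intro x
      simp only [Finset.mem_sdiff, Finset.mem_union]
      tauto
    have h2 := (Finset.card_le_card h1).trans (Finset.card_union_le _ _)
    have := h.card_sdiff
    omega
  | double _ _ _ ih => exact ih

theorem Path.penalty_eq (h : Path c w t N k z R q p S p' S') : p' = 2 ^ q * p := by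
  induction h with
  | done => simp
  | swap _ _ _ ih => exact ih
  | double _ _ _ ih => rw [ih, pow_succ]; ring

/-- A property of the penalty that is preserved at local optima with too many outliers. -/
theorem Path.penalty_induction (h : Path c w t N k z R q p S p' S') (I : ℕ → Prop)
    (hI : ∀ p T, T ⊆ Finset.range N → T.card = S.card → LocalOpt w t N k c.E c.ℓ p T →
      Violated c w t z p T → I p → I (p + p)) (hS : S ⊆ Finset.range N) (hp : I p) : I p' := by
  induction h with
  | done => exact hp
  | swap _ h _ ih => exact ih (fun p T h1 h2 => hI p T h1 (h2.trans h.card_eq)) h.subset hp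
  | double h1 h2 _ ih => exact ih hI hS (hI _ _ hS rfl h1 h2 hp)

/-- The potential log(1 + cost) telescopes along the path, with a gain of at most log 2 at each of
the `q` doublings. -/
theorem Path.le_log (h : Path c w t N k z R q p S p' S') :
    (R : ℝ) ≤ 2 * (k * c.E) * (Real.log (1 + pcost w t p S) - Real.log (1 + pcost w t p' S') +
      q * Real.log 2) := by
  induction h with
  | done => simp
  | swap _ h _ ih =>
    have := h.le_log
    push_cast
    linarith
  | @double R q p p' S S' _ _ _ ih =>
    refine ih.trans (mul_le_mul_of_nonneg_left ?_ (by positivity))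
    have h1 : (1 + pcost w t (p + p) S : ℝ) ≤ (1 + pcost w t p S) * 2 := by
      have : (pcost w t (p + p) S : ℝ) ≤ 2 * pcost w t p S := by exact_mod_cast pcost_double
      linarith
    have h2 := Real.log_le_log (by positivity) h1
    rw [Real.log_mul (by positivity) (by norm_num)] at h2
    push_cast
    linarith

/-- Too many far points means at least one, and its distance to a median is at least `p`. This stops
the doublings and keeps the penalty at most max(1, 2D). -/
theorem Violated.le_of_dist_le {D : ℕ} (h : Violated c w t z p S) (hS : S.Nonempty)
    (hD : ∀ j < t, ∀ i ∈ S, w j i ≤ D) : p ≤ D := by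
  have h1 : (farPoints w t p S).Nonempty := by
    rw [← Finset.card_pos]
    by_contra h0
    rw [Violated, Nat.eq_zero_of_not_pos h0] at h
    omega
  obtain ⟨j, hj⟩ := h1
  rw [farPoints, Finset.mem_filter, Finset.mem_range] at hj
  obtain ⟨i, hi⟩ := hS
  exact hj.2.trans ((tdist_le_of_mem hi).trans (hD j hj.1 i hi))

theorem Path.penalty_le {D : ℕ} (h : Path c w t N k z R q p S p' S') (hS : S ⊆ Finset.range N)
    (hS0 : S.Nonempty) (hD : ∀ j < t, ∀ i < N, w j i ≤ D) : p' ≤ max p (2 * D) := by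
  refine h.penalty_induction (fun r => r ≤ max p (2 * D)) ?_ hS (le_max_left _ _)
  intro r T hT hTc _ hv _
  have hT0 : T.Nonempty := by rw [← Finset.card_pos, hTc]; exact hS0.card_pos
  have := hv.le_of_dist_le hT0 fun j hj i hi => hD j hj i (Finset.mem_range.1 (hT hi))
  exact le_max_of_le_right (by omega)

end KMedianOutliers

namespace KMedianRAM

open KMedianOutliers

/-! ### The program

Array `3` holds the distances, array `4` the triangular numbers, arrays `5` and `6` the current
and the best candidate of the search. The other arrays hold one number each: `7` the number of
points, `8` the number of locations, `9` the penalty, `10` the number of medians, `14` and `15` the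
cost and the number of outliers of the last evaluated candidate, `16` and `18` those of the
solution, `17` the scaled cost of the solution, `19` and `20` flags. -/

/-- Multiplication by a constant. -/
def mulConst : ℕ → Expr → Expr
  | 0, _ => .const 0
  | c + 1, e => .add e (mulConst c e)

@[simp] theorem eval_mulConst (s : Store) (c : ℕ) (e : Expr) :
    (mulConst c e).eval s = c * e.eval s := by
  induction c with
  | zero => simp [mulConst]
  | succ c ih => rw [mulConst, eval_add, ih]; ring

@[simp] theorem writes_skip : Prog.skip.writes = ∅ := rfl

@[simp] theorem writes_set (a : ℕ) (i e : Expr) : (Prog.set a i e).writes = {a} := rfl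

@[simp] theorem writes_assign (a : ℕ) (e : Expr) : (assign a e).writes = {a} := rfl

@[simp] theorem writes_seq (p q : Prog) : (Prog.seq p q).writes = p.writes ∪ q.writes := rfl

@[simp] theorem writes_ite (e : Expr) (p q : Prog) :
    (Prog.ite e p q).writes = p.writes ∪ q.writes := rfl

@[simp] theorem writes_loop (e : Expr) (p : Prog) : (Prog.loop e p).writes = p.writes := rfl

attribute [simp] writes_forLoop

theorem Runs.assign {s : Store} {a : ℕ} {e : Expr} {Q : Store → Prop}
    (h : Q (s.write a 0 (e.eval s))) : Runs (assign a e) s 1 Q :=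
  Runs.set h

theorem Runs.assign_seq {s : Store} {a : ℕ} {e : Expr} {q : Prog} {N : ℕ} {Q : Store → Prop}
    (h : Runs q (s.write a 0 (e.eval s)) N Q) :
    Runs (.seq (KMedianRAM.assign a e) q) s (1 + N) Q :=
  Runs.set_seq h

/-- The nonzero cells among the first `N` cells of array `a`. -/
def cellSet (s : Store) (a N : ℕ) : Finset ℕ := (Finset.range N).filter fun i => s a i ≠ 0

theorem mem_cellSet {s : Store} {a N i : ℕ} : i ∈ cellSet s a N ↔ i < N ∧ s a i ≠ 0 := by
  simp [cellSet]

theorem cellSet_subset (s : Store) (a N : ℕ) : cellSet s a N ⊆ Finset.range N :=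
  Finset.filter_subset _ _

theorem cellSet_congr {s s' : Store} {a : ℕ} (h : s' a = s a) (N : ℕ) :
    cellSet s' a N = cellSet s a N := by
  simp [cellSet, h]

theorem cellSet_succ (s : Store) (a N : ℕ) :
    cellSet s a (N + 1) = if s a N ≠ 0 then insert N (cellSet s a N) else cellSet s a N := by
  rw [cellSet, Finset.range_add_one, Finset.filter_insert]
  rfl

/-- The memory holds the instance. -/
structure Data (s : Store) (w : ℕ → ℕ → ℕ) (t N k z : ℕ) : Prop where
  dist : ∀ j < t, ∀ i < N, s 3 (s 4 (i + j) + j) = w j i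
  k : s 1 1 = k
  z : s 1 2 = z
  t : s 7 0 = t
  N : s 8 0 = N

theorem Data.congr {s s' : Store} {w : ℕ → ℕ → ℕ} {t N k z : ℕ} (h : Data s w t N k z)
    (h1 : s' 1 = s 1) (h3 : s' 3 = s 3) (h4 : s' 4 = s 4) (h7 : s' 7 = s 7) (h8 : s' 8 = s 8) :
    Data s' w t N k z :=
  ⟨by rw [h3, h4]; exact h.dist, by rw [h1]; exact h.k, by rw [h1]; exact h.z,
    by rw [h7]; exact h.t, by rw [h8]; exact h.N⟩

/-- Address of the distance between the point in variable `11` and the location in `12`. -/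
def distAddr : Expr := .add (.get 4 (.add (var 12) (var 11))) (var 11)

/-- Compute the cost and the number of outliers of the candidate in array `5`. -/
def evalProg : Prog :=
  .seq (assign 14 (.const 0)) <| .seq (assign 15 (.const 0)) <|
  forLoop 11 (var 7) <|
    .seq (assign 13 (var 9)) <|
    .seq (forLoop 12 (var 8) <|
      .ite (.get 5 (var 12))
        (.ite (.sub (var 13) (.get 3 distAddr)) (assign 13 (.get 3 distAddr)) .skip) .skip) <|
    .seq (assign 14 (.add (var 14) (var 13))) <|
    .ite (.sub (var 9) (var 13)) .skip (assign 15 (.add (var 15) (.const 1)))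

theorem tdist_cellSet_succ (s : Store) (w : ℕ → ℕ → ℕ) (p a i j : ℕ) :
    tdist w p (cellSet s a (i + 1)) j =
      if s a i ≠ 0 then min (w j i) (tdist w p (cellSet s a i) j)
      else tdist w p (cellSet s a i) j := by
  rw [cellSet_succ]
  split_ifs
  · rw [tdist, Finset.fold_insert_idem, tdist]
  · rfl

theorem farPoints_succ_card (w : ℕ → ℕ → ℕ) (t p : ℕ) (S : Finset ℕ) :
    (farPoints w (t + 1) p S).card =
      (farPoints w t p S).card + if p ≤ tdist w p S t then 1 else 0 := by
  rw [farPoints, Finset.range_add_one, Finset.filter_insert]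
  split_ifs
  · rw [Finset.card_insert_of_notMem (by simp)]; rfl
  · rfl

theorem runs_evalProg {s : Store} {w : ℕ → ℕ → ℕ} {t N k z : ℕ} (h : Data s w t N k z) :
    Runs evalProg s (4 + t * (5 * N + 8)) fun s' =>
      s' 14 0 = pcost w t (s 9 0) (cellSet s 5 N) ∧
      s' 15 0 = (farPoints w t (s 9 0) (cellSet s 5 N)).card := by
  refine Runs.mono (Runs.assign_seq <| Runs.assign_seq <| Runs.forLoop (n := t)
    (N := 1 + (2 + N * (3 + 2) + (1 + 2)))
    (fun t s' => s' 14 0 = pcost w t (s 9 0) (cellSet s 5 N) ∧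
      s' 15 0 = (farPoints w t (s 9 0) (cellSet s 5 N)).card)
    (by simp) ?_ ?_ ?_) (by nlinarith) (fun _ _ h => h)
  · intro s' hs
    simp [hs 7, Store.write, h.t]
  · simp [Store.write, pcost, farPoints]
  · intro j hj s' hs hj' hI
    simp only [writes_seq, writes_assign, writes_forLoop, writes_ite, writes_skip] at hs
    have h5 : s' 5 = s 5 := by rw [hs 5 (by simp)]; funext i; simp [Store.write]
    have h9 : s' 9 = s 9 := by rw [hs 9 (by simp)]; funext i; simp [Store.write]
    have hD : Data s' w t N k z := by
      refine h.congr ?_ ?_ ?_ ?_ ?_ <;> rw [hs _ (by simp)] <;> funext i <;> simp [Store.write]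
    refine Runs.assign_seq <| Runs.seq (Runs.forLoop (n := N) (N := 3)
      (fun i s'' => s'' 13 0 = tdist w (s 9 0) (cellSet s 5 i) j)
      (by simp) ?_ ?_ ?_) ?_
    · intro s'' hs'
      simp [hs' 8, Store.write, hD.N]
    · simp [Store.write, cellSet, tdist, h9]
    · intro i hi s'' hs' hi' hI'
      simp only [writes_assign, writes_ite, writes_skip] at hs'
      have h5' : s'' 5 = s 5 := by rw [hs' 5 (by simp), ← h5]; funext i; simp [Store.write]
      have h11 : s'' 11 0 = j := by rw [hs' 11 (by simp), ← hj']; simp [Store.write]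
      have hd : s'' 3 (s'' 4 (i + j) + j) = w j i := by
        rw [hs' 3 (by simp), hs' 4 (by simp), ← hD.dist j hj i hi]
        simp [Store.write]
      have hw : (Expr.get 3 distAddr).eval s'' = w j i := by
        simp [distAddr, h11, hi', hd]
      refine Runs.mono (N := 1 + (1 + 1)) (Runs.ite (fun hc => Runs.ite (fun hlt => Runs.assign ?_)
        (fun hge => Runs.skip ?_)) (fun hc => Runs.mono (N := 1) (Runs.skip ?_) (by omega)
          (fun _ _ h => h))) (by omega) (fun _ _ h => h)
      all_goals
        rw [tdist_cellSet_succ]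
        simp only [eval_get, eval_var, hi', h5'] at hc
        simp only [hc, not_false_eq_true, ne_eq, not_true_eq_false, if_true, if_false]
      · rw [eval_sub, hw, eval_var, hI'] at hlt
        rw [hw]
        simp [Store.write]
        omega
      · rw [eval_sub, hw, eval_var, hI'] at hge
        simp [Store.write, hI']
        omega
      · simp [Store.write, hI']
    · intro s'' hs' hI'
      simp only [writes_assign, writes_forLoop, writes_ite, writes_skip] at hs'
      have h14 : s'' 14 0 = s' 14 0 := by rw [hs' 14 (by simp)]; simp [Store.write]
      have h15 : s'' 15 0 = s' 15 0 := by rw [hs' 15 (by simp)]; simp [Store.write]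
      have h9' : s'' 9 0 = s 9 0 := by rw [hs' 9 (by simp), ← h9]; simp [Store.write]
      refine Runs.assign_seq <| Runs.ite (fun hlt => Runs.skip ?_) (fun hge => Runs.assign ?_)
      all_goals
        rw [pcost_succ, farPoints_succ_card]
        simp [Store.write, h14, h15, hI, hI', h9'] at *
        omega

end KMedianRAM

/-! ### Exhaustive search for an improving exchange -/

namespace KMedianRAM

open KMedianOutliers

/-- Copy the first cells of array `a` to array `b`. -/
def copyProg (a b : ℕ) : Prog := forLoop 11 (var 8) (.set b (var 11) (.get a (var 11)))

theorem runs_copyProg {s : Store} {N : ℕ} (hN : s 8 0 = N) (a b : ℕ) (ha : a ≠ 11) (hb : b ≠ 11)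
    (hb8 : b ≠ 8) (hab : a ≠ b) :
    Runs (copyProg a b) s (2 + N * 3) fun s' => ∀ i, s' b i = if i < N then s a i else s b i := by
  refine Runs.forLoop (n := N) (N := 1) (fun n s' => ∀ i, s' b i = if i < n then s a i else s b i)
    (by simp [hb.symm]) ?_ ?_ ?_
  · intro s' hs
    simp [hs 8 (by simp [hb8.symm]), hN]
  · intro i
    simp [Store.write, hb]
  · intro n hn s' hs hn' hI
    refine Runs.set ?_
    intro i
    have : s' a n = s a n := by rw [hs a (by simp [ha, hab])]
    simp only [eval_get, eval_var, hn', this, write_ne _ _ _ hb, write_apply, hI]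
    split_ifs <;> first | rfl | omega | (subst_vars; rfl)

/-- Compare the candidate in array `5`, which is obtained by `d` exchanges, with the solution. -/
def checkProg (c : Params) (d : ℕ) : Prog :=
  .seq evalProg <| .seq (assign 21 (.const 0)) <|
  .seq (forLoop 22 (.get 1 (.const 1)) (assign 21 (.add (var 21) (mulConst c.E (var 14))))) <|
  .ite (.sub (var 17) (.add (var 21) (mulConst d (var 16))))
    (.seq (copyProg 5 6) (assign 19 (.const 1))) .skip

/-- Try all sequences of at most `r` exchanges after the `d` exchanges that led to the candidate
in array `5`. -/
def searchProg (c : Params) : ℕ → ℕ → Prog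
  | 0, d => checkProg c d
  | r + 1, d => .seq (checkProg c d) <|
    forLoop (30 + 2 * d) (var 8) <| forLoop (31 + 2 * d) (var 8) <|
      .ite (.get 5 (var (30 + 2 * d)))
        (.ite (.get 5 (var (31 + 2 * d))) .skip <|
          .seq (.set 5 (var (30 + 2 * d)) (.const 0)) <|
          .seq (.set 5 (var (31 + 2 * d)) (.const 1)) <|
          .seq (searchProg c r (d + 1)) <|
          .seq (.set 5 (var (30 + 2 * d)) (.const 1)) <|
          .set 5 (var (31 + 2 * d)) (.const 0))
        .skip

/-- Depth `d` counts with the variables `30 + 2 * d` and `31 + 2 * d`, and recursive calls only use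
higher ones, so they do not disturb the enclosing loops. -/
theorem mem_writes_searchProg {c : Params} {a : ℕ} : ∀ {r d : ℕ}, a ∈ (searchProg c r d).writes →
    a ∈ ({5, 6, 11, 12, 13, 14, 15, 19, 21, 22} : Finset ℕ) ∨ 30 + 2 * d ≤ a
  | 0, d, h => by
    simp [searchProg, checkProg, copyProg, evalProg] at h ⊢
    omega
  | r + 1, d, h => by
    have ih := mem_writes_searchProg (a := a) (r := r) (d := d + 1) (c := c)
    simp only [Finset.mem_insert, Finset.mem_singleton] at ih
    simp [searchProg, checkProg, copyProg, evalProg] at h ⊢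
    by_cases hm : a ∈ (searchProg c r (d + 1)).writes
    · rcases ih hm with h | h <;> omega
    · simp only [hm, or_false] at h
      omega

/-- Invariant of the search for an improvement of `S`. -/
structure SearchInv (c : Params) (w : ℕ → ℕ → ℕ) (t N k z p : ℕ) (S : Finset ℕ) (s : Store) :
    Prop where
  data : Data s w t N k z
  penalty : s 9 0 = p
  base : s 16 0 = pcost w t p S
  scaled : s 17 0 = k * c.E * pcost w t p S
  found : s 19 0 ≠ 0 → ∃ d ≤ c.ℓ, EffSwap w t N k c.E d p S (cellSet s 6 N)

variable {c : Params} {w : ℕ → ℕ → ℕ} {t N k z p : ℕ} {S : Finset ℕ}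

theorem SearchInv.congr {s s' : Store} (h : SearchInv c w t N k z p S s)
    (hs : ∀ a ∈ ({1, 3, 4, 6, 7, 8, 9, 16, 17, 19} : Finset ℕ), s' a = s a) :
    SearchInv c w t N k z p S s' where
  data := h.data.congr (hs _ (by simp)) (hs _ (by simp)) (hs _ (by simp)) (hs _ (by simp))
    (hs _ (by simp))
  penalty := by rw [hs _ (by simp)]; exact h.penalty
  base := by rw [hs _ (by simp)]; exact h.base
  scaled := by rw [hs _ (by simp)]; exact h.scaled
  found := by rw [hs _ (by simp), cellSet_congr (hs 6 (by simp))]; exact h.found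

/-- The machine cannot multiply, so `k * E * cost` is formed by `k` additions in variable `21`. When
the flag stays 0, the candidate is certified not to improve enough; otherwise array `6` holds an
exchange that does. -/
theorem runs_checkProg {s : Store} (h : SearchInv c w t N k z p S s) {d : ℕ} (hd : d ≤ c.ℓ)
    (hcard : (cellSet s 5 N).card = S.card) (hsdiff : (cellSet s 5 N \ S).card ≤ d) :
    Runs (checkProg c d) s (13 + t * (5 * N + 8) + 3 * k + 3 * N) fun s' =>
      SearchInv c w t N k z p S s' ∧ (s' 19 0 = 0 → s 19 0 = 0 ∧
        k * c.E * pcost w t p S ≤ k * c.E * pcost w t p (cellSet s 5 N) + d * pcost w t p S) := by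
  refine Runs.mono (Runs.seq (runs_evalProg h.data) fun s₁ hs₁ h₁ => Runs.assign_seq <|
    Runs.seq (N := 2 + k * 3) (N' := 1 + (2 + N * 3 + 1))
      (R := fun s' => s' 21 0 = k * (c.E * pcost w t p (cellSet s 5 N)))
      (Runs.forLoop (n := k) (N := 1)
        (fun n s' => s' 21 0 = n * (c.E * pcost w t p (cellSet s 5 N))) (by simp) ?_ ?_ ?_) ?_)
    (by omega) (fun _ _ h => h)
  · intro s' hs
    simp only [writes_assign] at hs
    have := h.data.k
    rw [← hs₁ 1 (by simp [evalProg])] at this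
    simp [hs 1, Store.write, this]
  · simp [Store.write]
  · intro n hn s' hs hn' hI
    simp only [writes_assign] at hs
    refine Runs.assign ?_
    have h14 : s' 14 0 = pcost w t p (cellSet s 5 N) := by
      rw [hs 14 (by simp), ← h.penalty, ← h₁.1]
      simp [Store.write]
    simp [Store.write, hI, h14]
    ring
  · intro s₂ hs₂ h₂
    simp only [writes_assign, writes_forLoop] at hs₂
    have hfr : ∀ a ∉ insert 21 (insert 22 evalProg.writes), s₂ a = s a := by
      intro a ha
      simp only [Finset.mem_insert, not_or] at ha
      rw [hs₂ a (by simp [ha.1, ha.2.1]), write_ne _ _ _ ha.1, hs₁ a ha.2.2]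
    have hinv : SearchInv c w t N k z p S s₂ := by
      refine h.congr fun a ha => hfr a ?_
      simp [evalProg] at ha ⊢
      omega
    have heq : (Expr.sub (var 17) (.add (var 21) (mulConst d (var 16)))).eval s₂ =
        k * c.E * pcost w t p S -
          (k * c.E * pcost w t p (cellSet s 5 N) + d * pcost w t p S) := by
      simp [hinv.base, hinv.scaled, h₂, mul_assoc]
    refine Runs.ite (fun hc => ?_) (fun hc => Runs.mono (Runs.skip ?_)
      (by omega) (fun _ _ h => h))
    · rw [heq] at hc
      refine Runs.seq (runs_copyProg hinv.data.N 5 6 (by simp) (by simp) (by simp) (by simp)) ?_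
      intro s₃ hs₃ h₃
      refine Runs.assign ⟨?_, by simp [Store.write]⟩
      simp only [copyProg, writes_forLoop, writes_set] at hs₃
      have hset : cellSet s₃ 6 N = cellSet s 5 N := by
        ext i
        rw [mem_cellSet, mem_cellSet, h₃, hfr 5 (by simp [evalProg])]
        refine and_congr_right fun hi => ?_
        rw [if_pos hi]
      have hfr' : ∀ a, a ≠ 6 → a ≠ 11 → a ≠ 19 →
          (s₃.write 19 0 ((Expr.const 1).eval s₃)) a = s₂ a := by
        intro a h6 h11 h19
        rw [write_ne _ _ _ h19, hs₃ a (by simp [h6, h11])]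
      constructor
      · exact hinv.data.congr (hfr' _ (by simp) (by simp) (by simp))
          (hfr' _ (by simp) (by simp) (by simp)) (hfr' _ (by simp) (by simp) (by simp))
          (hfr' _ (by simp) (by simp) (by simp)) (hfr' _ (by simp) (by simp) (by simp))
      · rw [hfr' _ (by simp) (by simp) (by simp)]; exact hinv.penalty
      · rw [hfr' _ (by simp) (by simp) (by simp)]; exact hinv.base
      · rw [hfr' _ (by simp) (by simp) (by simp)]; exact hinv.scaled
      · intro _
        refine ⟨d, hd, ?_⟩
        rw [cellSet_congr (s := s₃) (write_ne _ _ _ (by simp)), hset]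
        exact ⟨cellSet_subset _ _ _, hcard, hsdiff, by omega⟩
    · rw [heq] at hc
      refine ⟨hinv, fun h19 => ⟨?_, by omega⟩⟩
      rw [← hfr 19 (by simp [evalProg])]
      exact h19

/-- `T'` is obtained from `T` by `e` exchanges of one element. -/
def Exch (N : ℕ) : ℕ → Finset ℕ → Finset ℕ → Prop
  | 0, T, T' => T' = T
  | e + 1, T, T' => ∃ a ∈ T, ∃ b < N, b ∉ T ∧ Exch N e (insert b (T.erase a)) T'

/-- Swapping an element of T \ T' for one of T' \ T shrinks the difference by one. Hence searching
through sequences of single exchanges reaches every set that `LocalOpt` quantifies over. -/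
theorem exch_of_card : ∀ {e : ℕ} {T T' : Finset ℕ}, T' ⊆ Finset.range N → T'.card = T.card →
    (T' \ T).card = e → Exch N e T T'
  | 0, T, T', _, hc, he => Finset.eq_of_subset_of_card_le
      (Finset.sdiff_eq_empty_iff_subset.1 (Finset.card_eq_zero.1 he)) hc.ge
  | e + 1, T, T', hN, hc, he => by
    obtain ⟨b, hb⟩ : (T' \ T).Nonempty := by rw [← Finset.card_pos]; omega
    obtain ⟨a, ha⟩ : (T \ T').Nonempty := by
      rw [← Finset.card_pos, Finset.card_sdiff_comm hc.symm]; omega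
    rw [Finset.mem_sdiff] at ha hb
    refine ⟨a, ha.1, b, Finset.mem_range.1 (hN hb.1), hb.2, exch_of_card hN ?_ ?_⟩
    · rw [Finset.card_insert_of_notMem (by simp [hb.2]), Finset.card_erase_add_one ha.1, hc]
    · have : T' \ insert b (T.erase a) = (T' \ T).erase b := by
        ext x
        simp only [Finset.mem_sdiff, Finset.mem_insert, Finset.mem_erase, not_or, not_and]
        constructor
        · rintro ⟨h1, h2, h3⟩
          exact ⟨h2, h1, h3 fun h => ha.2 (h ▸ h1)⟩
        · rintro ⟨h1, h2, h3⟩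
          exact ⟨h2, h1, fun _ => h3⟩
      rw [this, Finset.card_erase_of_mem (Finset.mem_sdiff.2 hb), he]
      omega

theorem cellSet_write {s : Store} {a i v : ℕ} (hi : i < N) :
    cellSet (s.write a i v) a N =
      if v = 0 then (cellSet s a N).erase i else insert i (cellSet s a N) := by
  ext j
  rw [mem_cellSet, write_apply]
  split_ifs with h1 h2 h2 <;>
    simp only [Finset.mem_erase, Finset.mem_insert, mem_cellSet] <;> subst_vars <;> simp_all

/-- A bound for the number of steps of the search. -/
def searchSteps (N B : ℕ) : ℕ → ℕ
  | 0 => B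
  | r + 1 => B + (2 + N * (2 + N * (searchSteps N B r + 8) + 2))

/-- The search never stops early and undoes each exchange in array `5`. A flag that is still 0 at
the end was 0 throughout, so that every candidate within reach was rejected. -/
theorem runs_searchProg (r : ℕ) : ∀ {d : ℕ} {s : Store}, SearchInv c w t N k z p S s →
    d + r ≤ c.ℓ → (cellSet s 5 N).card = S.card → (cellSet s 5 N \ S).card ≤ d →
    Runs (searchProg c r d) s (searchSteps N (13 + t * (5 * N + 8) + 3 * k + 3 * N) r) fun s' =>
      SearchInv c w t N k z p S s' ∧ cellSet s' 5 N = cellSet s 5 N ∧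
      (s' 19 0 = 0 → s 19 0 = 0 ∧ ∀ e ≤ r, ∀ T, Exch N e (cellSet s 5 N) T →
        k * c.E * pcost w t p S ≤ k * c.E * pcost w t p T + (d + e) * pcost w t p S) := by
  induction r with
  | zero =>
    intro d s h hd hcard hsdiff
    refine Runs.mono (runs_checkProg h (by omega) hcard hsdiff) le_rfl ?_
    rintro s' hs ⟨h1, h2⟩
    refine ⟨h1, cellSet_congr (hs 5 (by simp [searchProg, checkProg, evalProg, copyProg])) N, fun h0 =>
      ⟨(h2 h0).1, ?_⟩⟩
    rintro e he T hT
    obtain rfl : e = 0 := by omega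
    rw [Exch] at hT
    rw [hT]
    simpa using (h2 h0).2
  | succ r ih =>
    intro d s h hd hcard hsdiff
    set T := cellSet s 5 N with hTdef
    have hmem := fun a => @mem_writes_searchProg c a r (d + 1)
    simp only [Finset.mem_insert, Finset.mem_singleton] at hmem
    refine Runs.seq (runs_checkProg h (by omega) hcard hsdiff) ?_
    rintro s₁ hs₁ ⟨h₁, h₁'⟩
    have hT₁ : cellSet s₁ 5 N = T :=
      cellSet_congr (hs₁ 5 (by simp [checkProg, evalProg, copyProg])) N
    -- the candidates that are reached through the exchange of `a` and `b`
    let P : ℕ → ℕ → Prop := fun a b => a ∈ T → b ∉ T → ∀ e ≤ r, ∀ T',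
      Exch N e (insert b (T.erase a)) T' →
        k * c.E * pcost w t p S ≤ k * c.E * pcost w t p T' + (d + (e + 1)) * pcost w t p S
    refine Runs.mono (Runs.forLoop (n := N)
      (N := 2 + N * (searchSteps N (13 + t * (5 * N + 8) + 3 * k + 3 * N) r + 6 + 2))
      (fun n s' => SearchInv c w t N k z p S s' ∧ cellSet s' 5 N = T ∧
        (s' 19 0 = 0 → s₁ 19 0 = 0 ∧ ∀ a < n, ∀ b < N, P a b)) ?_ ?_ ?_ ?_) ?_ ?_
    · simp
      refine ⟨by omega, fun h => ?_⟩
      rcases hmem _ h with h | h <;> omega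
    · intro s' hs
      rw [eval_var, hs 8, h₁.data.N]
      simp
      refine ⟨by omega, by omega, fun h => ?_⟩
      rcases hmem _ h with h | h <;> omega
    · refine ⟨h₁.congr fun a ha => write_ne _ _ _ ?_, ?_, fun h0 => ⟨?_, by simp⟩⟩
      · simp at ha; omega
      · rw [← hT₁]; exact cellSet_congr (write_ne _ _ _ (by omega)) N
      · rwa [write_ne _ _ _ (by omega)] at h0
    · rintro a haN s₂ hs₂ ha₂ ⟨h₂, hT₂, h₂'⟩
      refine Runs.mono (Runs.forLoop (n := N)
        (N := searchSteps N (13 + t * (5 * N + 8) + 3 * k + 3 * N) r + 6)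
        (fun n s' => SearchInv c w t N k z p S s' ∧ cellSet s' 5 N = T ∧
          (s' 19 0 = 0 → s₂ 19 0 = 0 ∧ ∀ b < n, P a b)) ?_ ?_ ?_ ?_) le_rfl ?_
      · simp
        refine ⟨by omega, fun h => ?_⟩
        rcases hmem _ h with h | h <;> omega
      · intro s' hs
        rw [eval_var, hs 8, h₂.data.N]
        simp
        refine ⟨by omega, fun h => ?_⟩
        rcases hmem _ h with h | h <;> omega
      · refine ⟨h₂.congr fun a ha => write_ne _ _ _ ?_, ?_, fun h0 => ⟨?_, by simp⟩⟩
        · simp at ha; omega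
        · rw [← hT₂]; exact cellSet_congr (write_ne _ _ _ (by omega)) N
        · rwa [write_ne _ _ _ (by omega)] at h0
      · rintro b hbN s₃ hs₃ hb₃ ⟨h₃, hT₃, h₃'⟩
        have ha₃ : s₃ (30 + 2 * d) 0 = a := by
          rw [hs₃, ha₂]
          simp
          refine ⟨by omega, fun h => ?_⟩
          rcases hmem _ h with h | h <;> omega
        -- the loop variable does not affect the invariant
        have key : ∀ s', SearchInv c w t N k z p S s' → cellSet s' 5 N = T →
            (s' 19 0 = 0 → s₃ 19 0 = 0 ∧ P a b) →
            SearchInv c w t N k z p S (s'.write (31 + 2 * d) 0 (b + 1)) ∧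
            cellSet (s'.write (31 + 2 * d) 0 (b + 1)) 5 N = T ∧
            ((s'.write (31 + 2 * d) 0 (b + 1)) 19 0 = 0 →
              s₂ 19 0 = 0 ∧ ∀ b' < b + 1, P a b') := by
          intro s' hs' hT' h'
          refine ⟨hs'.congr fun a ha => write_ne _ _ _ ?_, ?_, fun h0 => ?_⟩
          · simp at ha; omega
          · rw [← hT']; exact cellSet_congr (write_ne _ _ _ (by omega)) N
          · rw [write_ne _ _ _ (by omega)] at h0
            refine ⟨(h₃' (h' h0).1).1, fun b' hb' => ?_⟩
            rcases Nat.lt_succ_iff_lt_or_eq.1 hb' with hb' | rfl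
            · exact (h₃' (h' h0).1).2 b' hb'
            · exact (h' h0).2
        refine Runs.mono (N := 1 + (1 + (1 + (1 +
          (searchSteps N (13 + t * (5 * N + 8) + 3 * k + 3 * N) r + (1 + 1))))))
          (Runs.ite (fun hca => Runs.ite (fun hcb => ?_) (fun hcb => ?_)) (fun hca => ?_))
          (by omega) (fun _ _ h => h)
        · refine Runs.mono (Runs.skip (key s₃ h₃ hT₃ fun h0 => ⟨h0, fun _ hb => ?_⟩))
            (by omega) (fun _ _ h => h)
          refine absurd ?_ hb
          rw [← hT₃, mem_cellSet]
          simp only [eval_get, eval_var, hb₃] at hcb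
          exact ⟨hbN, hcb⟩
        · simp only [eval_get, eval_var, hb₃] at hcb
          simp only [eval_get, eval_var, ha₃] at hca
          have haT : a ∈ T := by rw [← hT₃, mem_cellSet]; exact ⟨haN, hca⟩
          have hbT : b ∉ T := by rw [← hT₃, mem_cellSet]; exact fun h => h.2 hcb
          have hab : a ≠ b := fun h => hbT (h ▸ haT)
          refine Runs.set_seq <| Runs.set_seq ?_
          simp only [eval_var, eval_const, ha₃,
            write_ne _ _ _ (show 31 + 2 * d ≠ 5 by omega), hb₃]
          set s₄ := (s₃.write 5 a 0).write 5 b 1 with hs₄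
          have hfr₄ : ∀ a', a' ≠ 5 → s₄ a' = s₃ a' := fun a' h => by
            rw [hs₄, write_ne _ _ _ h, write_ne _ _ _ h]
          have hT₄ : cellSet s₄ 5 N = insert b (T.erase a) := by
            rw [hs₄, cellSet_write hbN, cellSet_write haN, hT₃]
            simp
          have h₄ : SearchInv c w t N k z p S s₄ := h₃.congr fun a' ha' => hfr₄ a' (by
            simp at ha'; omega)
          refine Runs.seq (ih (d := d + 1) h₄ (by omega) ?_ ?_) ?_
          · rw [hT₄, Finset.card_insert_of_notMem (by simp [hbT]),
              Finset.card_erase_add_one haT, hcard]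
          · have hsub : insert b (T.erase a) \ S ⊆ insert b (T \ S) := by
              intro x
              simp only [Finset.mem_sdiff, Finset.mem_insert, Finset.mem_erase]
              tauto
            rw [hT₄]
            exact (Finset.card_le_card hsub).trans ((Finset.card_insert_le _ _).trans (by omega))
          · rintro s₅ hs₅ ⟨h₅, hT₅, h₅'⟩
            have ha₅ : s₅ (30 + 2 * d) 0 = a := by
              rw [hs₅, hfr₄ _ (by omega), ha₃]
              intro h
              rcases hmem _ h with h | h <;> omega
            have hb₅ : s₅ (31 + 2 * d) 0 = b := by
              rw [hs₅, hfr₄ _ (by omega), hb₃]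
              intro h
              rcases hmem _ h with h | h <;> omega
            refine Runs.set_seq <| Runs.set ?_
            simp only [eval_var, eval_const, ha₅,
              write_ne _ _ _ (show 31 + 2 * d ≠ 5 by omega), hb₅]
            refine key _ (h₅.congr fun a' ha' => ?_) ?_ ?_
            · simp at ha'
              rw [write_ne _ _ _ (by omega), write_ne _ _ _ (by omega)]
            · rw [cellSet_write hbN, cellSet_write haN, hT₅, hT₄]
              ext x
              by_cases hxa : x = a
              · simp [hxa, haT, hab]
              · by_cases hxb : x = b
                · simp [hxb, hbT]
                · simp [hxa, hxb]
            · intro h0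
              rw [write_ne _ _ _ (by omega), write_ne _ _ _ (by omega)] at h0
              obtain ⟨h6, h7⟩ := h₅' h0
              rw [hfr₄ _ (by omega)] at h6
              refine ⟨h6, fun _ _ e he T' hT' => ?_⟩
              have := h7 e he T' (by rw [hT₄]; exact hT')
              rwa [show d + 1 + e = d + (e + 1) by omega] at this
        · refine Runs.mono (Runs.skip (key s₃ h₃ hT₃ fun h0 => ⟨h0, fun ha _ => ?_⟩))
            (by omega) (fun _ _ h => h)
          simp only [eval_get, eval_var, ha₃] at hca
          rw [← hT₃, mem_cellSet] at ha
          exact absurd hca ha.2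
      · rintro s₄ hs₄ ⟨h₄, hT₄, h₄'⟩
        refine ⟨h₄.congr fun a ha => write_ne _ _ _ ?_, ?_, fun h0 => ?_⟩
        · simp at ha; omega
        · rw [← hT₄]; exact cellSet_congr (write_ne _ _ _ (by omega)) N
        · rw [write_ne _ _ _ (by omega)] at h0
          refine ⟨(h₂' (h₄' h0).1).1, fun a' ha' => ?_⟩
          rcases Nat.lt_succ_iff_lt_or_eq.1 ha' with ha' | rfl
          · exact (h₂' (h₄' h0).1).2 a' ha'
          · exact (h₄' h0).2
    · exact le_of_eq (by ring)
    · rintro s' hs' ⟨h2, hT2, h2'⟩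
      refine ⟨h2, hT2, fun h0 => ⟨(h₁' (h2' h0).1).1, ?_⟩⟩
      rintro (_ | e) he T' hT'
      · rw [Exch] at hT'
        rw [hT']
        exact (h₁' (h2' h0).1).2
      · obtain ⟨a, haT, b, hbN, hbT, hE⟩ := hT'
        have haN : a < N := Finset.mem_range.1 (cellSet_subset s 5 N haT)
        exact (h2' h0).2 a haN b hbN haT hbT e (by omega) T' hE

end KMedianRAM

/-! ### One iteration of the algorithm, and termination of local search -/

namespace KMedianRAM

open KMedianOutliers

/-- One iteration: exchange medians, or increase the penalty, or stop. -/
def iterProg (c : Params) : Prog :=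
  .seq (assign 19 (.const 0)) <| .seq (copyProg 2 5) <| .seq evalProg <|
  .seq (assign 16 (var 14)) <| .seq (assign 18 (var 15)) <| .seq (assign 17 (.const 0)) <|
  .seq (forLoop 22 (.get 1 (.const 1)) (assign 17 (.add (var 17) (mulConst c.E (var 16))))) <|
  .seq (searchProg c c.ℓ 0) <|
  .ite (var 19) (copyProg 6 2) <|
    .ite (.sub (mulConst c.den (var 18)) (mulConst c.num (.get 1 (.const 2))))
      (assign 9 (.add (var 9) (var 9))) (assign 20 (.const 0))

variable {c : Params} {w : ℕ → ℕ → ℕ} {t N k z p : ℕ} {S : Finset ℕ}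

theorem cellSet_copy {s s' : Store} {a b : ℕ}
    (h : ∀ i, s' b i = if i < N then s a i else s b i) : cellSet s' b N = cellSet s a N := by
  ext i
  rw [mem_cellSet, mem_cellSet, h]
  refine and_congr_right fun hi => ?_
  rw [if_pos hi]

theorem notMem_writes_iterProg {a : ℕ} (ha : a ∈ ({0, 1, 3, 4, 7, 8, 10} : Finset ℕ)) :
    a ∉ (iterProg c).writes := by
  have := @mem_writes_searchProg c a c.ℓ 0
  simp only [Finset.mem_insert, Finset.mem_singleton] at this
  intro h
  simp [iterProg, copyProg, evalProg] at h ha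
  by_cases hm : a ∈ (searchProg c c.ℓ 0).writes
  · rcases this hm with h | h <;> omega
  · simp only [hm, or_false] at h
    omega

/-- A bound for the number of steps of one iteration. -/
def iterSteps (c : Params) (t N k : ℕ) : ℕ :=
  40 + 6 * N + 3 * k + t * (5 * N + 8) +
    searchSteps N (13 + t * (5 * N + 8) + 3 * k + 3 * N) c.ℓ

theorem runs_iterProg {s : Store} (h : Data s w t N k z) (hp : s 9 0 = p)
    (hS : cellSet s 2 N = S) :
    Runs (iterProg c) s (iterSteps c t N k) fun s' =>
      (∀ i, N ≤ i → s' 2 i = s 2 i) ∧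
      ((∃ d ≤ c.ℓ, EffSwap w t N k c.E d p S (cellSet s' 2 N) ∧ s' 9 0 = p ∧
          s' 20 0 = s 20 0) ∨
        (LocalOpt w t N k c.E c.ℓ p S ∧ Violated c w t z p S ∧ cellSet s' 2 N = S ∧
          s' 9 0 = p + p ∧ s' 20 0 = s 20 0) ∨
        (LocalOpt w t N k c.E c.ℓ p S ∧ ¬ Violated c w t z p S ∧ cellSet s' 2 N = S ∧
          s' 9 0 = p ∧ s' 20 0 = 0)) := by
  refine Runs.mono (N := 1 + ((2 + N * 3) + ((4 + t * (5 * N + 8)) + (1 + (1 + (1 +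
    ((2 + k * (1 + 2)) + (searchSteps N (13 + t * (5 * N + 8) + 3 * k + 3 * N) c.ℓ +
      (1 + (2 + N * 3)))))))))) (Runs.assign_seq <| Runs.seq
    (runs_copyProg (N := N) ?_ 2 5 (by simp) (by simp) (by simp) (by simp)) ?_) ?_
    (fun _ _ h => h)
  · rw [write_ne _ _ _ (by simp)]; exact h.N
  swap
  · rw [iterSteps]; omega
  intro s₁ hs₁ h₁
  simp only [copyProg, writes_forLoop, writes_set] at hs₁
  have hS₁ : cellSet s₁ 5 N = S := by
    rw [cellSet_copy h₁, ← hS]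
    exact cellSet_congr (write_ne _ _ _ (by simp)) N
  have hfr₁ : ∀ a ∉ ({5, 11, 19} : Finset ℕ), s₁ a = s a := by
    intro a ha
    simp at ha
    rw [hs₁ a (by simp [ha]), write_ne _ _ _ ha.2.2]
  have hD₁ : Data s₁ w t N k z := by
    refine h.congr ?_ ?_ ?_ ?_ ?_ <;> exact hfr₁ _ (by simp)
  have hp₁ : s₁ 9 0 = p := by rw [hfr₁ 9 (by simp), hp]
  have h19 : s₁ 19 0 = 0 := by rw [hs₁ 19 (by simp)]; simp
  refine Runs.seq (runs_evalProg hD₁) ?_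
  rintro s₂ hs₂ ⟨h₂, h₂'⟩
  rw [hp₁, hS₁] at h₂ h₂'
  refine Runs.assign_seq <| Runs.assign_seq <| Runs.assign_seq <|
    Runs.seq (Runs.forLoop (n := k) (N := 1)
      (fun n s' => s' 17 0 = n * (c.E * pcost w t p S)) (by simp) ?_ ?_ ?_) ?_
  · intro s' hs
    simp only [writes_assign] at hs
    have := hD₁.k
    rw [← hs₂ 1 (by simp [evalProg])] at this
    simp [hs 1, Store.write, this]
  · simp [Store.write]
  · intro n hn s' hs hn' hI
    simp only [writes_assign] at hs
    refine Runs.assign ?_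
    have h16 : s' 16 0 = pcost w t p S := by
      rw [hs 16 (by simp), ← h₂]
      simp [Store.write]
    simp [Store.write, hI, h16]
    ring
  · intro s₃ hs₃ h₃
    simp only [writes_assign, writes_forLoop] at hs₃
    have hfr₃ : ∀ a ∉ insert 16 (insert 17 (insert 18 (insert 22 evalProg.writes))),
        s₃ a = s₁ a := by
      intro a ha
      simp only [Finset.mem_insert, not_or] at ha
      rw [hs₃ a (by simp [ha]), write_ne _ _ _ ha.2.1, write_ne _ _ _ ha.2.2.1,
        write_ne _ _ _ ha.1, hs₂ a ha.2.2.2.2]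
    have h16 : s₃ 16 0 = pcost w t p S := by
      rw [hs₃ 16 (by simp), ← h₂]; simp [Store.write]
    have h18 : s₃ 18 0 = (farPoints w t p S).card := by
      rw [hs₃ 18 (by simp), ← h₂']; simp [Store.write]
    have hinv : SearchInv c w t N k z p S s₃ := by
      refine ⟨?_, ?_, h16, by rw [h₃, mul_assoc], ?_⟩
      · refine hD₁.congr ?_ ?_ ?_ ?_ ?_ <;> exact hfr₃ _ (by simp [evalProg])
      · rw [hfr₃ 9 (by simp [evalProg]), hp₁]
      · rw [hfr₃ 19 (by simp [evalProg]), h19]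
        exact fun h => absurd rfl h
    have hS₃ : cellSet s₃ 5 N = S := by
      rw [cellSet_congr (hfr₃ 5 (by simp [evalProg])), hS₁]
    refine Runs.seq (runs_searchProg c.ℓ hinv (by omega) (by rw [hS₃]) (by simp [hS₃])) ?_
    rintro s₄ hs₄ ⟨h₄, -, h₄'⟩
    rw [hS₃] at h₄'
    have hmem := fun a => @mem_writes_searchProg c a c.ℓ 0
    have hfr₄ : ∀ a ∈ ({1, 2, 9, 18, 20} : Finset ℕ), s₄ a = s₃ a := by
      intro a ha
      refine hs₄ a fun h => ?_
      have := hmem a h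
      simp at this ha
      omega
    have h2 : s₄ 2 = s 2 := by
      rw [hfr₄ 2 (by simp), hfr₃ 2 (by simp [evalProg]), hfr₁ 2 (by simp)]
    have h20 : s₄ 20 = s 20 := by
      rw [hfr₄ 20 (by simp), hfr₃ 20 (by simp [evalProg]), hfr₁ 20 (by simp)]
    refine Runs.ite (fun hc => ?_) (fun hc => ?_)
    · rw [eval_var] at hc
      obtain ⟨d, hd, hsw⟩ := h₄.found hc
      refine Runs.mono (runs_copyProg h₄.data.N 6 2 (by simp) (by simp) (by simp) (by simp))
        le_rfl ?_
      intro s₅ hs₅ h₅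
      simp only [copyProg, writes_forLoop, writes_set] at hs₅
      refine ⟨fun i hi => ?_, Or.inl ⟨d, hd, ?_, ?_, ?_⟩⟩
      · rw [h₅, if_neg (by omega), h2]
      · rw [cellSet_copy h₅]; exact hsw
      · rw [hs₅ 9 (by simp)]; exact h₄.penalty
      · rw [hs₅ 20 (by simp), h20]
    · rw [eval_var] at hc
      have hLO : LocalOpt w t N k c.E c.ℓ p S := by
        intro T hT hTc hTℓ
        have := (h₄' hc).2 _ hTℓ T (exch_of_card hT hTc rfl)
        simpa using this
      have heq : (Expr.sub (mulConst c.den (var 18))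
          (mulConst c.num (.get 1 (.const 2)))).eval s₄ =
          c.den * (farPoints w t p S).card - c.num * z := by
        simp [h₄.data.z, hfr₄ 18, h18]
      refine Runs.mono (N := 1 + 1) (Runs.ite (fun hv => Runs.assign ?_)
        (fun hv => Runs.assign ?_)) (by omega) (fun _ _ h => h)
      · rw [heq] at hv
        refine ⟨fun i _ => ?_, Or.inr (Or.inl ⟨hLO, by rw [Violated]; omega, ?_, ?_, ?_⟩)⟩
        · rw [write_ne _ _ _ (by simp), h2]
        · rw [cellSet_congr (write_ne _ _ _ (by simp)), cellSet_congr h2, hS]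
        · simp [h₄.penalty]
        · rw [write_ne _ _ _ (by simp), h20]
      · rw [heq] at hv
        refine ⟨fun i _ => ?_, Or.inr (Or.inr ⟨hLO, by rw [Violated]; omega, ?_, ?_, ?_⟩)⟩
        · rw [write_ne _ _ _ (by simp), h2]
        · rw [cellSet_congr (write_ne _ _ _ (by simp)), cellSet_congr h2, hS]
        · rw [write_ne _ _ _ (by simp)]; exact h₄.penalty
        · simp

/-- Local search with increasing penalties. -/
def loopProg (c : Params) : Prog := .seq (assign 20 (.const 1)) (.loop (var 20) (iterProg c))

/-- Termination is by lexicographic induction: a doubling happens only for p ≤ D and lowers D + 1 -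
p, and an exchange keeps p and lowers the cost. Since an exchange has size bound at least 1, there
are at most `R + q + 1` rounds. -/
theorem runs_loop {D : ℕ} (hD : ∀ j < t, ∀ i < N, w j i ≤ D) {s : Store}
    (hd : Data s w t N k z) (hp : s 9 0 = p) (hp1 : 1 ≤ p) (hS : cellSet s 2 N = S)
    (hS0 : S.Nonempty) (h20 : s 20 0 ≠ 0) :
    ∃ R q p' S', Path c w t N k z R q p S p' S' ∧
      Runs (.loop (var 20) (iterProg c)) s (1 + (R + q + 1) * (1 + iterSteps c t N k)) fun s' =>
        (∀ i, N ≤ i → s' 2 i = s 2 i) ∧ cellSet s' 2 N = S' ∧ s' 9 0 = p' := by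
  induction hm : D + 1 - p using Nat.strong_induction_on generalizing s p S with
  | _ m ihm =>
  induction hb : pcost w t p S using Nat.strong_induction_on generalizing s S with
  | _ b ihb =>
  obtain ⟨s₁, n₁, h1, h2, h3, h4⟩ := runs_iterProg (c := c) hd hp hS
  have hfr := h1.frame
  have hd₁ : Data s₁ w t N k z := by
    refine hd.congr ?_ ?_ ?_ ?_ ?_ <;> exact hfr _ (notMem_writes_iterProg (by simp))
  rcases h4 with ⟨d, hd', hsw, h5, h6⟩ | ⟨hLO, hv, h6, h7, h8⟩ | ⟨h5, h6, h7, h8, h9⟩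
  · have hd1 := hsw.one_le
    obtain ⟨R, q, p', S', hpath, s₂, n₂, h1', h2', h3', h4'⟩ := ihb _ (hb ▸ hsw.pcost_lt)
      hd₁ h5 rfl (by rw [← Finset.card_pos, hsw.card_eq]; exact hS0.card_pos)
      (by rw [h6]; exact h20) rfl
    refine ⟨R + d, q, p', S', .swap hd' hsw hpath, s₂, _, .loop_step h20 h1 h1', ?_,
      fun i hi => (h3' i hi).trans (h3 i hi), h4'⟩
    nlinarith
  · have hpD := hv.le_of_dist_le hS0 fun j hj i hi =>
      hD j hj i (by rw [← hS] at hi; exact (mem_cellSet.1 hi).1)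
    obtain ⟨R, q, p', S', hpath, s₂, n₂, h1', h2', h3', h4'⟩ := ihm _
      (by omega) hd₁ h7 (by omega) h6 hS0 (by rw [h8]; exact h20) rfl
    refine ⟨R, q + 1, p', S', .double hLO hv hpath, s₂, _, .loop_step h20 h1 h1', ?_,
      fun i hi => (h3' i hi).trans (h3 i hi), h4'⟩
    nlinarith
  · exact ⟨0, 0, p, S, .done h5 h6, s₁, _, .loop_step h20 h1 (.loop_done h9),
      by omega, h3, h7, h8⟩

theorem runs_loopProg {D : ℕ} (hD : ∀ j < t, ∀ i < N, w j i ≤ D) {s : Store}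
    (hd : Data s w t N k z) (hp : s 9 0 = p) (hp1 : 1 ≤ p) (hS : cellSet s 2 N = S)
    (hS0 : S.Nonempty) :
    ∃ R q p' S', Path c w t N k z R q p S p' S' ∧
      Runs (loopProg c) s (2 + (R + q + 1) * (1 + iterSteps c t N k)) fun s' =>
        (∀ i, N ≤ i → s' 2 i = s 2 i) ∧ cellSet s' 2 N = S' ∧ s' 9 0 = p' := by
  have hne : ∀ a, a ≠ 20 → s.write 20 0 1 a = s a := fun a ha => write_ne _ _ _ ha
  obtain ⟨R, q, p', S', hpath, hrun⟩ := runs_loop (c := c) hD (s := s.write 20 0 1)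
    (hd.congr (hne _ (by simp)) (hne _ (by simp)) (hne _ (by simp)) (hne _ (by simp))
      (hne _ (by simp))) (by rw [hne _ (by simp)]; exact hp) hp1
    (by rw [cellSet_congr (hne _ (by simp))]; exact hS) hS0 (by simp)
  refine ⟨R, q, p', S', hpath, Runs.mono (Runs.assign_seq hrun) (by omega) ?_⟩
  rintro s' - ⟨h1, h2⟩
  refine ⟨fun i hi => ?_, h2⟩
  rw [h1 i hi, hne _ (by simp)]

end KMedianRAM

namespace KMedianRAM

open KMedianOutliers

/-! ### Processing an arrival -/

/-- Triangular numbers. -/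
def tri : ℕ → ℕ
  | 0 => 0
  | n + 1 => tri n + n + 1

/-- The cell of array `3` that holds the distance between location `i` and point `j`. -/
def addr (i j : ℕ) : ℕ := tri (i + j) + j

theorem tri_add_lt {a b : ℕ} (h : a < b) : tri a + a < tri b := by
  induction b, h using Nat.le_induction with
  | base => rw [tri]; omega
  | succ b _ ih => rw [tri]; omega

/-- This is Cantor pairing. Addresses stay polynomial and do not depend on the unknown `n`, and the
triangular numbers can be tabulated by additions alone. -/
theorem addr_inj {i j i' j' : ℕ} : addr i j = addr i' j' ↔ i = i' ∧ j = j' := by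
  constructor
  · intro h
    simp only [addr] at h
    rcases lt_trichotomy (i + j) (i' + j') with h1 | h1 | h1
    · have := tri_add_lt h1; omega
    · rw [h1] at h; omega
    · have := tri_add_lt h1; omega
  · rintro ⟨rfl, rfl⟩; rfl

/-- Compute the triangular numbers needed for the addresses of the distances. -/
def triProg : Prog := forLoop 11 (.add (var 8) (var 7))
  (.set 4 (.add (var 11) (.const 1)) (.add (.get 4 (var 11)) (.add (var 11) (.const 1))))

theorem runs_triProg {s : Store} {t N : ℕ} (ht : s 7 0 = t) (hN : s 8 0 = N) (h4 : s 4 0 = 0) :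
    Runs triProg s (2 + (N + t) * 3) fun s' => ∀ u ≤ N + t, s' 4 u = tri u := by
  refine Runs.forLoop (n := N + t) (N := 1) (fun n s' => ∀ u ≤ n, s' 4 u = tri u) (by simp)
    ?_ ?_ ?_
  · intro s' hs
    simp [hs 8, hs 7, ht, hN]
  · intro u hu
    obtain rfl : u = 0 := by omega
    rw [write_ne _ _ _ (by simp), h4, tri]
  · intro n hn s' hs hn' hI
    refine Runs.set ?_
    intro u hu
    rw [write_ne _ _ _ (by simp), write_apply]
    simp only [eval_add, eval_var, eval_const, eval_get, hn']
    split_ifs with h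
    · rw [hI n le_rfl, h, tri]; ring
    · exact hI u (by omega)

/-- Store the distances between the new point and the locations. -/
def storeStatic : Prog := forLoop 11 (var 8)
  (.set 3 (.add (.get 4 (.add (var 11) (var 7))) (var 7)) (.get 0 (var 11)))

/-- Store the distances between the new point and the points, in both orders. -/
def storeDynamic : Prog := forLoop 11 (var 8) <|
  .seq (.set 3 (.add (.get 4 (.add (var 11) (var 7))) (var 7)) (.get 0 (var 11)))
    (.set 3 (.add (.get 4 (.add (var 7) (var 11))) (var 11)) (.get 0 (var 11)))

variable {c : Params} {w : ℕ → ℕ → ℕ} {t N k z p : ℕ} {S : Finset ℕ}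

theorem runs_storeStatic {s : Store} (ht : s 7 0 = t) (hN : s 8 0 = N)
    (h4 : ∀ u ≤ N + t, s 4 u = tri u) (h0 : ∀ i < N, s 0 i = w t i)
    (h : ∀ j < t, ∀ i < N, s 3 (addr i j) = w j i) :
    Runs storeStatic s (2 + N * 4) fun s' =>
      ∀ j < t + 1, ∀ i < N, s' 3 (addr i j) = w j i := by
  refine Runs.mono (Runs.forLoop (n := N) (N := 1) (fun n s' =>
    (∀ j < t, ∀ i < N, s' 3 (addr i j) = w j i) ∧ ∀ i < n, s' 3 (addr i t) = w t i) (by simp)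
    ?_ ?_ ?_) (by omega) ?_
  · intro s' hs
    simp [hs 8, hN]
  · rw [write_ne _ _ _ (by simp)]
    exact ⟨h, by simp⟩
  · rintro n hn s' hs hn' ⟨hI, hI'⟩
    refine Runs.set ?_
    have ha : (Expr.add (.get 4 (.add (var 11) (var 7))) (var 7)).eval s' = addr n t := by
      simp [hn', hs 4, hs 7, ht, h4 (n + t) (by omega), addr]
    rw [ha, write_ne _ _ _ (by simp)]
    simp only [write_apply, addr_inj, and_true, eval_get, eval_var, hn', hs 0 (by simp), h0 n hn]
    refine ⟨fun j hj i hi => ?_, fun i hi => ?_⟩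
    · rw [if_neg (by omega)]; exact hI j hj i hi
    · split_ifs with hc
      · rw [hc]
      · exact hI' i (by omega)
  · rintro s' - ⟨h1, h2⟩ j hj i hi
    rcases Nat.lt_succ_iff_lt_or_eq.1 hj with hj | rfl
    · exact h1 j hj i hi
    · exact h2 i hi

/-- The arriving point is both a point and a location: the known square of distances grows by a row
and a column, both filled from the same input row by symmetry. -/
theorem runs_storeDynamic {s : Store} (ht : s 7 0 = t) (hN : s 8 0 = t + 1)
    (h4 : ∀ u ≤ t + 1 + t, s 4 u = tri u) (h0 : ∀ i < t + 1, s 0 i = w t i)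
    (hw : ∀ i < t + 1, w i t = w t i) (h : ∀ j < t, ∀ i < t, s 3 (addr i j) = w j i) :
    Runs storeDynamic s (2 + (t + 1) * 4) fun s' =>
      ∀ j < t + 1, ∀ i < t + 1, s' 3 (addr i j) = w j i := by
  refine Runs.mono (Runs.forLoop (n := t + 1) (N := 1 + 1) (fun n s' =>
    (∀ j < t, ∀ i < t, s' 3 (addr i j) = w j i) ∧
      ∀ i < n, s' 3 (addr i t) = w t i ∧ s' 3 (addr t i) = w t i) (by simp)
    ?_ ?_ ?_) (by omega) ?_
  · intro s' hs
    simp [hs 8, hN]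
  · rw [write_ne _ _ _ (by simp)]
    exact ⟨h, by simp⟩
  · rintro n hn s' hs hn' ⟨hI, hI'⟩
    refine Runs.set_seq (Runs.set ?_)
    have ha : (Expr.add (.get 4 (.add (var 11) (var 7))) (var 7)).eval s' = addr n t := by
      simp [hn', hs 4, hs 7, ht, h4 (n + t) (by omega), addr]
    have hr : (Expr.get 0 (var 11)).eval s' = w t n := by
      simp [hn', hs 0, h0 n hn]
    rw [ha, hr]
    have ha' : (Expr.add (.get 4 (.add (var 7) (var 11))) (var 11)).eval
        (s'.write 3 (addr n t) (w t n)) = addr t n := by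
      simp [write_ne, hn', hs 4, hs 7, ht, h4 (t + n) (by omega), addr]
    have hr' : (Expr.get 0 (var 11)).eval (s'.write 3 (addr n t) (w t n)) = w t n := by
      simp [write_ne, hn', hs 0, h0 n hn]
    rw [ha', hr', write_ne _ _ _ (by simp)]
    simp only [write_apply, addr_inj, and_true, true_and]
    refine ⟨fun j hj i hi => ?_, fun i hi => ⟨?_, ?_⟩⟩
    · rw [if_neg (by omega), if_neg (by omega)]; exact hI j hj i hi
    · split_ifs with hc hc
      · rw [hc.1, hc.2]
      · rw [hc]
      · exact (hI' i (by omega)).1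
    · split_ifs with hc hc
      · rw [hc]
      · rw [hc.2, hc.1]
      · exact (hI' i (by omega)).2
  · rintro s' - ⟨h1, h2⟩ j hj i hi
    rcases Nat.lt_succ_iff_lt_or_eq.1 hj with hj | rfl
    · rcases Nat.lt_succ_iff_lt_or_eq.1 hi with hi | rfl
      · exact h1 j hj i hi
      · rw [(h2 j (by omega)).2, hw j (by omega)]
    · exact (h2 i hi).1

/-- Open further medians while there are fewer than `k`. -/
def fillProg : Prog := forLoop 11 (var 8) <|
  .ite (.get 2 (var 11)) .skip <|
    .ite (.sub (.get 1 (.const 1)) (var 10))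
      (.seq (.set 2 (var 11) (.const 1)) (assign 10 (.add (var 10) (.const 1)))) .skip

/-- If the counter is still below `k` at the end, no closed location was passed over, so all `N` are
open; otherwise there are exactly `k`. -/
theorem runs_fillProg {s : Store} (hN : s 8 0 = N) (hk : s 1 1 = k)
    (h10 : s 10 0 = (cellSet s 2 N).card) (hle : (cellSet s 2 N).card ≤ k) :
    Runs fillProg s (2 + N * 6) fun s' => cellSet s 2 N ⊆ cellSet s' 2 N ∧
      (cellSet s' 2 N).card = min k N ∧ s' 10 0 = (cellSet s' 2 N).card ∧
      ∀ i, N ≤ i → s' 2 i = s 2 i := by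
  refine Runs.mono (Runs.forLoop (n := N) (N := 1 + (1 + (1 + 1))) (fun n s' =>
    cellSet s 2 N ⊆ cellSet s' 2 N ∧ s' 10 0 = (cellSet s' 2 N).card ∧ s' 10 0 ≤ k ∧
      (s' 10 0 < k → ∀ i < n, s' 2 i ≠ 0) ∧ ∀ i, N ≤ i → s' 2 i = s 2 i) (by simp)
    ?_ ?_ ?_) (by omega) ?_
  · intro s' hs
    simp [hs 8, hN]
  · have h2 : cellSet (s.write 11 0 0) 2 N = cellSet s 2 N :=
      cellSet_congr (write_ne _ _ _ (by simp)) N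
    rw [h2, write_ne _ _ _ (by simp), write_ne _ _ _ (by simp)]
    exact ⟨subset_rfl, h10, by omega, by simp, by simp⟩
  · rintro n hn s' hs hn' ⟨h1, h2, h3, h4, h5⟩
    have hk' : s' 1 1 = k := by rw [hs 1 (by simp), hk]
    have hcs : cellSet (s'.write 11 0 (n + 1)) 2 N = cellSet s' 2 N :=
      cellSet_congr (write_ne _ _ _ (by simp)) N
    refine Runs.ite (fun hc => Runs.mono (N := 1) (Runs.skip ?_) (by omega) (fun _ _ h => h))
      (fun hc => Runs.ite (fun hlt => Runs.set_seq (Runs.assign ?_))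
        (fun hge => Runs.mono (N := 1) (Runs.skip ?_) (by omega) (fun _ _ h => h)))
    · simp only [eval_get, eval_var, hn'] at hc
      rw [hcs, write_ne _ _ _ (by simp), write_ne _ _ _ (by simp)]
      refine ⟨h1, h2, h3, fun hlt i hi => ?_, h5⟩
      rcases Nat.lt_succ_iff_lt_or_eq.1 hi with hi | rfl
      · exact h4 hlt i hi
      · exact hc
    · simp only [eval_get, eval_var, hn'] at hc
      simp only [eval_sub, eval_get, eval_const, eval_var, hk'] at hlt
      simp only [eval_add, eval_var, eval_const, hn']
      have hcs' : cellSet (((s'.write 2 n 1).write 10 0 ((s'.write 2 n 1) 10 0 + 1)).write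
          11 0 (n + 1)) 2 N = insert n (cellSet s' 2 N) := by
        rw [cellSet_congr (s := s'.write 2 n 1)
          (by rw [write_ne _ _ _ (by simp), write_ne _ _ _ (by simp)]), cellSet_write hn]
        simp
      have hnot : n ∉ cellSet s' 2 N := fun h => (mem_cellSet.1 h).2 hc
      rw [hcs', Finset.card_insert_of_notMem hnot]
      simp only [write_ne _ _ _ (show 2 ≠ 11 by simp), write_ne _ _ _ (show 2 ≠ 10 by simp),
        write_ne _ _ _ (show 10 ≠ 11 by simp), write_ne _ _ _ (show 10 ≠ 2 by simp),
        write_apply, if_true]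
      refine ⟨h1.trans (Finset.subset_insert _ _), by omega, by omega, fun hlt i hi => ?_,
        fun i hi => ?_⟩
      · split_ifs with hin
        · simp
        · exact h4 (by omega) i (by omega)
      · rw [if_neg (by omega)]; exact h5 i hi
    · simp only [eval_sub, eval_get, eval_const, eval_var, hk'] at hge
      rw [hcs, write_ne _ _ _ (by simp), write_ne _ _ _ (by simp)]
      exact ⟨h1, h2, h3, fun hlt => by omega, h5⟩
  · rintro s' - ⟨h1, h2, h3, h4, h5⟩
    refine ⟨h1, ?_, h2, h5⟩
    have hcN : (cellSet s' 2 N).card ≤ N := by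
      simpa using Finset.card_le_card (cellSet_subset s' 2 N)
    by_cases hlt : s' 10 0 < k
    · have : cellSet s' 2 N = Finset.range N := by
        ext i
        rw [mem_cellSet, Finset.mem_range]
        exact ⟨fun h => h.1, fun h => ⟨h, h4 hlt i h⟩⟩
      rw [this, Finset.card_range] at h2 ⊢
      omega
    · omega

/-- The program that is executed for every arriving point. -/
def arriveProg (c : Params) (locs : Expr) (store : Prog) : Prog :=
  .seq (assign 8 locs) <| .seq triProg <| .seq store <|
  .seq (.ite (var 9) .skip (assign 9 (.const 1))) <| .seq fillProg <|
  .seq (assign 7 (.add (var 7) (.const 1))) (loopProg c)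

/-- The memory between two arrivals: there are `t` points and `N` locations, the penalty is `p`
and the solution is `S`. -/
structure Rest (w : ℕ → ℕ → ℕ) (m k z t N p : ℕ) (S : Finset ℕ) (s : Store) : Prop where
  param_m : s 1 0 = m
  param_k : s 1 1 = k
  param_z : s 1 2 = z
  points : s 7 0 = t
  tri_zero : s 4 0 = 0
  dist : ∀ j < t, ∀ i < N, s 3 (addr i j) = w j i
  penalty : max (s 9 0) 1 = p
  medians : cellSet s 2 N = S
  above : ∀ i, N ≤ i → s 2 i = 0
  card : s 10 0 = S.card
  card_le : S.card ≤ k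

/-- A bound for the number of steps for one arrival. -/
def arriveSteps (c : Params) (t N k r : ℕ) : ℕ :=
  20 + 3 * (N + t) + 10 * N + (r + 1) * (1 + iterSteps c (t + 1) N k)

theorem cellSet_of_zero {s : Store} {a N' : ℕ} (hN : N ≤ N') (h : ∀ i, N ≤ i → s a i = 0) :
    cellSet s a N' = cellSet s a N := by
  ext i
  rw [mem_cellSet, mem_cellSet]
  constructor
  · rintro ⟨_, h2⟩
    exact ⟨by by_contra hi; exact h2 (h i (by omega)), h2⟩
  · rintro ⟨h1, h2⟩
    exact ⟨by omega, h2⟩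

/-- The settings differ only in the number of locations `locs` and in how distances are stored, so
both are parameters. The field `Rest.above` ensures that a newly available location starts closed,
and `Rest.penalty` reads an uninitialized penalty 0 as 1. -/
theorem runs_arriveProg {D m N' : ℕ} {locs : Expr} {store : Prog}
    (hD : ∀ j < t + 1, ∀ i < N', w j i ≤ D) (hk : 1 ≤ k) (hN : N ≤ N') (hN' : 1 ≤ N')
    (hwr : store.writes ⊆ {3, 11}) {s : Store} (h : Rest w m k z t N p S s)
    (hlocs : locs.eval s = N')
    (hstore : ∀ s', (∀ a ∉ ({4, 8, 11} : Finset ℕ), s' a = s a) → s' 7 0 = t → s' 8 0 = N' →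
      (∀ u ≤ N' + t, s' 4 u = tri u) →
      Runs store s' (2 + N' * 4) fun s'' => ∀ j < t + 1, ∀ i < N', s'' 3 (addr i j) = w j i) :
    ∃ R q p' S₁ S', S ⊆ S₁ ∧ S₁ ⊆ Finset.range N' ∧ S₁.card = min k N' ∧
      Path c w (t + 1) N' k z R q p S₁ p' S' ∧
      Runs (arriveProg c locs store) s (arriveSteps c t N' k (R + q))
        (Rest w m k z (t + 1) N' p' S') := by
  have hw3 : ∀ a, a ≠ 3 → a ≠ 11 → a ∉ store.writes := fun a h3 h11 ha => by
    have := hwr ha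
    simp [h3, h11] at this
  have h2N' : cellSet s 2 N' = S := by rw [cellSet_of_zero hN h.above, h.medians]
  obtain ⟨s₁, n₁, hst₁, hn₁, h₁⟩ := runs_triProg (s := s.write 8 0 N') (t := t) (N := N')
    (by rw [write_ne _ _ _ (by simp)]; exact h.points) (by simp)
    (by rw [write_ne _ _ _ (by simp)]; exact h.tri_zero)
  have hs₁ := hst₁.frame
  have hf₁ : ∀ a ∉ ({4, 8, 11} : Finset ℕ), s₁ a = s a := by
    intro a ha
    simp at ha
    rw [hs₁ a (by simp [triProg, ha]), write_ne _ _ _ ha.2.1]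
  have h8 : s₁ 8 0 = N' := by rw [hs₁ 8 (by simp [triProg])]; simp
  have h7 : s₁ 7 0 = t := by rw [hf₁ 7 (by simp)]; exact h.points
  obtain ⟨s₂, n₂, hst₂, hn₂, h₂⟩ := hstore s₁ hf₁ h7 h8 h₁
  have hs₂ := hst₂.frame
  -- penalty
  obtain ⟨s₃, hst₃, hs₃, h₃⟩ : ∃ s₃, Steps (.ite (var 9) .skip (assign 9 (.const 1))) s₂ s₃ 2 ∧
      (∀ a, a ≠ 9 → s₃ a = s₂ a) ∧ s₃ 9 0 = p := by
    have h9 : s₂ 9 0 = s 9 0 := by rw [hs₂ 9 (hw3 _ (by simp) (by simp)), hf₁ 9 (by simp)]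
    have hpen := h.penalty
    by_cases h0 : s₂ 9 0 = 0
    · refine ⟨s₂.write 9 0 1, .ite_false (show (var 9).eval s₂ = 0 from h0) (.set _ _ _ _), fun a ha => write_ne _ _ _ ha, ?_⟩
      simp
      omega
    · exact ⟨s₂, .ite_true (show (var 9).eval s₂ ≠ 0 from h0) (.skip _), fun _ _ => rfl, by omega⟩
  have hs₃' : ∀ a, a ≠ 3 → a ≠ 9 → a ≠ 11 → s₃ a = s₁ a := fun a h3 h9 h11 => by
    rw [hs₃ a h9, hs₂ a (hw3 a h3 h11)]
  have hs₃'' : ∀ a ∉ ({3, 4, 8, 9, 11} : Finset ℕ), s₃ a = s a := fun a ha => by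
    simp at ha
    rw [hs₃' a ha.1 (by omega) (by omega), hf₁ a (by simp; omega)]
  have hS₃ : cellSet s₃ 2 N' = S := by
    rw [cellSet_congr (hs₃'' 2 (by simp)), h2N']
  obtain ⟨s₄, n₄, hst₄, hn₄, hS₄, hc₄, h10₄, habove₄⟩ := runs_fillProg (s := s₃) (N := N') (k := k)
    (by rw [hs₃' 8 (by simp) (by simp) (by simp), h8]) (by rw [hs₃'' 1 (by simp), h.param_k])
    (by rw [hS₃, hs₃'' 10 (by simp), h.card]) (by rw [hS₃]; exact h.card_le)
  have hs₄ := hst₄.frame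
  set s₅ := s₄.write 7 0 (t + 1) with hs₅
  have hst₅ : Steps (assign 7 (.add (var 7) (.const 1))) s₄ s₅ 1 := by
    have := Steps.set s₄ 7 (.const 0) (.add (var 7) (.const 1))
    have h7' : s₄ 7 0 = t := by
      rw [hs₄ 7 (by simp [fillProg]), hs₃' 7 (by simp) (by simp) (by simp), h7]
    simpa [assign, h7'] using this
  have hf₅ : ∀ a ∉ ({2, 7, 10, 11} : Finset ℕ), s₅ a = s₃ a := fun a ha => by
    simp at ha
    rw [hs₅, write_ne _ _ _ ha.2.1, hs₄ a (by simp [fillProg]; omega)]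
  have hS₅ : cellSet s₅ 2 N' = cellSet s₄ 2 N' := cellSet_congr (write_ne _ _ _ (by simp)) N'
  have htri₅ : ∀ u ≤ N' + t, s₅ 4 u = tri u := by
    rw [hf₅ 4 (by simp), hs₃' 4 (by simp) (by simp) (by simp)]
    exact h₁
  have hdist₅ : ∀ j < t + 1, ∀ i < N', s₅ 3 (addr i j) = w j i := by
    rw [hf₅ 3 (by simp), hs₃ 3 (by simp)]
    exact h₂
  have hD₅ : Data s₅ w (t + 1) N' k z := by
    refine ⟨fun j hj i hi => ?_, ?_, ?_, by simp [hs₅], ?_⟩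
    · rw [htri₅ (i + j) (by omega)]; exact hdist₅ j hj i hi
    · rw [hf₅ 1 (by simp), hs₃'' 1 (by simp), h.param_k]
    · rw [hf₅ 1 (by simp), hs₃'' 1 (by simp), h.param_z]
    · rw [hf₅ 8 (by simp), hs₃' 8 (by simp) (by simp) (by simp), h8]
  have hpen := h.penalty
  obtain ⟨R, q, p', S', hpath, s₆, n₆, hst₆, hn₆, habove₆, hS₆, hp₆⟩ := runs_loopProg (c := c) hD
    hD₅ (p := p) (S := cellSet s₄ 2 N') (by rw [hf₅ 9 (by simp), h₃]) (by omega) hS₅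
    (by rw [← Finset.card_pos, hc₄]; omega)
  have hf₆ : ∀ a ∈ ({0, 1, 3, 4, 7, 8, 10} : Finset ℕ), s₆ a = s₅ a := fun a ha => by
    refine hst₆.frame a ?_
    have := notMem_writes_iterProg (c := c) ha
    simp [loopProg, this]
    simp at ha
    omega
  have hst₀ : Steps (assign 8 locs) s (s.write 8 0 N') 1 := by
    have := Steps.set s 8 (.const 0) locs
    rwa [hlocs] at this
  have hall : Steps (arriveProg c locs store) s s₆ _ :=
    .seq hst₀ (.seq hst₁ (.seq hst₂ (.seq hst₃ (.seq hst₄ (.seq hst₅ hst₆)))))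
  refine ⟨R, q, p', cellSet s₄ 2 N', S', by rw [← hS₃]; exact hS₄, cellSet_subset _ _ _, hc₄,
    hpath, s₆, _, hall, ?_, ?_⟩
  · rw [arriveSteps]
    omega
  · have hp1 : 1 ≤ p := by omega
    constructor
    · rw [hf₆ 1 (by simp), hf₅ 1 (by simp), hs₃'' 1 (by simp), h.param_m]
    · rw [hf₆ 1 (by simp), hf₅ 1 (by simp), hs₃'' 1 (by simp), h.param_k]
    · rw [hf₆ 1 (by simp), hf₅ 1 (by simp), hs₃'' 1 (by simp), h.param_z]
    · rw [hf₆ 7 (by simp), hs₅]; simp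
    · rw [hf₆ 4 (by simp), htri₅ 0 (by omega), tri]
    · rw [hf₆ 3 (by simp)]; exact hdist₅
    · have : 1 ≤ p' := by
        rw [hpath.penalty_eq]
        exact Nat.mul_pos (by positivity) hp1
      omega
    · exact hS₆
    · intro i hi
      rw [habove₆ i hi, hs₅, write_ne _ _ _ (by simp), habove₄ i hi, hs₃'' 2 (by simp)]
      exact h.above i (by omega)
    · rw [hf₆ 10 (by simp), hs₅, write_ne _ _ _ (by simp), h10₄, hpath.card_eq]
    · rw [hpath.card_eq, hc₄]
      exact min_le_left _ _

end KMedianRAM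

namespace KMedianRAM

open KMedianOutliers

/-! ### The whole run -/

/-- Dependent choice up to a finite horizon, used to assemble the run from the single arrivals. -/
theorem exists_seq {α : Type} {n : ℕ} (P : ℕ → α → Prop) (Q : ℕ → α → α → Prop) (a : α)
    (h0 : P 0 a) (step : ∀ t < n, ∀ a, P t a → ∃ b, P (t + 1) b ∧ Q t a b) :
    ∃ f : ℕ → α, f 0 = a ∧ (∀ t ≤ n, P t (f t)) ∧ ∀ t < n, Q t (f t) (f (t + 1)) := by
  induction n with
  | zero =>
    exact ⟨fun _ => a, rfl, fun t ht => by rwa [Nat.le_zero.1 ht], by simp⟩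
  | succ n ih =>
    obtain ⟨f, hf0, hf, hf'⟩ := ih fun t ht => step t (by omega)
    obtain ⟨b, hb, hb'⟩ := step n (by omega) (f n) (hf n le_rfl)
    have hne : ∀ t ≤ n, Function.update f (n + 1) b t = f t := fun t ht =>
      Function.update_of_ne (by omega) _ _
    have heq : Function.update f (n + 1) b (n + 1) = b := Function.update_self _ _ _
    refine ⟨Function.update f (n + 1) b, ?_, fun t ht => ?_, fun t ht => ?_⟩
    · rw [hne 0 (by omega), hf0]
    · rcases Nat.le_succ_iff.1 ht with h | rfl
      · rw [hne t h]; exact hf t h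
      · rw [heq]; exact hb
    · rw [hne t (by omega)]
      rcases Nat.lt_succ_iff_lt_or_eq.1 ht with h | rfl
      · rw [hne (t + 1) (by omega)]; exact hf' t h
      · rw [heq]; exact hb'

theorem searchSteps_mono {N N' B B' : ℕ} (hN : N ≤ N') (hB : B ≤ B') (r : ℕ) :
    searchSteps N B r ≤ searchSteps N' B' r := by
  induction r with
  | zero => exact hB
  | succ r ih => simp only [searchSteps]; gcongr

theorem arriveSteps_mono (c : Params) {t t' N N' k k' r r' : ℕ} (ht : t ≤ t') (hN : N ≤ N')
    (hk : k ≤ k') (hr : r ≤ r') : arriveSteps c t N k r ≤ arriveSteps c t' N' k' r' := by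
  have : searchSteps N (13 + (t + 1) * (5 * N + 8) + 3 * k + 3 * N) c.ℓ ≤
      searchSteps N' (13 + (t' + 1) * (5 * N' + 8) + 3 * k' + 3 * N') c.ℓ :=
    searchSteps_mono hN (by gcongr) _
  simp only [arriveSteps, iterSteps]
  gcongr

/-- A bound for the number of iterations for one arrival, where `b` is the number of bits of the
penalty. -/
def roundBound (c : Params) (n k b : ℕ) : ℕ := 2 * (k * c.E) * (n + 2 * b) + b

/-- A worst-case count for a single arrival, used only for the running time: the potential never
exceeds the bit length of (n + 1)·B, and there are at most as many doublings as `B` has bits. -/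
theorem path_length_le {c : Params} {w : ℕ → ℕ → ℕ} {t N k z R q p p' B n : ℕ} {S S' : Finset ℕ}
    (h : Path c w t N k z R q p S p' S') (hp : 1 ≤ p) (hp' : p' ≤ B) (ht : t ≤ n) :
    R + q ≤ roundBound c n k B.size := by
  have hpp := h.penalty_eq
  have hpB : p ≤ B := by
    refine le_trans ?_ hp'
    rw [hpp]
    exact Nat.le_mul_of_pos_left _ (by positivity)
  have h2B : B < 2 ^ B.size := Nat.lt_size_self B
  have hlog2 : Real.log 2 ≤ 1 := by
    have := Real.log_two_lt_d9; linarith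
  have hlog2' : 0 ≤ Real.log 2 := Real.log_nonneg (by norm_num)
  have hpow : ∀ {a e : ℕ}, 0 < a → a ≤ 2 ^ e → Real.log a ≤ e := by
    intro a e ha hae
    have h1 : (a : ℝ) ≤ 2 ^ e := by exact_mod_cast hae
    have h2 := Real.log_le_log (by exact_mod_cast ha) h1
    rw [Real.log_pow] at h2
    have : (e : ℝ) * Real.log 2 ≤ e * 1 := by gcongr
    linarith
  have hq : q ≤ B.size := by
    have : 2 ^ q < 2 ^ B.size := lt_of_le_of_lt (by
      calc 2 ^ q ≤ 2 ^ q * p := Nat.le_mul_of_pos_right _ hp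
        _ = p' := hpp.symm
        _ ≤ B := hp') h2B
    exact ((Nat.pow_lt_pow_iff_right one_lt_two).1 this).le
  have hcost : 1 + pcost w t p S ≤ 2 ^ (n + B.size) := by
    have h1 : pcost w t p S ≤ t * p := by
      refine (Finset.sum_le_card_nsmul _ _ p fun j _ => tdist_le).trans ?_
      simp
    have h2 : t * p ≤ n * B := Nat.mul_le_mul ht hpB
    have h3 : n + 1 ≤ 2 ^ n := Nat.lt_two_pow_self
    rw [pow_add]
    calc 1 + pcost w t p S ≤ (n + 1) * B := by nlinarith
      _ ≤ 2 ^ n * 2 ^ B.size := Nat.mul_le_mul h3 h2B.le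
  have h1 := hpow (by omega) hcost
  have h2 : 0 ≤ Real.log (1 + pcost w t p' S') := Real.log_nonneg (by
    have : (0 : ℝ) ≤ pcost w t p' S' := by positivity
    linarith)
  have h3 := h.le_log
  have hq' : (q : ℝ) ≤ B.size := by exact_mod_cast hq
  have h4 : (q : ℝ) * Real.log 2 ≤ B.size * 1 := by gcongr
  have h5 : (R : ℝ) ≤ 2 * (k * c.E) * (n + 2 * B.size) := by
    refine h3.trans (mul_le_mul_of_nonneg_left ?_ (by positivity))
    push_cast at h1
    linarith
  have h6 : R ≤ 2 * (k * c.E) * (n + 2 * B.size) := by exact_mod_cast h5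
  rw [roundBound]
  omega

theorem Rest.feed {w : ℕ → ℕ → ℕ} {m k z t N p : ℕ} {S : Finset ℕ} {s : Store}
    (h : Rest w m k z t N p S s) (len : ℕ) (row : ℕ → ℕ) :
    Rest w m k z t N p S (feed s len row) := by
  have hne : ∀ a, a ≠ 0 → KMedianRAM.feed s len row a = s a := fun a ha => by
    funext i; simp [KMedianRAM.feed, ha]
  constructor
  · rw [hne _ (by simp)]; exact h.param_m
  · rw [hne _ (by simp)]; exact h.param_k
  · rw [hne _ (by simp)]; exact h.param_z
  · rw [hne _ (by simp)]; exact h.points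
  · rw [hne _ (by simp)]; exact h.tri_zero
  · rw [hne _ (by simp)]; exact h.dist
  · rw [hne _ (by simp)]; exact h.penalty
  · rw [cellSet_congr (hne _ (by simp))]; exact h.medians
  · rw [hne _ (by simp)]; exact h.above
  · rw [hne _ (by simp)]; exact h.card
  · exact h.card_le

theorem rest_initStore (w : ℕ → ℕ → ℕ) (m k z : ℕ) :
    Rest w m k z 0 0 1 ∅ (initStore m k z) := by
  constructor <;> simp [initStore, cellSet]

theorem bitBound_initStore {m k z b : ℕ} (hm : m.size ≤ b) (hk : k.size ≤ b) (hz : z.size ≤ b) :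
    BitBound (initStore m k z) b := by
  intro a i
  simp only [initStore]
  split_ifs <;> simp [*]

theorem BitBound.feed {s : Store} {b len : ℕ} {row : ℕ → ℕ} (h : BitBound s b)
    (hrow : ∀ i < len, (row i).size ≤ b) : BitBound (KMedianRAM.feed s len row) b := by
  intro a i
  simp only [KMedianRAM.feed]
  split_ifs with h1 h2
  · exact hrow i h2
  · simp
  · exact h a i

/-- A bound for the time of one arrival. -/
def timeBound (c : Params) (C n M k b : ℕ) : ℕ :=
  arriveSteps c n M k (roundBound c n k (b + 2)) *
    (C * (1 + b + (n + 1) * (arriveSteps c n M k (roundBound c n k (b + 2)) * C)))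

theorem exists_run (c : Params) {w : ℕ → ℕ → ℕ} {n m k z D M b : ℕ} {Nf : ℕ → ℕ} {locs : Expr}
    {store : Prog} {len : ℕ → ℕ} {row : ℕ → ℕ → ℕ} (hN0 : Nf 0 = 0)
    (hmono : ∀ t < n, Nf t ≤ Nf (t + 1)) (hpos : ∀ t < n, 1 ≤ Nf (t + 1))
    (hM : ∀ t ≤ n, Nf t ≤ M) (hD : ∀ j < n, ∀ i < M, w j i ≤ D) (hk : 1 ≤ k)
    (hwr : store.writes ⊆ {3, 11})
    (hlocs : ∀ t < n, ∀ s : Store, s 1 0 = m → s 7 0 = t → locs.eval s = Nf (t + 1))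
    (hstore : ∀ t < n, ∀ s : Store, s 7 0 = t → s 8 0 = Nf (t + 1) →
      (∀ u ≤ Nf (t + 1) + t, s 4 u = tri u) →
      (∀ j < t, ∀ i < Nf t, s 3 (addr i j) = w j i) →
      (∀ i, s 0 i = if i < len t then row t i else 0) →
      Runs store s (2 + Nf (t + 1) * 4) fun s' =>
        ∀ j < t + 1, ∀ i < Nf (t + 1), s' 3 (addr i j) = w j i)
    (hrow : ∀ t < n, ∀ i < len t, (row t i).size ≤ b)
    (hmb : m.size ≤ b) (hkb : k.size ≤ b) (hzb : z.size ≤ b) (hDb : D.size ≤ b) :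
    ∃ (σ : ℕ → Store) (τ p R q : ℕ → ℕ) (S₁ : ℕ → Finset ℕ),
      IsOnlineRun (arriveProg c locs store) (initStore m k z) len row n σ τ ∧ p 0 = 1 ∧
      cellSet (σ 0) 2 (Nf 0) = ∅ ∧ 
      (∀ t ≤ n, (∀ i, Nf t ≤ i → σ t 2 i = 0) ∧ 1 ≤ p t ∧ p t ≤ max 1 (2 * D)) ∧
      ∀ t < n, cellSet (σ t) 2 (Nf t) ⊆ S₁ t ∧ S₁ t ⊆ Finset.range (Nf (t + 1)) ∧
        (S₁ t).card = min k (Nf (t + 1)) ∧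
        Path c w (t + 1) (Nf (t + 1)) k z (R t) (q t) (p t) (S₁ t) (p (t + 1))
          (cellSet (σ (t + 1)) 2 (Nf (t + 1))) ∧
        τ t ≤ timeBound c (arriveProg c locs store).weight n M k b := by
  set P := arriveProg c locs store with hP
  set A := arriveSteps c n M k (roundBound c n k (b + 2)) with hA
  set C := P.weight with hC
  have hsize : (max 1 (2 * D)).size ≤ b + 2 := by
    rw [Nat.size_le] at hDb ⊢
    have : 1 ≤ 2 ^ b := Nat.one_le_two_pow
    rw [pow_add]
    omega
  -- Memory persists, so numbers may grow from arrival to arrival: by at most `A * C` bits each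
  -- time, which is why the bit bound depends on `t`.
  obtain ⟨f, hf0, hf, hf'⟩ := exists_seq (α := Store × ℕ) (n := n)
    (fun t a => (∃ S, Rest w m k z t (Nf t) a.2 S a.1) ∧ a.2 ≤ max 1 (2 * D) ∧
      BitBound a.1 (b + t * (A * C)))
    (fun t a a' => ∃ R q S₁ T, cellSet a.1 2 (Nf t) ⊆ S₁ ∧ S₁ ⊆ Finset.range (Nf (t + 1)) ∧
        S₁.card = min k (Nf (t + 1)) ∧
        Path c w (t + 1) (Nf (t + 1)) k z R q a.2 S₁ a'.2 (cellSet a'.1 2 (Nf (t + 1))) ∧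
        Exec P (feed a.1 (len t) (row t)) a'.1 T ∧ T ≤ timeBound c C n M k b)
    (initStore m k z, 1)
    ⟨⟨∅, by rw [hN0]; exact rest_initStore w m k z⟩, le_max_left _ _, by
      simpa using bitBound_initStore hmb hkb hzb⟩ (by
    rintro t ht ⟨s, p⟩ ⟨⟨S, hrest⟩, hp, hbit⟩
    simp only at hrest hp hbit
    have hrest' := hrest.feed (len t) (row t)
    obtain ⟨R, q, p', S₁, S', hS, hS₁, hc, hpath, s', N₀, hsteps, hN₀, hrest''⟩ :=
      runs_arriveProg (c := c) (D := D) (locs := locs) (store := store) (N' := Nf (t + 1))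
      (fun j hj i hi => hD j (by omega) i (hi.trans_le (hM (t + 1) ht))) hk (hmono t ht)
      (hpos t ht) hwr hrest' (hlocs t ht _ hrest'.param_m hrest'.points) (by
        intro s' hs' h7 h8 h4
        refine hstore t ht s' h7 h8 h4 ?_ ?_
        · rw [hs' 3 (by simp)]; exact hrest'.dist
        · rw [hs' 0 (by simp)]; intro i; simp [feed])
    have hp1 : 1 ≤ p := by rw [← hrest.penalty]; exact le_max_right _ _
    have hp' : p' ≤ max 1 (2 * D) := by
      have h1 := hpath.penalty_le hS₁ (by
        rw [← Finset.card_pos, hc]; have := hpos t ht; omega)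
        (fun j hj i hi => hD j (by omega) i (hi.trans_le (hM (t + 1) ht)))
      refine h1.trans (max_le hp (le_max_right _ _))
    have hlen := path_length_le (n := n) hpath hp1 hp' (by omega)
    have hlen' : R + q ≤ roundBound c n k (b + 2) := hlen.trans (by
      simp only [roundBound]; gcongr)
    have hN₀' : N₀ ≤ A := hN₀.trans (arriveSteps_mono c ht.le (hM (t + 1) ht) le_rfl hlen')
    obtain ⟨T, hexec, hT, hbit'⟩ := hsteps.exec (C := C) le_rfl
      (hbit.feed (len := len t) (row := row t) fun i hi => (hrow t ht i hi).trans (by omega))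
    refine ⟨(s', p'), ⟨⟨S', hrest''⟩, hp', hbit'.mono ?_⟩, R, q, S₁, T, ?_, hS₁, hc, ?_, hexec, ?_⟩
    · have : N₀ * C ≤ A * C := Nat.mul_le_mul_right _ hN₀'
      rw [add_mul]
      omega
    · simp only
      rw [hrest.medians]; exact hS
    · simp only
      rw [hrest''.medians]; exact hpath
    · refine hT.trans ?_
      rw [timeBound, ← hA]
      refine Nat.mul_le_mul hN₀' (Nat.mul_le_mul_left _ ?_)
      have h1 : N₀ * C ≤ A * C := Nat.mul_le_mul_right _ hN₀'
      have h2 : t * (A * C) ≤ n * (A * C) := Nat.mul_le_mul_right _ ht.le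
      rw [add_mul]
      omega)
  choose R q S₁ T h using hf'
  refine ⟨fun t => (f t).1, fun t => if ht : t < n then T t ht else 0, fun t => (f t).2,
    fun t => if ht : t < n then R t ht else 0, fun t => if ht : t < n then q t ht else 0,
    fun t => if ht : t < n then S₁ t ht else ∅, ⟨congrArg Prod.fst hf0, fun t ht => ?_⟩, congrArg Prod.snd hf0, ?_,
    fun t ht => ?_, fun t ht => ?_⟩
  · simp only [dif_pos ht]
    exact (h t ht).2.2.2.2.1
  · rw [hN0]; simp [cellSet]
  · obtain ⟨⟨S, hr⟩, h2, -⟩ := hf t ht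
    exact ⟨hr.above, (le_max_right _ _).trans hr.penalty.le, h2⟩
  · simp only [dif_pos ht]
    obtain ⟨h1, h2, h3, h4, -, h6⟩ := h t ht
    exact ⟨h1, h2, h3, h4, h6⟩

end KMedianRAM

namespace KMedianOutliers

/-! ### Optimum and approximation -/

variable {X : Type} [MetricSpace X] {f x : ℕ → X} {F C : Finset ℕ} {k z : ℕ}

theorem infDist_image_le {S : Finset ℕ} {i : ℕ} (hi : i ∈ S) (y : X) :
    Metric.infDist y (f '' (S : Set ℕ)) ≤ dist y (f i) :=
  Metric.infDist_le_dist_of_mem (Set.mem_image_of_mem f hi)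

theorem exists_infDist_image_eq {S : Finset ℕ} (hS : S.Nonempty) (y : X) :
    ∃ i ∈ S, Metric.infDist y (f '' (S : Set ℕ)) = dist y (f i) := by
  have hne : (f '' (S : Set ℕ)).Nonempty := Set.Nonempty.image f (by exact_mod_cast hS)
  obtain ⟨_, ⟨i, hi, rfl⟩, h⟩ :=
    (S.finite_toSet.image f).isCompact.exists_infDist_eq_dist hne y
  exact ⟨i, by exact_mod_cast hi, h⟩

theorem cost_nonneg (S : Finset ℕ) : 0 ≤ cost f x C S :=
  Finset.sum_nonneg fun _ _ => Metric.infDist_nonneg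

theorem opt_le {S O : Finset ℕ} (hS : IsSolution F k S) (hO : O ⊆ C)
    (hcard : O.card = min z C.card) : opt f x F C k z ≤ cost f x (C \ O) S :=
  csInf_le ⟨0, by rintro _ ⟨S, O, -, -, -, rfl⟩; exact cost_nonneg _⟩ ⟨S, O, hS, hO, hcard, rfl⟩

theorem le_opt {B : ℝ} (h : ∀ S O : Finset ℕ, IsSolution F k S → O ⊆ C →
    O.card = min z C.card → B ≤ cost f x (C \ O) S) : B ≤ opt f x F C k z := by
  obtain ⟨S, hS, hSc⟩ := Finset.exists_subset_card_eq (min_le_right k F.card)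
  obtain ⟨O, hO, hOc⟩ := Finset.exists_subset_card_eq (min_le_right z C.card)
  refine le_csInf ⟨_, S, O, ⟨hS, hSc⟩, hO, hOc, rfl⟩ ?_
  rintro _ ⟨S, O, hS, hO, hOc, rfl⟩
  exact h S O hS hO hOc

theorem opt_nonneg : 0 ≤ opt f x F C k z := le_opt fun _ _ _ _ _ => cost_nonneg _

/-- The outliers among the remaining points are kept and padded to the prescribed number; extra
outliers only lower the cost. -/
theorem opt_le_mul_cost {F' C' : Finset ℕ} {S S' O : Finset ℕ} {κ : ℝ} (hC : C' ⊆ C)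
    (hS' : IsSolution F' k S') (hOc : O.card = min z C.card)
    (hκ : ∀ j ∈ C', Metric.infDist (x j) (f '' (S' : Set ℕ)) ≤
      κ * Metric.infDist (x j) (f '' (S : Set ℕ))) (hκ0 : 0 ≤ κ) :
    opt f x F' C' k z ≤ κ * cost f x (C \ O) S := by
  classical
  obtain ⟨O', h1, h2, h3⟩ := Finset.exists_subsuperset_card_eq (s := O ∩ C') (t := C')
    (n := min z C'.card) Finset.inter_subset_right (by
      refine le_min ?_ (Finset.card_le_card Finset.inter_subset_right)
      have := Finset.card_le_card (Finset.inter_subset_left (s₁ := O) (s₂ := C'))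
      have := min_le_left z C.card
      omega) (min_le_right _ _)
  refine (opt_le hS' h2 h3).trans ?_
  rw [cost, cost, Finset.mul_sum]
  refine (Finset.sum_le_sum fun j hj => hκ j (Finset.mem_sdiff.1 hj).1).trans ?_
  refine Finset.sum_le_sum_of_subset_of_nonneg (fun j hj => ?_) fun j _ _ =>
    mul_nonneg hκ0 Metric.infDist_nonneg
  rw [Finset.mem_sdiff] at hj ⊢
  exact ⟨hC hj.1, fun hjO => hj.2 (h1 (Finset.mem_inter.2 ⟨hjO, hj.1⟩))⟩

theorem opt_mono {C' : Finset ℕ} (hC : C' ⊆ C) : opt f x F C' k z ≤ opt f x F C k z :=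
  le_opt fun S O hS _ hOc => by
    simpa using opt_le_mul_cost (κ := 1) (S := S) hC hS hOc (fun _ _ => by simp) zero_le_one

/-- If the points are the locations, removing points at most doubles the optimum. -/
theorem opt_self_le_two_mul {C' : Finset ℕ} (hC : C' ⊆ C) (hC' : C'.Nonempty) (hk : 1 ≤ k) :
    opt x x C' C' k z ≤ 2 * opt x x C C k z := by
  classical
  have : 2⁻¹ * opt x x C' C' k z ≤ opt x x C C k z := by
    refine le_opt fun S O hS hO hOc => ?_
    have hS0 : S.Nonempty := by
      rw [← Finset.card_pos, hS.2]
      have := (hC'.mono hC).card_pos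
      omega
    -- Each median is replaced by the remaining point nearest to it. For a remaining point `j` this
    -- at most doubles the distance, since `j` itself was a candidate for the replacement.
    choose g hgC hg using fun i => Finset.exists_min_image C' (fun j => dist (x i) (x j)) hC'
    obtain ⟨S', h1, h2, h3⟩ := Finset.exists_subsuperset_card_eq (s := S.image g) (t := C')
      (n := min k C'.card) (Finset.image_subset_iff.2 fun i _ => hgC i) (by
        refine le_min ?_ (Finset.card_le_card (Finset.image_subset_iff.2 fun i _ => hgC i))
        have := Finset.card_image_le (s := S) (f := g)
        have := hS.2
        omega) (min_le_right _ _)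
    have := opt_le_mul_cost (f := x) (x := x) (κ := 2) (S := S) (z := z) (O := O) hC
      (⟨h2, h3⟩ : IsSolution C' k S') hOc (by
        intro j hj
        obtain ⟨i, hi, hid⟩ := exists_infDist_image_eq (f := x) hS0 (x j)
        rw [hid]
        refine (infDist_image_le (h1 (Finset.mem_image_of_mem g hi)) (x j)).trans ?_
        have h4 := dist_triangle (x j) (x i) (x (g i))
        have h5 := hg i j hj
        rw [dist_comm (x i) (x j)] at h5
        linarith) zero_le_two
    linarith
  linarith

/-- Distances, rounded down; they are integers anyway. -/
noncomputable def ndist (f x : ℕ → X) (j i : ℕ) : ℕ := ⌊dist (x j) (f i)⌋₊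

/-- The truncated cost pays `p` for each far point and the actual distance for the others. The first
part yields `Violated.le_opt`, the second bounds the cost without outliers. -/
theorem mul_card_farPoints_add_le {w : ℕ → ℕ → ℕ} {t p : ℕ} {S : Finset ℕ} :
    p * (farPoints w t p S).card +
      ∑ j ∈ Finset.range t \ farPoints w t p S, tdist w p S j ≤ pcost w t p S := by
  have hsub : farPoints w t p S ⊆ Finset.range t := Finset.filter_subset _ _
  rw [pcost, ← Finset.sum_sdiff hsub, add_comm,
    mul_comm, ← smul_eq_mul]
  gcongr
  exact Finset.card_nsmul_le_sum _ _ _ fun j hj => (Finset.mem_filter.1 hj).2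

variable {t N p : ℕ} {c : Params} {S : Finset ℕ}

theorem LocalOpt.pcost_le (hw : ∀ j < t, ∀ i < N, (ndist f x j i : ℝ) = dist (x j) (f i))
    (h : LocalOpt (ndist f x) t N k c.E c.ℓ p S)
    (hS : IsSolution (Finset.range N) k S) (hS0 : S.Nonempty) (hE : 1 ≤ c.E) (hℓ : 1 ≤ c.ℓ) :
    (1 - 1 / (c.E : ℝ)) * pcost (ndist f x) t p S ≤
      (3 + 2 / (c.ℓ : ℝ)) * opt f x (Finset.range N) (Finset.range t) k z +
        (1 + 1 / (c.ℓ : ℝ)) * (p * z) := by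
  have hℓ0 : (0 : ℝ) < 3 + 2 / (c.ℓ : ℝ) := by positivity
  rw [← sub_le_iff_le_add, ← div_le_iff₀' hℓ0]
  refine le_opt fun S' O hS' hO hOc => ?_
  rw [div_le_iff₀' hℓ0, sub_le_iff_le_add]
  have hcard : S'.card = S.card := by rw [hS'.2, hS.2]
  have hS'0 : S'.Nonempty := by rw [← Finset.card_pos, hcard]; exact hS0.card_pos
  choose o hoS ho using fun j => exists_infDist_image_eq (f := f) hS'0 (x j)
  have h1 := h.cost_le hS.1 (by rw [hS.2]; exact min_le_left _ _) hS0 hE hℓ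
    (fun a b => dist (f a) (f b)) (by
      intro j hj a ha b hb
      rw [hw j hj a ha, hw j hj b hb]
      exact dist_triangle _ _ _) (by
      intro j hj a ha b hb
      rw [hw j hj a ha, hw j hj b hb]
      exact dist_triangle_left _ _ _) hS'.1 hcard hO o (fun j _ _ => hoS j)
  refine h1.trans ?_
  have h2 : ∑ j ∈ Finset.range t \ O, (ndist f x j (o j) : ℝ) =
      cost f x (Finset.range t \ O) S' := by
    refine Finset.sum_congr rfl fun j hj => ?_
    rw [hw j (Finset.mem_range.1 (Finset.mem_sdiff.1 hj).1) _
      (Finset.mem_range.1 (hS'.1 (hoS j))), ho]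
  rw [h2]
  have h3 : (O.card : ℝ) ≤ z := by
    rw [hOc]; exact_mod_cast min_le_left _ _
  gcongr

/-- If the algorithm increases the penalty `p`, then `p * z` is at most a multiple of the
optimum. -/
theorem Violated.le_opt {γ : ℝ} (hv : Violated c (ndist f x) t z p S)
    (hβ : (1 + 1 / (c.ℓ : ℝ)) * (1 + γ) ≤ (1 - 1 / (c.E : ℝ)) * (c.num / c.den : ℝ))
    (hden : 0 < c.den) (hE : 1 ≤ c.E) {opt₀ : ℝ}
    (h : (1 - 1 / (c.E : ℝ)) * pcost (ndist f x) t p S ≤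
      (3 + 2 / (c.ℓ : ℝ)) * opt₀ + (1 + 1 / (c.ℓ : ℝ)) * (p * z)) :
    γ * ((1 + 1 / (c.ℓ : ℝ)) * (p * z)) ≤ (3 + 2 / (c.ℓ : ℝ)) * opt₀ := by
  have h1 : p * (farPoints (ndist f x) t p S).card ≤ pcost (ndist f x) t p S :=
    (Nat.le_add_right _ _).trans mul_card_farPoints_add_le
  have h1' : (p * (farPoints (ndist f x) t p S).card : ℝ) ≤ pcost (ndist f x) t p S := by
    exact_mod_cast h1
  have h2 : (c.num * z : ℝ) ≤ c.den * (farPoints (ndist f x) t p S).card := by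
    exact_mod_cast hv.le
  have hden' : (0 : ℝ) < c.den := by exact_mod_cast hden
  have h3 : (c.num / c.den : ℝ) * z ≤ (farPoints (ndist f x) t p S).card := by
    rw [div_mul_eq_mul_div, div_le_iff₀ hden']
    linarith
  have hE0 : 0 ≤ 1 - 1 / (c.E : ℝ) := by
    have : (1 : ℝ) ≤ c.E := by exact_mod_cast hE
    rw [sub_nonneg, div_le_one (by linarith)]
    exact this
  have hpz : (0 : ℝ) ≤ p * z := by positivity
  have h4 : (1 - 1 / (c.E : ℝ)) * (c.num / c.den : ℝ) * (p * z) ≤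
      (1 - 1 / (c.E : ℝ)) * pcost (ndist f x) t p S := by
    calc (1 - 1 / (c.E : ℝ)) * (c.num / c.den : ℝ) * (p * z)
        = (1 - 1 / (c.E : ℝ)) * (p * ((c.num / c.den : ℝ) * z)) := by ring
      _ ≤ (1 - 1 / (c.E : ℝ)) * (p * (farPoints (ndist f x) t p S).card) := by gcongr
      _ ≤ _ := mul_le_mul_of_nonneg_left h1' hE0
  have h5 := mul_le_mul_of_nonneg_right hβ hpz
  nlinarith

/-- The outliers are the far points. `κ` bounds the penalty term relative to the optimum term, and
is instantiated with twice the ratio of optima because of the last doubling. -/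
theorem isBicriteria {γ κ β α : ℝ} (hw : ∀ j < t, ∀ i < N, (ndist f x j i : ℝ) = dist (x j) (f i))
    (h : LocalOpt (ndist f x) t N k c.E c.ℓ p S)
    (hv : ¬ Violated c (ndist f x) t z p S) (hS : IsSolution (Finset.range N) k S)
    (hS0 : S.Nonempty) (hE : 2 ≤ c.E) (hℓ : 1 ≤ c.ℓ) (hden : 0 < c.den) (hγ : 0 < γ)
    (hβ : (c.num / c.den : ℝ) ≤ β)
    (hκ : 0 ≤ κ) (hα : (3 + 2 / (c.ℓ : ℝ)) * (1 + κ / γ) ≤ (1 - 1 / (c.E : ℝ)) * α)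
    (hp : p = 1 ∨ γ * ((1 + 1 / (c.ℓ : ℝ)) * (p * z)) ≤
      κ * ((3 + 2 / (c.ℓ : ℝ)) * opt f x (Finset.range N) (Finset.range t) k z)) :
    IsBicriteria f x (Finset.range N) (Finset.range t) k z β α S := by
  refine ⟨hS, farPoints (ndist f x) t p S, Finset.filter_subset _ _, ?_, ?_⟩
  · rw [Violated, not_lt] at hv
    have hv' : (c.den * (farPoints (ndist f x) t p S).card : ℝ) ≤ c.num * z := by
      exact_mod_cast hv
    have hden' : (0 : ℝ) < c.den := by exact_mod_cast hden
    calc ((farPoints (ndist f x) t p S).card : ℝ) ≤ (c.num / c.den : ℝ) * z := by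
          rw [div_mul_eq_mul_div, le_div_iff₀ hden']; linarith
      _ ≤ β * z := by gcongr
  · have hO := opt_nonneg (f := f) (x := x) (F := Finset.range N) (C := Finset.range t) (k := k)
      (z := z)
    set opt₀ := opt f x (Finset.range N) (Finset.range t) k z
    have hE2 : (2 : ℝ) ≤ c.E := by exact_mod_cast hE
    have hE0 : 0 < 1 - 1 / (c.E : ℝ) := by
      rw [sub_pos, div_lt_one (by linarith)]
      linarith
    have hα0 : 0 ≤ α := by
      have : 0 ≤ (3 + 2 / (c.ℓ : ℝ)) * (1 + κ / γ) := by positivity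
      exact nonneg_of_mul_nonneg_right (this.trans hα) hE0
    have hcost : cost f x (Finset.range t \ farPoints (ndist f x) t p S) S ≤
        ∑ j ∈ Finset.range t \ farPoints (ndist f x) t p S, (tdist (ndist f x) p S j : ℝ) := by
      refine Finset.sum_le_sum fun j hj => ?_
      rw [Finset.mem_sdiff, Finset.mem_range] at hj
      rcases tdist_eq_or (w := ndist f x) (p := p) (S := S) (j := j) with h1 | ⟨i, hi, h1⟩
      · exact absurd (Finset.mem_filter.2 ⟨Finset.mem_range.2 hj.1, h1.ge⟩) hj.2
      · rw [h1, hw j hj.1 i (Finset.mem_range.1 (hS.1 hi))]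
        exact infDist_image_le hi _
    refine hcost.trans ?_
    rcases hp with rfl | hp
    -- For penalty 1, truncated distances of points that are not far are natural numbers below 1, so
    -- the cost is 0.
    · refine le_trans (le_of_eq ?_) (mul_nonneg hα0 hO)
      refine Finset.sum_eq_zero fun j hj => ?_
      rw [Finset.mem_sdiff] at hj
      have : ¬ 1 ≤ tdist (ndist f x) 1 S j := fun h => hj.2 (Finset.mem_filter.2 ⟨hj.1, h⟩)
      exact_mod_cast (by omega : tdist (ndist f x) 1 S j = 0)
    · have h1 := LocalOpt.pcost_le (z := z) hw h hS hS0 (by omega) hℓ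
      have h2 : (∑ j ∈ Finset.range t \ farPoints (ndist f x) t p S,
          (tdist (ndist f x) p S j : ℝ)) ≤ pcost (ndist f x) t p S := by
        exact_mod_cast (Nat.le_add_left _ _).trans mul_card_farPoints_add_le
      refine h2.trans ?_
      have h3 : (1 + 1 / (c.ℓ : ℝ)) * (p * z) ≤
          (κ / γ) * ((3 + 2 / (c.ℓ : ℝ)) * opt₀) := by
        rw [div_mul_eq_mul_div, le_div_iff₀ hγ]
        linarith
      have h4 := mul_le_mul_of_nonneg_right hα hO
      have h5 : (1 - 1 / (c.E : ℝ)) * pcost (ndist f x) t p S ≤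
          (1 - 1 / (c.E : ℝ)) * (α * opt₀) := by
        nlinarith
      exact le_of_mul_le_mul_left h5 hE0

end KMedianOutliers

namespace KMedianOutliers

/-! ### Total recourse -/

/-- The course of the algorithm: the solution `S t` after `t` arrivals is extended to `S₁ t` at
the next arrival, and local search leads from there to `S (t + 1)`. -/
structure Trace (c : Params) (w : ℕ → ℕ → ℕ) (n k z D : ℕ) (Nf p R q : ℕ → ℕ)
    (S S₁ : ℕ → Finset ℕ) : Prop where
  penalty_zero : p 0 = 1
  zero : S 0 = ∅
  penalty : ∀ t ≤ n, 1 ≤ p t ∧ p t ≤ max 1 (2 * D)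
  subset : ∀ t < n, S t ⊆ S₁ t
  subset_range : ∀ t < n, S₁ t ⊆ Finset.range (Nf (t + 1))
  card : ∀ t < n, (S₁ t).card = min k (Nf (t + 1))
  path : ∀ t < n, Path c w (t + 1) (Nf (t + 1)) k z (R t) (q t) (p t) (S₁ t) (p (t + 1))
    (S (t + 1))

namespace Trace

variable {c : Params} {w : ℕ → ℕ → ℕ} {n k z D M : ℕ} {Nf p R q : ℕ → ℕ} {S S₁ : ℕ → Finset ℕ}

theorem isSolution (h : Trace c w n k z D Nf p R q S S₁) {t : ℕ} (ht : t < n) :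
    IsSolution (Finset.range (Nf (t + 1))) k (S (t + 1)) :=
  ⟨(h.path t ht).subset (h.subset_range t ht), by
    rw [(h.path t ht).card_eq, h.card t ht, Finset.card_range]⟩

theorem card_le (h : Trace c w n k z D Nf p R q S S₁) {t : ℕ} (ht : t ≤ n) :
    (S t).card ≤ k := by
  rcases t with _ | t
  · simp [h.zero]
  · rw [(h.isSolution ht).2]; exact min_le_left _ _

/-- Filling up contributes at most `k` in total, since the number of medians never decreases; it
serves as the potential in the induction. -/
theorem recourse_le (h : Trace c w n k z D Nf p R q S S₁) :
    recourse S n ≤ ∑ t ∈ Finset.range n, R t + k := by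
  have key : ∀ t ≤ n, recourse S t ≤ ∑ t ∈ Finset.range t, R t + (S t).card := by
    intro t
    induction t with
    | zero => simp [recourse]
    | succ t ih =>
      intro ht
      have h1 := ih (by omega)
      rw [recourse] at h1 ⊢
      rw [Finset.sum_range_succ, Finset.sum_range_succ]
      have h2 := (h.path t ht).card_sdiff_le
      have h3 := (h.path t ht).card_eq
      have h4 := Finset.card_sdiff_add_card_eq_card (h.subset t ht)
      have h5 : S (t + 1) \ S t ⊆ (S (t + 1) \ S₁ t) ∪ (S₁ t \ S t) := by
        intro x
        simp only [Finset.mem_sdiff, Finset.mem_union]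
        tauto
      have h6 := (Finset.card_le_card h5).trans (Finset.card_union_le _ _)
      omega
  have := key n le_rfl
  have := h.card_le le_rfl
  omega

theorem penaltySeq (h : Trace c w n k z D Nf p R q S S₁) (hM : ∀ t ≤ n, Nf t ≤ M)
    (h4 : ∀ j < n, ∀ j' < n, ∀ c < M, ∀ s < M, w j s ≤ w j c + w j' c + w j' s) :
    PenaltySeq w n M k p S where
  four_point := h4
  subset t ht := by
    rcases t with _ | t
    · simp [h.zero]
    · exact (h.isSolution (by omega)).1.trans (Finset.range_subset_range.2 (hM _ ht.le))
  card_le t ht := h.card_le ht.le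
  mono s t hst := by
    induction t, hst using Nat.le_induction with
    | base => exact fun _ => le_rfl
    | succ t _ ih =>
      intro ht
      refine (ih (by omega)).trans ?_
      rw [(h.path t (by omega)).penalty_eq]
      exact Nat.le_mul_of_pos_left _ (by positivity)

theorem log_penalty (h : Trace c w n k z D Nf p R q S S₁) :
    ((∑ t ∈ Finset.range n, q t : ℕ) : ℝ) * Real.log 2 ≤ Real.log (max 1 (2 * D) : ℕ) := by
  have key : ∀ t ≤ n, p t = 2 ^ ∑ t ∈ Finset.range t, q t := by
    intro t
    induction t with
    | zero => simp [h.penalty_zero]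
    | succ t ih =>
      intro ht
      rw [(h.path t ht).penalty_eq, ih (by omega), Finset.sum_range_succ, pow_add, mul_comm]
  have h1 : (2 : ℝ) ^ ∑ t ∈ Finset.range n, q t ≤ (max 1 (2 * D) : ℕ) := by
    have := (h.penalty n le_rfl).2
    rw [key n le_rfl] at this
    exact_mod_cast this
  have h2 := Real.log_le_log (by positivity) h1
  rwa [Real.log_pow] at h2

theorem pcost_le (h : Trace c w n k z D Nf p R q S S₁) {t : ℕ} (ht : t ≤ n) :
    pcost w t (p t) (S t) ≤ n * max 1 (2 * D) := by
  refine (Finset.sum_le_card_nsmul _ _ (max 1 (2 * D)) fun j _ =>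
    tdist_le.trans (h.penalty t ht).2).trans ?_
  rw [Finset.card_range, smul_eq_mul]
  gcongr

/-- Telescoping log(1 + cost) over all arrivals leaves the insertion terms and the doublings. The
fill-up before the local search only lowers the cost. -/
theorem sum_le (h : Trace c w n k z D Nf p R q S S₁) (hM : ∀ t ≤ n, Nf t ≤ M)
    (h4 : ∀ j < n, ∀ j' < n, ∀ c < M, ∀ s < M, w j s ≤ w j c + w j' c + w j' s)
    {J : ℕ} (hJ : 1 + n * max 1 (2 * D) ≤ 2 ^ J) :
    ((∑ t ∈ Finset.range n, R t : ℕ) : ℝ) ≤ 2 * (k * c.E) *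
      (2 * ((J + 1) * (2 + k * (1 + 2 * (harmonic n : ℝ)))) + Real.log (max 1 (2 * D) : ℕ)) := by
  have hlog := (h.penaltySeq hM h4).sum_log_le J (by
    intro t ht
    have h1 := (tdist_le (w := w) (S := S t) (j := t)).trans (h.penalty t ht.le).2
    have h2 : 1 * max 1 (2 * D) ≤ n * max 1 (2 * D) := by
      gcongr; omega
    omega) (by
    intro t ht
    have := h.pcost_le ht.le
    omega)
  let W : ℕ → ℝ := fun t => Real.log (1 + pcost w t (p t) (S t))
  have hstep : ∀ t ∈ Finset.range n, (R t : ℝ) ≤ 2 * (k * c.E) * ((W t - W (t + 1)) +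
      Real.log (1 + (tdist w (p t) (S t) t : ℝ) / (1 + pcost w t (p t) (S t) : ℕ)) +
      q t * Real.log 2) := by
    intro t ht
    have ht := Finset.mem_range.1 ht
    refine (h.path t ht).le_log.trans (mul_le_mul_of_nonneg_left ?_ (by positivity))
    have h1 : pcost w (t + 1) (p t) (S₁ t) ≤ pcost w t (p t) (S t) + tdist w (p t) (S t) t := by
      rw [← pcost_succ]
      exact pcost_anti (h.subset t ht)
    have h1' : (pcost w (t + 1) (p t) (S₁ t) : ℝ) ≤
        pcost w t (p t) (S t) + tdist w (p t) (S t) t := by exact_mod_cast h1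
    have hW : (0 : ℝ) < 1 + pcost w t (p t) (S t) := by positivity
    have h2 : Real.log (1 + pcost w (t + 1) (p t) (S₁ t)) ≤ Real.log
        ((1 + pcost w t (p t) (S t)) *
          (1 + (tdist w (p t) (S t) t : ℝ) / (1 + pcost w t (p t) (S t)))) := by
      refine Real.log_le_log (by positivity) ?_
      rw [mul_add, mul_div_cancel₀ _ hW.ne']
      linarith
    rw [Real.log_mul hW.ne' (by positivity)] at h2
    simp only [W]
    push_cast
    linarith
  have h1 := Finset.sum_le_sum hstep
  rw [← Finset.mul_sum, Finset.sum_add_distrib, Finset.sum_add_distrib, Finset.sum_range_sub',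
    ← Finset.sum_mul] at h1
  have hW0 : W 0 = 0 := by simp [W, pcost]
  have hWn : 0 ≤ W n := Real.log_nonneg (by
    have : (0 : ℝ) ≤ pcost w n (p n) (S n) := by positivity
    linarith)
  have hq := h.log_penalty
  push_cast at h1 hq ⊢
  refine h1.trans (mul_le_mul_of_nonneg_left ?_ (by positivity))
  push_cast at hlog
  linarith

theorem recourse_le_log (h : Trace c w n k z D Nf p R q S S₁) (hM : ∀ t ≤ n, Nf t ≤ M)
    (h4 : ∀ j < n, ∀ j' < n, ∀ c < M, ∀ s < M, w j s ≤ w j c + w j' c + w j' s)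
    (hn : 2 ≤ n) (hD : 1 ≤ D) (hk : 1 ≤ k) (hE : 1 ≤ c.E) :
    (recourse S n : ℝ) ≤ 400 * ((k : ℝ) ^ 2 * c.E * (Real.log n * Real.log (n * D))) := by
  have hl2 : 0.69 ≤ Real.log 2 := by have := Real.log_two_gt_d9; linarith
  have hl2' : Real.log 2 ≤ 0.7 := by have := Real.log_two_lt_d9; linarith
  have hn' : (2 : ℝ) ≤ n := by exact_mod_cast hn
  have hD' : (1 : ℝ) ≤ D := by exact_mod_cast hD
  have hk' : (1 : ℝ) ≤ k := by exact_mod_cast hk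
  have hE' : (1 : ℝ) ≤ c.E := by exact_mod_cast hE
  have hnD : (n : ℝ) ≤ n * D := by nlinarith
  have hL1 : Real.log 2 ≤ Real.log n := Real.log_le_log (by norm_num) hn'
  have hL12 : Real.log n ≤ Real.log (n * D) := Real.log_le_log (by linarith) hnD
  have hlogD : Real.log D ≤ Real.log (n * D) := Real.log_le_log (by linarith) (by nlinarith)
  set L₁ := Real.log n
  set L₂ := Real.log (n * D)
  -- the scale
  have hJ1 : 4 * (n * D) ≤ 2 ^ Nat.clog 2 (4 * (n * D)) := Nat.le_pow_clog one_lt_two _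
  have hnD1 : 1 ≤ n * D := Nat.mul_pos (by omega) hD
  have hJ2 : 2 ^ (Nat.clog 2 (4 * (n * D)) - 1) < 4 * (n * D) := by
    have := Nat.pow_pred_clog_lt_self one_lt_two (x := 4 * (n * D)) (by omega)
    simpa using this
  have hmax : max 1 (2 * D) = 2 * D := max_eq_right (by omega)
  set J := Nat.clog 2 (4 * (n * D))
  have hJ : 1 + n * max 1 (2 * D) ≤ 2 ^ J := by
    rw [hmax]
    nlinarith
  have hsum := h.sum_le hM h4 hJ
  have hrec : (recourse S n : ℝ) ≤ (∑ t ∈ Finset.range n, R t : ℕ) + k := by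
    exact_mod_cast h.recourse_le
  rw [hmax] at hsum
  -- `J` is about log₂(4nD); its additive constants are absorbed using `L₂ ≥ log 2`.
  have hJL : (J : ℝ) + 1 ≤ 8 * L₂ := by
    have h1 : (2 : ℝ) ^ (J - 1) ≤ 4 * (n * D) := by exact_mod_cast hJ2.le
    have h2 := Real.log_le_log (by positivity) h1
    rw [Real.log_pow, Real.log_mul (by norm_num) (by positivity),
      show (4 : ℝ) = 2 ^ 2 by norm_num, Real.log_pow] at h2
    have h3 : (J : ℝ) - 1 ≤ (J - 1 : ℕ) := by
      rw [sub_le_iff_le_add]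
      exact_mod_cast (by omega : J ≤ J - 1 + 1)
    push_cast at h2
    have h4 : ((J : ℝ) - 1) * Real.log 2 ≤ 2 * Real.log 2 + L₂ :=
      (mul_le_mul_of_nonneg_right h3 (by linarith)).trans h2
    nlinarith
  have hH : (harmonic n : ℝ) ≤ 1 + L₁ := harmonic_le_one_add_log n
  have hH0 : 2 + k * (1 + 2 * (harmonic n : ℝ)) ≤ 10 * (k * L₁) := by nlinarith
  have hlog2D : Real.log (2 * D : ℕ) ≤ 3 * (k * L₁ * L₂) := by
    push_cast
    rw [Real.log_mul (by norm_num) (by positivity)]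
    have h1 : 0.69 * L₂ ≤ L₁ * L₂ := by nlinarith
    have h2 : L₁ * L₂ ≤ k * (L₁ * L₂) := by nlinarith
    nlinarith
  have hprod : ((J : ℝ) + 1) * (2 + k * (1 + 2 * (harmonic n : ℝ))) ≤
      (8 * L₂) * (10 * (k * L₁)) :=
    mul_le_mul hJL hH0 (by
      have : (0 : ℝ) ≤ harmonic n := by rw [harmonic]; push_cast; positivity
      positivity) (by linarith)
  have hX : (0 : ℝ) ≤ k * L₁ * L₂ := by
    have : 0 ≤ L₁ := by linarith
    have : 0 ≤ L₂ := by linarith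
    positivity
  -- 163 = 2·8·10 + 3, from `hprod` and `hlog2D`.
  have h1 : ((∑ t ∈ Finset.range n, R t : ℕ) : ℝ) ≤ 2 * (k * c.E) * (163 * (k * L₁ * L₂)) := by
    refine hsum.trans (mul_le_mul_of_nonneg_left ?_ (by positivity))
    linarith
  have h2 : (k : ℝ) ≤ 3 * ((k : ℝ) ^ 2 * c.E * (L₁ * L₂)) := by
    have h3 : 1 ≤ 3 * (L₁ * L₂) := by nlinarith
    have h4 : (k : ℝ) ≤ k ^ 2 * c.E := by
      have : (k : ℝ) * 1 ≤ k * (k * c.E) := by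
        refine mul_le_mul_of_nonneg_left ?_ (by linarith)
        nlinarith
      linarith
    nlinarith
  nlinarith

end Trace

end KMedianOutliers

namespace KMedianRAM

open KMedianOutliers

/-! ### Polynomial running time -/

theorem exists_searchSteps_le (r : ℕ) :
    ∃ K, ∀ Q B, 1 ≤ Q → 1 ≤ B → searchSteps Q B r ≤ K * (B * Q ^ (2 * r)) := by
  induction r with
  | zero => exact ⟨1, fun Q B _ _ => by simp [searchSteps]⟩
  | succ r ih =>
    obtain ⟨K, hK⟩ := ih
    refine ⟨K + 15, fun Q B hQ hB => ?_⟩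
    have h1 := hK Q B hQ hB
    rw [searchSteps, show 2 * (r + 1) = 2 * r + 2 by ring, pow_add]
    have hZ : 1 ≤ Q ^ (2 * r) := Nat.one_le_pow _ _ hQ
    set Z := Q ^ (2 * r)
    have h2 : Q ^ 2 * searchSteps Q B r ≤ K * (B * (Z * Q ^ 2)) := by
      calc Q ^ 2 * searchSteps Q B r ≤ Q ^ 2 * (K * (B * Z)) := Nat.mul_le_mul_left _ h1
        _ = _ := by ring
    have hQ2 : Q ≤ Q ^ 2 := by nlinarith
    have h3 : Q ^ 2 ≤ B * (Z * Q ^ 2) := by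
      calc Q ^ 2 = 1 * (1 * Q ^ 2) := by ring
        _ ≤ B * (Z * Q ^ 2) := by gcongr
    have h4 : B ≤ B * (Z * Q ^ 2) := Nat.le_mul_of_pos_right _ (by positivity)
    nlinarith

theorem exists_iterSteps_le (c : Params) :
    ∃ K, ∀ Q, 1 ≤ Q → iterSteps c (Q + 1) Q Q ≤ K * Q ^ (2 * c.ℓ + 2) := by
  obtain ⟨K, hK⟩ := exists_searchSteps_le c.ℓ
  refine ⟨75 + 45 * K, fun Q hQ => ?_⟩
  rw [iterSteps, pow_add]
  have h1 := hK Q (13 + (Q + 1) * (5 * Q + 8) + 3 * Q + 3 * Q) hQ (by omega)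
  have hZ : 1 ≤ Q ^ (2 * c.ℓ) := Nat.one_le_pow _ _ hQ
  set Z := Q ^ (2 * c.ℓ)
  have hQ2 : Q ≤ Q ^ 2 := by nlinarith
  have h2 : 13 + (Q + 1) * (5 * Q + 8) + 3 * Q + 3 * Q ≤ 45 * Q ^ 2 := by nlinarith
  have h3 : K * ((13 + (Q + 1) * (5 * Q + 8) + 3 * Q + 3 * Q) * Z) ≤ K * (45 * Q ^ 2 * Z) := by
    gcongr
  have h4 : Q ^ 2 ≤ Z * Q ^ 2 := Nat.le_mul_of_pos_left _ hZ
  nlinarith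

/-- There are O(Q²s) rounds per arrival, each of O(Q^(2ℓ+2)) steps. -/
theorem exists_arriveSteps_le (c : Params) :
    ∃ K, ∀ Q s b, 1 ≤ Q → 1 ≤ s → b ≤ Q * s →
      arriveSteps c Q Q Q (roundBound c Q Q (b + 2)) ≤ K * (Q ^ (2 * c.ℓ + 4) * s) := by
  obtain ⟨K, hK⟩ := exists_iterSteps_le c
  refine ⟨36 + (14 * c.E + 4) * (K + 1), fun Q s b hQ hs hb => ?_⟩
  have h1 := hK Q hQ
  have hZ : 1 ≤ Q ^ (2 * c.ℓ + 2) := Nat.one_le_pow _ _ hQ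
  rw [arriveSteps, show 2 * c.ℓ + 4 = 2 * c.ℓ + 2 + 2 by ring, pow_add Q (2 * c.ℓ + 2) 2]
  set Z := Q ^ (2 * c.ℓ + 2)
  have hQs : 1 ≤ Q * s := Nat.mul_pos hQ hs
  have hQ2s : Q * s ≤ Q ^ 2 * s := by nlinarith
  have hQQs : Q ≤ Q * s := Nat.le_mul_of_pos_right _ hs
  have h2 : roundBound c Q Q (b + 2) + 1 ≤ (14 * c.E + 4) * (Q ^ 2 * s) := by
    rw [roundBound]
    have h3 : Q + 2 * (b + 2) ≤ 7 * (Q * s) := by omega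
    have h4 : 2 * (Q * c.E) * (Q + 2 * (b + 2)) ≤ 2 * (Q * c.E) * (7 * (Q * s)) := by gcongr
    have h5 : 2 * (Q * c.E) * (7 * (Q * s)) = 14 * c.E * (Q ^ 2 * s) := by ring
    have h6 : b + 2 + 1 ≤ 4 * (Q ^ 2 * s) := by omega
    rw [add_mul]
    omega
  have h3 : 1 + iterSteps c (Q + 1) Q Q ≤ (K + 1) * Z := by
    rw [add_mul]
    omega
  have h4 := Nat.mul_le_mul h2 h3
  have h5 : (14 * c.E + 4) * (Q ^ 2 * s) * ((K + 1) * Z) =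
      (14 * c.E + 4) * (K + 1) * (Z * Q ^ 2 * s) := by ring
  have h6 : Q ^ 2 * s ≤ Z * Q ^ 2 * s := by
    rw [mul_assoc]
    exact Nat.le_mul_of_pos_left _ hZ
  rw [add_mul 36]
  omega

/-- The number of steps enters twice, once as a count and once through the bit length it can create:
n·A·(nA) with A of order Q^(2ℓ+4)·s. -/
theorem exists_timeBound_le (c : Params) (C : ℕ) :
    ∃ K, ∀ n M k Q s b, 1 ≤ Q → 1 ≤ s → n ≤ Q → M ≤ Q → k ≤ Q → b ≤ Q * s →
      n * timeBound c C n M k b ≤ K * (Q ^ (4 * c.ℓ + 10) * s ^ 3) := by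
  obtain ⟨K, hK⟩ := exists_arriveSteps_le c
  refine ⟨(K + 1) ^ 2 * (C * (2 + 2 * C)), fun n M k Q s b hQ hs hn hM hk hb => ?_⟩
  have hA : arriveSteps c n M k (roundBound c n k (b + 2)) ≤
      (K + 1) * (Q ^ (2 * c.ℓ + 4) * s) := by
    have h1 : arriveSteps c n M k (roundBound c n k (b + 2)) ≤
        arriveSteps c Q Q Q (roundBound c Q Q (b + 2)) := by
      have h2 : roundBound c n k (b + 2) ≤ roundBound c Q Q (b + 2) := by
        simp only [roundBound]; gcongr
      exact arriveSteps_mono c hn hM hk h2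
    refine (h1.trans (hK Q s b hQ hs hb)).trans ?_
    gcongr
    omega
  rw [timeBound]
  set A := arriveSteps c n M k (roundBound c n k (b + 2))
  set A' := (K + 1) * (Q ^ (2 * c.ℓ + 4) * s) with hA'
  have hQs : 1 ≤ Q * s := Nat.mul_pos hQ hs
  have hA'1 : 1 ≤ A' := Nat.mul_pos (by omega) (Nat.mul_pos (Nat.one_le_pow _ _ hQ) hs)
  have h1 : 1 + b + (n + 1) * (A * C) ≤ (2 + 2 * C) * (Q * s * A') := by
    have h2 : n + 1 ≤ 2 * (Q * s) := by nlinarith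
    have h3 : (n + 1) * (A * C) ≤ 2 * (Q * s) * (A' * C) := by gcongr
    have h4 : 2 * (Q * s) * (A' * C) = 2 * C * (Q * s * A') := by ring
    have h5 : Q * s ≤ Q * s * A' := Nat.le_mul_of_pos_right _ hA'1
    rw [add_mul 2 (2 * C)]
    omega
  calc n * (A * (C * (1 + b + (n + 1) * (A * C))))
      ≤ Q * (A' * (C * ((2 + 2 * C) * (Q * s * A')))) := by gcongr
    _ = (K + 1) ^ 2 * (C * (2 + 2 * C)) * (Q ^ (4 * c.ℓ + 10) * s ^ 3) := by
      rw [hA']; ring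

theorem size_le_log (D : ℕ) : ((D.size + 1 : ℕ) : ℝ) ≤ 3 * (1 + Real.log (1 + D)) := by
  have hlog : 0 ≤ Real.log (1 + D) := Real.log_nonneg (by
    have : (0 : ℝ) ≤ D := by positivity
    linarith)
  rcases Nat.eq_zero_or_pos D with rfl | hD
  · norm_num
  · have h0 : 0 < D.size := Nat.size_pos.2 hD
    have h1 : 2 ^ (D.size - 1) ≤ D := Nat.lt_size.1 (by omega)
    have h1' : (2 : ℝ) ^ (D.size - 1) ≤ 1 + D := by
      have : (2 : ℝ) ^ (D.size - 1) ≤ D := by exact_mod_cast h1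
      linarith
    have h2 := Real.log_le_log (by positivity) h1'
    rw [Real.log_pow] at h2
    have h3 := Real.log_two_gt_d9
    have h4 : ((D.size - 1 : ℕ) : ℝ) + 1 = D.size := by
      exact_mod_cast Nat.succ_pred_eq_of_pos h0
    have h5 : (0 : ℝ) ≤ (D.size - 1 : ℕ) := by positivity
    push_cast
    nlinarith

/-- The total running time is polynomial in `Q` and `log Δ`. -/
theorem exists_time_const (c : Params) (hℓ : 1 ≤ c.ℓ) (C : ℕ) :
    ∃ K : ℝ, 0 ≤ K ∧ ∀ (n M k Q D b : ℕ) (τ : ℕ → ℕ) (Δ : ℝ), 1 ≤ Q → n ≤ Q → M ≤ Q → k ≤ Q →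
      b ≤ Q + D.size → (D : ℝ) ≤ Δ → (∀ t < n, τ t ≤ timeBound c C n M k b) →
      ((∑ t ∈ Finset.range n, τ t : ℕ) : ℝ) ≤
        K * (Q : ℝ) ^ (16 * c.ℓ) * (1 + Real.log (1 + Δ)) ^ 16 := by
  obtain ⟨K, hK⟩ := exists_timeBound_le c C
  refine ⟨K * 27, by positivity, fun n M k Q D b τ Δ hQ hn hM hk hb hD hτ => ?_⟩
  have h1 : ∑ t ∈ Finset.range n, τ t ≤ n * timeBound c C n M k b := by
    refine (Finset.sum_le_card_nsmul _ _ _ fun t ht => hτ t (Finset.mem_range.1 ht)).trans ?_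
    simp
  have h2 := hK n M k Q (D.size + 1) b hQ (by omega) hn hM hk (by nlinarith)
  have h3 : ((∑ t ∈ Finset.range n, τ t : ℕ) : ℝ) ≤
      K * ((Q : ℝ) ^ (4 * c.ℓ + 10) * ((D.size + 1 : ℕ) : ℝ) ^ 3) := by
    exact_mod_cast h1.trans h2
  have hD0 : (0 : ℝ) ≤ D := by positivity
  have hQ1 : (1 : ℝ) ≤ Q := by exact_mod_cast hQ
  have hlog : Real.log (1 + D) ≤ Real.log (1 + Δ) :=
    Real.log_le_log (by linarith) (by linarith)
  have hlog0 : 0 ≤ Real.log (1 + D) := Real.log_nonneg (by linarith)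
  set Λ := 1 + Real.log (1 + Δ)
  have hΛ : 1 ≤ Λ := by simp only [Λ]; linarith
  have h4 : ((D.size + 1 : ℕ) : ℝ) ≤ 3 * Λ := (size_le_log D).trans (by
    simp only [Λ]; linarith)
  calc ((∑ t ∈ Finset.range n, τ t : ℕ) : ℝ)
      ≤ K * ((Q : ℝ) ^ (4 * c.ℓ + 10) * ((D.size + 1 : ℕ) : ℝ) ^ 3) := h3
    -- 4ℓ + 10 ≤ 16ℓ because ℓ ≥ 1.
    _ ≤ K * ((Q : ℝ) ^ (16 * c.ℓ) * (3 * Λ) ^ 3) := by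
      gcongr
      omega
    _ = K * 27 * (Q : ℝ) ^ (16 * c.ℓ) * Λ ^ 3 := by ring
    _ ≤ K * 27 * (Q : ℝ) ^ (16 * c.ℓ) * Λ ^ 16 := by
      gcongr
      norm_num

end KMedianRAM

/-! ### The approximation guarantee along a run, and the choice of parameters -/

namespace KMedianOutliers

variable {X : Type} [MetricSpace X] {f x : ℕ → X}

theorem Trace.isBicriteria {c : Params} {n k z D M : ℕ} {Nf p R q : ℕ → ℕ} {S S₁ : ℕ → Finset ℕ}
    (h : Trace c (ndist f x) n k z D Nf p R q S S₁) (hpos : ∀ t < n, 1 ≤ Nf (t + 1))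
    (hM : ∀ t ≤ n, Nf t ≤ M) (hw : ∀ j < n, ∀ i < M, (ndist f x j i : ℝ) = dist (x j) (f i))
    (hk : 1 ≤ k) (hE : 2 ≤ c.E) (hℓ : 1 ≤ c.ℓ) (hden : 0 < c.den) {γ κ β α : ℝ} (hγ : 0 < γ)
    (hβ : (1 + 1 / (c.ℓ : ℝ)) * (1 + γ) ≤ (1 - 1 / (c.E : ℝ)) * (c.num / c.den : ℝ))
    (hβ' : (c.num / c.den : ℝ) ≤ β) (hκ0 : 0 ≤ κ)
    (hα : (3 + 2 / (c.ℓ : ℝ)) * (1 + 2 * κ / γ) ≤ (1 - 1 / (c.E : ℝ)) * α)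
    (hκ : ∀ t' t, 1 ≤ t' → t' ≤ t → t ≤ n →
      opt f x (Finset.range (Nf t')) (Finset.range t') k z ≤
        κ * opt f x (Finset.range (Nf t)) (Finset.range t) k z) {t : ℕ} (ht : t < n) :
    IsBicriteria f x (Finset.range (Nf (t + 1))) (Finset.range (t + 1)) k z β α (S (t + 1)) := by
  have hw' : ∀ t < n, ∀ j < t + 1, ∀ i < Nf (t + 1),
      (ndist f x j i : ℝ) = dist (x j) (f i) := fun t ht j hj i hi =>
    hw j (by omega) i (hi.trans_le (hM (t + 1) ht))
  have hne : ∀ t < n, ∀ T : Finset ℕ, T.card = min k (Nf (t + 1)) → T.Nonempty := by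
    intro t ht T hT
    rw [← Finset.card_pos, hT]
    have := hpos t ht
    omega
  -- The bound refers to the time `t'` of the last doubling. Passing on a bound by the current
  -- optimum at each arrival would multiply the factors `κ`; this way `κ` is paid once.
  have hpen : ∀ t ≤ n, p t = 1 ∨ ∃ t', 1 ≤ t' ∧ t' ≤ t ∧
      γ * ((1 + 1 / (c.ℓ : ℝ)) * (p t * z)) ≤ 2 * ((3 + 2 / (c.ℓ : ℝ)) *
        opt f x (Finset.range (Nf t')) (Finset.range t') k z) := by
    intro t
    induction t with
    | zero => exact fun _ => Or.inl h.penalty_zero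
    | succ t ih =>
      intro ht
      refine (h.path t ht).penalty_induction (fun r => r = 1 ∨ ∃ t', 1 ≤ t' ∧ t' ≤ t + 1 ∧
        γ * ((1 + 1 / (c.ℓ : ℝ)) * (r * z)) ≤ 2 * ((3 + 2 / (c.ℓ : ℝ)) *
          opt f x (Finset.range (Nf t')) (Finset.range t') k z)) ?_ (h.subset_range t ht) ?_
      · intro r T hT hTc hLO hv _
        have hTc' : T.card = min k (Nf (t + 1)) := by rw [hTc, h.card t ht]
        have hsol : IsSolution (Finset.range (Nf (t + 1))) k T :=
          ⟨hT, by rw [hTc', Finset.card_range]⟩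
        have h1 := LocalOpt.pcost_le (z := z) (hw' t ht) hLO hsol (hne t ht T hTc') (by omega) hℓ
        have h2 := hv.le_opt hβ hden (by omega) h1
        refine Or.inr ⟨t + 1, by omega, le_rfl, ?_⟩
        push_cast
        linarith
      · rcases ih (by omega) with h1 | ⟨t', h1, h2, h3⟩
        · exact Or.inl h1
        · exact Or.inr ⟨t', h1, by omega, h3⟩
  have hsol := h.isSolution ht
  refine KMedianOutliers.isBicriteria (γ := γ) (κ := 2 * κ) (hw' t ht) (h.path t ht).localOpt
    (h.path t ht).not_violated hsol
    (hne t ht _ (by rw [hsol.2, Finset.card_range])) hE hℓ hden hγ hβ' (by positivity) hα ?_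
  refine (hpen (t + 1) ht).imp id ?_
  rintro ⟨t', h1, h2, h3⟩
  refine h3.trans ?_
  have h4 := hκ t' (t + 1) h1 h2 ht
  have h5 : (0 : ℝ) ≤ 3 + 2 / (c.ℓ : ℝ) := by positivity
  have h6 := mul_le_mul_of_nonneg_left h4 h5
  linarith

theorem exists_params (ℓ : ℕ) {ε γ : ℝ} (hε : 0 < ε) (hε1 : ε < 1) (hγ : 0 < γ) :
    ∃ c : Params, c.ℓ = ℓ ∧ 2 ≤ c.E ∧ (c.E : ℝ) ≤ 2 / ε ∧ 0 < c.den ∧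
      (c.num / c.den : ℝ) ≤ 1 / (1 - ε) * (1 + 1 / (ℓ : ℝ)) * (1 + γ) ∧
      (1 + 1 / (ℓ : ℝ)) * (1 + γ) ≤ (1 - 1 / (c.E : ℝ)) * (c.num / c.den : ℝ) ∧
      ∀ a : ℝ, 0 ≤ a → a ≤ (1 - 1 / (c.E : ℝ)) * (1 / (1 - ε) * a) := by
  -- The strict inequality 1/E < ε leaves a gap for a rational outlier ratio, which the program can
  -- test with integers, while E ≤ 2/ε keeps the recourse bound.
  set E := ⌊1 / ε⌋₊ + 1 with hE
  have h1 : 1 / ε < E := by rw [hE]; exact_mod_cast Nat.lt_floor_add_one (1 / ε)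
  have h1' : 1 < 1 / ε := by rw [lt_div_iff₀ hε]; linarith
  have hE1 : (1 : ℝ) < E := h1'.trans h1
  have hE2 : 2 ≤ E := by
    have : 1 < E := by exact_mod_cast hE1
    omega
  have h2 : (E : ℝ) ≤ 2 / ε := by
    have : (⌊1 / ε⌋₊ : ℝ) ≤ 1 / ε := Nat.floor_le (by positivity)
    have h3 : (2 : ℝ) / ε = 1 / ε + 1 / ε := by ring
    rw [hE, h3]
    push_cast
    linarith
  have hEε : 1 / (E : ℝ) < ε := by
    rw [div_lt_iff₀ (by linarith)]
    rw [div_lt_iff₀ hε] at h1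
    linarith
  have hpos : 0 < 1 - ε := by linarith
  have hpos' : 0 < 1 - 1 / (E : ℝ) := by linarith
  set B : ℝ := (1 + 1 / (ℓ : ℝ)) * (1 + γ) with hB
  have hB0 : 0 < B := by positivity
  have hlt : B / (1 - 1 / (E : ℝ)) < 1 / (1 - ε) * B := by
    rw [div_eq_mul_one_div, mul_comm]
    refine mul_lt_mul_of_pos_right ?_ hB0
    exact one_div_lt_one_div_of_lt hpos (by linarith)
  obtain ⟨r, hr1, hr2⟩ := exists_rat_btwn hlt
  have hr0 : 0 < r := by
    have : (0 : ℝ) < r := lt_trans (by positivity) hr1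
    exact_mod_cast this
  have hr : ((r.num.toNat : ℕ) : ℝ) / (r.den : ℝ) = r := by
    have h3 : ((r.num.toNat : ℕ) : ℤ) = r.num := Int.toNat_of_nonneg (Rat.num_pos.2 hr0).le
    have h4 : ((r.num.toNat : ℕ) : ℝ) = (r.num : ℝ) := by exact_mod_cast h3
    rw [h4]
    exact_mod_cast r.num_div_den
  refine ⟨⟨E, ℓ, r.num.toNat, r.den⟩, rfl, hE2, h2, r.den_pos, ?_, ?_, fun a ha => ?_⟩
  · simp only
    rw [hr, mul_assoc]
    exact hr2.le
  · simp only
    rw [hr]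
    rw [div_lt_iff₀ hpos'] at hr1
    linarith
  · simp only
    rw [← mul_assoc, mul_one_div]
    have : 1 ≤ (1 - 1 / (E : ℝ)) / (1 - ε) := by
      rw [le_div_iff₀ hpos]; linarith
    nlinarith

/-- Only distances between points and locations are stored, so the triangle inequality appears as a
path through a location and another point. -/
theorem ndist_four_point {n M : ℕ}
    (hw : ∀ j < n, ∀ i < M, (ndist f x j i : ℝ) = dist (x j) (f i)) :
    ∀ j < n, ∀ j' < n, ∀ c < M, ∀ s < M,
      ndist f x j s ≤ ndist f x j c + ndist f x j' c + ndist f x j' s := by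
  intro j hj j' hj' c hc s hs
  have h : (ndist f x j s : ℝ) ≤ ndist f x j c + ndist f x j' c + ndist f x j' s := by
    rw [hw j hj s hs, hw j hj c hc, hw j' hj' c hc, hw j' hj' s hs]
    have h1 := dist_triangle (x j) (f c) (f s)
    have h2 := dist_triangle_left (f c) (f s) (x j')
    linarith
  exact_mod_cast h

theorem IntegralDist.ndist_eq {A : Set X} (hA : IntegralDist A) {j i : ℕ} (hj : x j ∈ A)
    (hi : f i ∈ A) : (ndist f x j i : ℝ) = dist (x j) (f i) := by
  obtain ⟨a, ha⟩ := hA _ hj _ hi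
  rw [ndist, ha, Nat.floor_natCast]

theorem ndist_le_floor_diam {A : Set X} (hA : A.Finite) {j i : ℕ} (hj : x j ∈ A)
    (hi : f i ∈ A) : ndist f x j i ≤ ⌊Metric.diam A⌋₊ :=
  Nat.floor_le_floor (Metric.dist_le_diam_of_mem hA.isBounded hj hi)

theorem recourse_congr {S T : ℕ → Finset ℕ} {n : ℕ} (h : ∀ t ≤ n, S t = T t) :
    recourse S n = recourse T n := by
  refine Finset.sum_congr rfl fun t ht => ?_
  rw [Finset.mem_range] at ht
  rw [h t ht.le, h (t + 1) ht]

theorem size_le_self (n : ℕ) : n.size ≤ n := Nat.size_le.2 Nat.lt_two_pow_self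

end KMedianOutliers

/-! ### The two settings -/

namespace KMedianRAM

open KMedianOutliers

variable {X : Type} [MetricSpace X] {f x : ℕ → X}

/-- The properties of the algorithm, for both settings: `Nf t` is the number of locations after
`t` arrivals. -/
theorem run_spec (c : Params) {ε γ κ β : ℝ} (hE : 2 ≤ c.E) (hEε : (c.E : ℝ) ≤ 2 / ε)
    (hε : 0 < ε) (hℓ : 1 ≤ c.ℓ) (hden : 0 < c.den) (hγ : 0 < γ) (hκ0 : 0 ≤ κ)
    (hβ : (1 + 1 / (c.ℓ : ℝ)) * (1 + γ) ≤ (1 - 1 / (c.E : ℝ)) * (c.num / c.den : ℝ))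
    (hβ' : (c.num / c.den : ℝ) ≤ β) (hεE : ∀ a : ℝ, 0 ≤ a →
      a ≤ (1 - 1 / (c.E : ℝ)) * (1 / (1 - ε) * a)) (locs : Expr) (store : Prog)
    (hwr : store.writes ⊆ {3, 11}) :
    ∃ K : ℝ, ∀ (X : Type) [MetricSpace X] (f x : ℕ → X) (A : Set X) (Nf len : ℕ → ℕ)
      (n m k z M Q : ℕ), A.Finite → IntegralDist A → (∀ j < n, x j ∈ A) → (∀ i < M, f i ∈ A) →
      Nf 0 = 0 → (∀ t < n, Nf t ≤ Nf (t + 1)) → (∀ t < n, 1 ≤ Nf (t + 1)) →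
      (∀ t ≤ n, Nf t ≤ M) → 1 ≤ k → 1 ≤ Q → n ≤ Q → m ≤ Q → M ≤ Q → k ≤ Q → z ≤ Q →
      (∀ t < n, len t ≤ M) →
      (∀ t < n, ∀ s : Store, s 1 0 = m → s 7 0 = t → locs.eval s = Nf (t + 1)) →
      (∀ t < n, ∀ s : Store, s 7 0 = t → s 8 0 = Nf (t + 1) →
        (∀ u ≤ Nf (t + 1) + t, s 4 u = tri u) →
        (∀ j < t, ∀ i < Nf t, s 3 (addr i j) = ndist f x j i) →
        (∀ i, s 0 i = if i < len t then ndist f x t i else 0) →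
        Runs store s (2 + Nf (t + 1) * 4) fun s' =>
          ∀ j < t + 1, ∀ i < Nf (t + 1), s' 3 (addr i j) = ndist f x j i) →
      (∀ t' t, 1 ≤ t' → t' ≤ t → t ≤ n →
        opt f x (Finset.range (Nf t')) (Finset.range t') k z ≤
          κ * opt f x (Finset.range (Nf t)) (Finset.range t) k z) →
      ∃ (σ : ℕ → Store) (τ : ℕ → ℕ),
        IsOnlineRun (arriveProg c locs store) (initStore m k z) len (ndist f x) n σ τ ∧
        (∀ t ≤ n, ∀ i, Nf t ≤ i → σ t 2 i = 0) ∧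
        (∀ t, 1 ≤ t → t ≤ n → IsBicriteria f x (Finset.range (Nf t)) (Finset.range t) k z β
          (1 / (1 - ε) * (3 + 2 / (c.ℓ : ℝ)) * (1 + 2 * κ / γ)) (cellSet (σ t) 2 (Nf t))) ∧
        (2 ≤ n → 1 ≤ Metric.diam A → (recourse (fun t => cellSet (σ t) 2 (Nf t)) n : ℝ) ≤
          800 * ((k : ℝ) ^ 2 * Real.log n * Real.log (n * Metric.diam A) / ε)) ∧
        ((∑ t ∈ Finset.range n, τ t : ℕ) : ℝ) ≤
          K * (Q : ℝ) ^ (16 * c.ℓ) * (1 + Real.log (1 + Metric.diam A)) ^ 16 := by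
  obtain ⟨K, hK0, hK⟩ := exists_time_const c hℓ (arriveProg c locs store).weight
  refine ⟨K, ?_⟩
  intro X _ f x A Nf len n m k z M Q hfin hint hxA hfA hN0 hmono hpos hM hk hQ hnQ hmQ hMQ hkQ hzQ
    hlen hlocs hstore hκ
  set D := ⌊Metric.diam A⌋₊ with hDdef
  have hDle : (D : ℝ) ≤ Metric.diam A := Nat.floor_le Metric.diam_nonneg
  have hw : ∀ j < n, ∀ i < M, (ndist f x j i : ℝ) = dist (x j) (f i) := fun j hj i hi =>
    hint.ndist_eq (hxA j hj) (hfA i hi)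
  have hwD : ∀ j < n, ∀ i < M, ndist f x j i ≤ D := fun j hj i hi =>
    ndist_le_floor_diam hfin (hxA j hj) (hfA i hi)
  obtain ⟨σ, τ, p, R, q, S₁, hrun, hp0, hS0, hrest, hpath⟩ := exists_run c (b := Q + D.size)
    hN0 hmono hpos hM hwD hk hwr hlocs hstore
    (fun t ht i hi => (Nat.size_le_size (hwD t ht i (hi.trans_le (hlen t ht)))).trans
      (Nat.le_add_left _ _))
    ((size_le_self m).trans (by omega)) ((size_le_self k).trans (by omega))
    ((size_le_self z).trans (by omega)) (Nat.le_add_left _ _) (z := z)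
  have htr : Trace c (ndist f x) n k z D Nf p R q (fun t => cellSet (σ t) 2 (Nf t)) S₁ :=
    ⟨hp0, hS0, fun t ht => (hrest t ht).2, fun t ht => (hpath t ht).1,
      fun t ht => (hpath t ht).2.1, fun t ht => (hpath t ht).2.2.1,
      fun t ht => (hpath t ht).2.2.2.1⟩
  refine ⟨σ, τ, hrun, fun t ht => (hrest t ht).1, fun t ht1 htn => ?_, fun hn hD1 => ?_,
    hK n M k Q D _ τ _ hQ hnQ hMQ hkQ le_rfl hDle fun t ht => (hpath t ht).2.2.2.2⟩
  · obtain ⟨t, rfl⟩ : ∃ t', t = t' + 1 := ⟨t - 1, by omega⟩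
    refine htr.isBicriteria hpos hM hw hk hE hℓ hden hγ hβ hβ' hκ0 ?_ hκ htn
    have := hεE ((3 + 2 / (c.ℓ : ℝ)) * (1 + 2 * κ / γ)) (by positivity)
    rwa [← mul_assoc (1 / (1 - ε))] at this
  · have hD1' : 1 ≤ D := Nat.le_floor (by exact_mod_cast hD1)
    have h1 := htr.recourse_le_log hM (ndist_four_point hw) hn hD1' hk (by omega)
    refine h1.trans ?_
    have hn' : (2 : ℝ) ≤ n := by exact_mod_cast hn
    have hD' : (1 : ℝ) ≤ D := by exact_mod_cast hD1'
    have hL1 : 0 ≤ Real.log n := Real.log_nonneg (by linarith)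
    have hL2 : Real.log (n * D) ≤ Real.log (n * Metric.diam A) :=
      Real.log_le_log (by positivity) (by gcongr)
    have hL2' : 0 ≤ Real.log (n * D) := Real.log_nonneg (by nlinarith)
    calc 400 * ((k : ℝ) ^ 2 * c.E * (Real.log n * Real.log (n * D)))
        ≤ 400 * ((k : ℝ) ^ 2 * (2 / ε) * (Real.log n * Real.log (n * Metric.diam A))) := by
          gcongr
      _ = _ := by ring

end KMedianRAM

open KMedianRAM KMedianOutliers in
theorem mainTheorem1 :
    ∃ (ε₀ A : ℝ) (c : ℕ), 0 < ε₀ ∧ ε₀ ≤ 1 ∧ 0 < A ∧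
      ∀ (ℓ : ℕ) (ε γ : ℝ), 1 ≤ ℓ → 0 < ε → ε < ε₀ → 0 < γ →
        -- the static `F` setting
        (∃ (P : Prog) (K : ℝ), ∀ (X : Type) [MetricSpace X] (f x : ℕ → X) (m n k z : ℕ),
          1 ≤ k → k ≤ m → z ≤ n →
          IntegralDist (f '' Set.Iio m ∪ x '' Set.Iio n) →
          ∃ (σ : ℕ → Store) (τ : ℕ → ℕ),
            IsOnlineRun P (initStore m k z) (fun _ => m)
              (fun t i => ⌊dist (x t) (f i)⌋₊) n σ τ ∧
            (∀ t, 1 ≤ t → t ≤ n →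
              IsBicriteria f x (Finset.range m) (Finset.range t) k z
                (1 / (1 - ε) * (1 + 1 / (ℓ : ℝ)) * (1 + γ))
                (1 / (1 - ε) * (3 + 2 / (ℓ : ℝ)) * (1 + 2 / γ))
                (medians (σ t) m)) ∧
            (2 ≤ n → 1 ≤ Metric.diam (f '' Set.Iio m ∪ x '' Set.Iio n) →
              (recourse (fun t => medians (σ t) m) n : ℝ) ≤
                A * ((k : ℝ) ^ 2 * Real.log n *
                  Real.log (n * Metric.diam (f '' Set.Iio m ∪ x '' Set.Iio n)) / ε)) ∧
            ((∑ t ∈ Finset.range n, τ t : ℕ) : ℝ) ≤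
              K * ((n : ℝ) + m) ^ (c * ℓ) *
                (1 + Real.log (1 + Metric.diam (f '' Set.Iio m ∪ x '' Set.Iio n))) ^ c) ∧
        -- the `F = C` setting
        (∃ (P : Prog) (K : ℝ), ∀ (X : Type) [MetricSpace X] (x : ℕ → X) (n k z : ℕ),
          1 ≤ k → k ≤ n → z ≤ n →
          IntegralDist (x '' Set.Iio n) →
          ∃ (σ : ℕ → Store) (τ : ℕ → ℕ),
            IsOnlineRun P (initStore 0 k z) (fun t => t)
              (fun t i => ⌊dist (x t) (x i)⌋₊) n σ τ ∧
            (∀ t, 1 ≤ t → t ≤ n →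
              IsBicriteria x x (Finset.range t) (Finset.range t) k z
                (1 / (1 - ε) * (1 + 1 / (ℓ : ℝ)) * (1 + γ))
                (1 / (1 - ε) * (3 + 2 / (ℓ : ℝ)) * (1 + 4 / γ))
                (medians (σ t) t)) ∧
            (2 ≤ n → 1 ≤ Metric.diam (x '' Set.Iio n) →
              (recourse (fun t => medians (σ t) t) n : ℝ) ≤
                A * ((k : ℝ) ^ 2 * Real.log n *
                  Real.log (n * Metric.diam (x '' Set.Iio n)) / ε)) ∧
            ((∑ t ∈ Finset.range n, τ t : ℕ) : ℝ) ≤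
              K * (n : ℝ) ^ (c * ℓ) *
                (1 + Real.log (1 + Metric.diam (x '' Set.Iio n))) ^ c) := by
  refine ⟨1, 800, 16, one_pos, le_rfl, by norm_num, fun ℓ ε γ hℓ hε hε1 hγ => ?_⟩
  obtain ⟨c, rfl, hE, hEε, hden, hβ', hβ, hεE⟩ := exists_params ℓ hε hε1 hγ
  constructor
  · obtain ⟨K, hK⟩ := run_spec c hE hEε hε hℓ hden hγ zero_le_one hβ hβ' hεE
      (.get 1 (.const 0)) storeStatic (by simp [storeStatic, Finset.pair_comm])
    refine ⟨arriveProg c (.get 1 (.const 0)) storeStatic, K, fun X _ f x m n k z hk hkm hzn hA => ?_⟩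
    -- No locations are counted before the first arrival, so that both settings start from the empty
    -- solution with `Nf 0 = 0`.
    have hNf : ∀ t, 1 ≤ t → (if t = 0 then 0 else m) = m := fun t ht => if_neg (by omega)
    obtain ⟨σ, τ, hrun, hz, happ, hrec, htime⟩ := hK X f x (f '' Set.Iio m ∪ x '' Set.Iio n)
      (fun t => if t = 0 then 0 else m) (fun _ => m) n m k z m (n + m)
      (((Set.finite_Iio m).image f).union ((Set.finite_Iio n).image x)) hA
      (fun j hj => .inr ⟨j, hj, rfl⟩) (fun i hi => .inl ⟨i, hi, rfl⟩) rfl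
      (fun t _ => by rw [hNf (t + 1) (by omega)]; split_ifs <;> omega)
      (fun t _ => by rw [hNf (t + 1) (by omega)]; omega)
      (fun t _ => by split_ifs <;> omega) hk (by omega) (by omega) (by omega) (by omega)
      (by omega) (by omega) (fun _ _ => le_rfl)
      (fun t _ s h1 _ => by rw [hNf (t + 1) (by omega)]; exact h1)
      (fun t _ s ht hN h4 h h0 => by
        rw [hNf (t + 1) (by omega)] at *
        refine runs_storeStatic ht hN h4 (fun i hi => by rw [h0, if_pos hi]) fun j hj i hi => ?_
        exact h j hj i (by rwa [hNf t (by omega)]))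
      (fun t' t h1 h2 _ => by
        rw [hNf t' h1, hNf t (h1.trans h2), one_mul]
        exact opt_mono (Finset.range_mono h2))
    have hmed : ∀ t ≤ n, medians (σ t) m = cellSet (σ t) 2 (if t = 0 then 0 else m) :=
      fun t ht => cellSet_of_zero (by split_ifs <;> omega) (hz t ht)
    refine ⟨σ, τ, hrun, fun t h1 htn => ?_, fun hn hD => ?_, ?_⟩
    · have := happ t h1 htn
      rw [← hmed t htn, mul_one, hNf t h1] at this
      exact this
    · rw [recourse_congr hmed]
      exact hrec hn hD
    · push_cast at htime ⊢
      exact htime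
  · obtain ⟨K, hK⟩ := run_spec c hE hEε hε hℓ hden hγ zero_le_two hβ hβ' hεE
      (.add (var 7) (.const 1)) storeDynamic (by simp [storeDynamic, Finset.pair_comm])
    refine ⟨arriveProg c (.add (var 7) (.const 1)) storeDynamic, K,
      fun X _ x n k z hk hkn hzn hA => ?_⟩
    obtain ⟨σ, τ, hrun, hz, happ, hrec, htime⟩ := hK X x x (x '' Set.Iio n)
      (fun t => t) (fun t => t) n 0 k z n n
      ((Set.finite_Iio n).image x) hA
      (fun j hj => ⟨j, hj, rfl⟩) (fun i hi => ⟨i, hi, rfl⟩) rfl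
      (fun t _ => Nat.le_succ t) (fun t _ => Nat.succ_pos t) (fun t ht => ht) hk (by omega)
      le_rfl (by omega) le_rfl hkn hzn (fun t ht => ht.le)
      (fun t _ s _ h7 => by simp [var, Expr.eval, h7])
      (fun t _ s ht hN h4 h h0 => runs_storeDynamic ht hN h4
        (fun i hi => by
          rw [h0]
          split_ifs with hit
          · rfl
          -- The input row of point `t` has only `t` entries; the empty cell `t` reads 0, which is
          -- the distance of the point to itself.
          · obtain rfl : i = t := by omega
            simp [ndist])
        (fun i _ => by rw [ndist, ndist, dist_comm]) h)
      (fun t' t h1 h2 _ => opt_self_le_two_mul (Finset.range_mono h2)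
        ⟨0, Finset.mem_range.2 h1⟩ hk)
    refine ⟨σ, τ, hrun, fun t h1 htn => ?_, hrec, htime⟩
    have := happ t h1 htn
    rwa [show (2 : ℝ) * 2 = 4 by norm_num] at this
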